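/- Let $n\ge 1$. Cubes in $\mathbb R^n$ have sides parallel to the axes, and $\frac{1}{|Q|}\int_Q$ denotes the average over a cube $Q$. Let $Mf(x)=\sup_{Q\ni x}\frac1{|Q|}\int_Q|f|$ be the Hardy--Littlewood maximal function (supremum over all cubes containing $x$). A weight is a locally integrable function $w$ on $\mathbb R^n$ with $w>0$ a.e., and $w(E):=\int_E w$. For $1<p<\infty$ put $p'=\frac p{p-1}$, $\sigma=w^{1-p'}$, $$[w]_{A_p}=\sup_Q\Big(\frac1{|Q|}\int_Q w\Big)\Big(\frac1{|Q|}\int_Q w^{1-p'}\Big)^{p-1},\qquad [\sigma]_{A_\infty}=\sup_Q\frac1{\sigma(Q)}\int_Q M(\sigma\chi_Q),$$ and write $w\in A_p$ if $[w]_{A_p}<\infty$. For $q\in(0,\infty)$ let $$\|f\|_{L^{p,q}(w)}=\Big(p\int_0^\infty s^q\,w(\{|f|>s\})^{q/p}\,\frac{ds}{s}\Big)^{1/q},\qquad \|f\|_{L^{p,\infty}(w)}=\sup_{s>0}s\,w(\{|f|>s\})^{1/p},$$ and let $\|M\|_{L^{p,q}(w)}$ be the supremum of $\|Mf\|_{L^{p,q}(w)}/\|f\|_{L^{p,q}(w)}$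 over all $f\in L^{p,q}(w)$, $f\ne0$. (1) For every $n\ge1$ and $q\in(0,\infty]$ there is a finite constant $C_{q,n}$, depending only on $q$ and $n$, such that for all $p\in(1,\infty)$ and all $w\in A_p$, $$\|M\|_{L^{p,q}(w)}\le C_{q,n}\,(p')^{\frac1{\min(p,q)}}\,[w]_{A_p}^{\frac1p}\,[\sigma]_{A_\infty}^{\frac1{\min(p,q)}}.$$ (2) The exponents of both weight constants are optimal: for every $n\ge1$, $p\in(1,\infty)$ and $q\in(0,\infty]$, if $\alpha<\frac1p$, then there is no finite constant $C$ (even depending on $n,p,q,\alpha$) with $\|M\|_{L^{p,q}(w)}\le C[w]_{A_p}^{\alpha}[\sigma]_{A_\infty}^{1/\min(p,q)}$ for all $w\in A_p$; and if $\beta<\frac1{\min(p,q)}$, then there is no finite constant $C$ (even depending on $n,p,q,\beta$) with $\|M\|_{L^{p,q}(w)}\le C[w]_{A_p}^{1/p}[\sigma]_{A_\infty}^{\beta}$ for all $w\in A_p$. Moreover, for $n=1$ the following families of weights, $0<\delta<1$, are contained in $A_p$, and neither estimate in (2) holds with one finite constant for all weights of the family: if $p\le q$, the weights $|x|^{(p-1)(1-\delta)}$;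 if $q\le p$, the weights equal to $\delta^{p-1}$ on $[-1,1]$ and to $|x|^{(1-\delta)(p-1)}$ outside $[-1,1]$. -/

import Mathlib

open MeasureTheory Set
open scoped ENNReal NNReal

noncomputable section

namespace WeightedLorentz

/-- `Q` is a (nondegenerate, closed) cube in `ℝⁿ` with sides parallel to the coordinate axes. -/
def IsCube {n : ℕ} (Q : Set (Fin n → ℝ)) : Prop :=
  ∃ (a : Fin n → ℝ) (l : ℝ), 0 < l ∧ Q = Set.Icc a (fun i => a i + l)

/-- The Hardy--Littlewood maximal function: the supremum of the averages of `|f|` over all cubes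
containing `x`. -/
def maximalFn {n : ℕ} (f : (Fin n → ℝ) → ℝ) (x : Fin n → ℝ) : ℝ≥0∞ :=
  ⨆ (Q : Set (Fin n → ℝ)) (_ : IsCube Q) (_ : x ∈ Q), ⨍⁻ y in Q, ‖f y‖ₑ ∂volume

/-- A weight on `ℝⁿ`: a locally integrable function that is positive almost everywhere. -/
structure IsWeight {n : ℕ} (w : (Fin n → ℝ) → ℝ) : Prop where
  locallyIntegrable : LocallyIntegrable w volume
  pos : ∀ᵐ x ∂volume, 0 < w x

/-- The measure `w(E) = ∫_E w(x) dx`. -/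
def weightMeasure {n : ℕ} (w : (Fin n → ℝ) → ℝ) : Measure (Fin n → ℝ) :=
  volume.withDensity (fun x => ENNReal.ofReal (w x))

/-- The dual weight `σ = w ^ (1 - p')`, where `p' = p / (p - 1)`. -/
def dualWeight {n : ℕ} (p : ℝ) (w : (Fin n → ℝ) → ℝ) : (Fin n → ℝ) → ℝ :=
  fun x => w x ^ (1 - p.conjExponent)

/-- The `A_p` constant `[w]_{A_p}`. -/
def apConst {n : ℕ} (p : ℝ) (w : (Fin n → ℝ) → ℝ) : ℝ≥0∞ :=
  ⨆ (Q : Set (Fin n → ℝ)) (_ : IsCube Q),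
    (⨍⁻ x in Q, ENNReal.ofReal (w x) ∂volume) *
      (⨍⁻ x in Q, ENNReal.ofReal (dualWeight p w x) ∂volume) ^ (p - 1)

/-- The Muckenhoupt class `A_p` on `ℝⁿ`. -/
def apClass (n : ℕ) (p : ℝ) : Set ((Fin n → ℝ) → ℝ) :=
  {w | IsWeight w ∧ apConst p w < ∞}

/-- The (Fujii--Wilson) `A_∞` constant: the supremum over all cubes `Q` of
`w(Q)⁻¹ ∫_Q M(w χ_Q) dx`. -/
def aInftyConst {n : ℕ} (w : (Fin n → ℝ) → ℝ) : ℝ≥0∞ :=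
  ⨆ (Q : Set (Fin n → ℝ)) (_ : IsCube Q),
    (∫⁻ x in Q, maximalFn (Q.indicator w) x ∂volume) / weightMeasure w Q

/-- The Lorentz (quasi-)norm of a `[0,∞]`-valued function `g` in `L^{p,q}(w)`, `q ∈ (0,∞]`,
through the distribution function:
`(p ∫₀^∞ s^q w({g > s})^{q/p} ds/s)^{1/q}` for `q < ∞`, `sup_{s>0} s w({g > s})^{1/p}` for
`q = ∞`. -/
def lorentzNorm {n : ℕ} (p : ℝ) (q : ℝ≥0∞) (w : (Fin n → ℝ) → ℝ)
    (g : (Fin n → ℝ) → ℝ≥0∞) : ℝ≥0∞ :=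
  if q = ∞ then
    ⨆ (s : ℝ) (_ : 0 < s),
      ENNReal.ofReal s * weightMeasure w {x | ENNReal.ofReal s < g x} ^ (1 / p)
  else
    (ENNReal.ofReal p * ∫⁻ s in Set.Ioi (0 : ℝ),
      ENNReal.ofReal s ^ q.toReal *
        weightMeasure w {x | ENNReal.ofReal s < g x} ^ (q.toReal / p) / ENNReal.ofReal s)
      ^ (1 / q.toReal)

/-- The operator norm `‖M‖_{L^{p,q}(w)}`: the supremum of `‖M f‖ / ‖f‖` over all nonzero (classes
of) functions `f` in `L^{p,q}(w)`. -/
def maximalNorm {n : ℕ} (p : ℝ) (q : ℝ≥0∞) (w : (Fin n → ℝ) → ℝ) : ℝ≥0∞ :=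
  ⨆ (f : (Fin n → ℝ) → ℝ) (_ : AEStronglyMeasurable f volume) (_ : ¬ f =ᵐ[volume] 0)
    (_ : lorentzNorm p q w (fun x => ‖f x‖ₑ) < ∞),
    lorentzNorm p q w (maximalFn f) / lorentzNorm p q w (fun x => ‖f x‖ₑ)

/-- The exponent `1 / min(p, q)`. -/
def invMin (p : ℝ) (q : ℝ≥0∞) : ℝ := 1 / (min (ENNReal.ofReal p) q).toReal

/-- For fixed `p` and `q`, the estimate
`‖M‖_{L^{p,q}(w)} ≤ C [w]_{A_p}^α [σ]_{A_∞}^β` holds with one finite constant `C` for all weights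
`w` in the family `W`. -/
def MixedBoundOn {n : ℕ} (p : ℝ) (q : ℝ≥0∞) (α β : ℝ) (W : Set ((Fin n → ℝ) → ℝ)) : Prop :=
  ∃ C : ℝ≥0, ∀ w ∈ W,
    maximalNorm p q w ≤ C * apConst p w ^ α * aInftyConst (dualWeight p w) ^ β

/-- The weights `|x|^{(p-1)(1-δ)}` on `ℝ`, `0 < δ < 1`. -/
def buckleyWeights (p : ℝ) : Set ((Fin 1 → ℝ) → ℝ) :=
  (fun (δ : ℝ) (x : Fin 1 → ℝ) => |x 0| ^ ((p - 1) * (1 - δ))) '' Set.Ioo 0 1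

/-- The weights on `ℝ` equal to `δ^{p-1}` on `[-1,1]` and to `|x|^{(1-δ)(p-1)}` outside,
`0 < δ < 1`. -/
def truncatedWeights (p : ℝ) : Set ((Fin 1 → ℝ) → ℝ) :=
  (fun (δ : ℝ) (x : Fin 1 → ℝ) =>
    if |x 0| ≤ 1 then δ ^ (p - 1) else |x 0| ^ ((1 - δ) * (p - 1))) '' Set.Ioo 0 1

end WeightedLorentz

end

noncomputable section

namespace WeightedLorentz

open Metric Filter Topology

variable {n : ℕ}

/-! ### Cubes as closed balls of the supremum norm -/

/-! Upper bound. Cubes are closed balls of the supremum norm, so Vitali's covering lemma applies to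
them. Let σ = w^(1-p'). The sharp reverse Hölder inequality `setLAverage_rpow_le` raises the
integrability of σ to 1+ε, uniformly over cubes, with ε comparable to 1/[σ]_{A_∞}. Inserted in the
definition of [w]_{A_p}, it shows that w satisfies an A_s condition with s = 1+(p-1)/(1+ε) < p and
constant at most 2^(p-1)[w]_{A_p}. Hölder and Vitali turn this into weak type (s,s) with respect to
w (`mul_measure_lt_supAverage_le`). Cutting f at height a then gives w{Mf > 2a} ≤ B Σ_k 2^((k+1)s)
w{|f| > 2^k a} (`measure_lt_supAverage_le_tsum`).

The Lorentz functional of such a series is summed in `distNorm_le_of_le_tsum`, by subadditivity of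
t^(q/p) if q ≤ p and by Minkowski in L^(q/p) if q ≥ p. What remains is a geometric series of size
about p/(min(p,q)(p-s)), raised to the power 1/min(p,q). Since p/(p-s) = p'(1+1/ε), this is the
source of both p' and [σ]_{A_∞}.

Optimality. It is enough to find weights w_δ with [w_δ]_{A_p} ≲ δ^(-(p-1)), [σ_δ]_{A_∞} ≲ δ^(-1) and
‖M‖ ≳ δ^(-γ), where γ = (p-1)/p + 1/min(p,q): lowering either exponent makes the right-hand side
o(δ^(-γ)) as δ → 0. Both families have a radially decreasing σ which is an A_1 weight with constant
O(1/δ), and this bounds both weight constants. For q ≥ p take σ = |x|^(-n(1-δ)) and f = σ on the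
unit cube, so that Mf ≥ f/δ. For q ≤ p flatten σ to 1/δ on the unit cube and take f to be its
indicator: ‖f‖ is of order at most δ^((p-1)/p), while the tail |x|^(-n) of Mf nearly fails to be in
the space and has norm at least of order δ^(-1/q). -/

theorem icc_eq_closedBall (a : Fin n → ℝ) {l : ℝ} (hl : 0 < l) :
    Icc a (fun i => a i + l) = closedBall (fun i => a i + l / 2) (l / 2) := by
  ext x
  simp only [mem_Icc, mem_closedBall, Pi.le_def]
  rw [dist_pi_le_iff (by positivity)]
  simp only [Real.dist_eq, abs_le]
  constructor
  · rintro ⟨h1, h2⟩ i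
    have := h1 i
    have := h2 i
    constructor <;> linarith
  · intro h
    constructor <;> intro i <;> have := h i <;> linarith [this.1, this.2]

theorem isCube_closedBall (c : Fin n → ℝ) {r : ℝ} (hr : 0 < r) : IsCube (closedBall c r) := by
  refine ⟨fun i => c i - r, 2 * r, by positivity, ?_⟩
  rw [icc_eq_closedBall _ (by positivity)]
  congr 1
  · ext i; simp
  · ring

theorem IsCube.exists_eq_closedBall {Q : Set (Fin n → ℝ)} (hQ : IsCube Q) :
    ∃ c r, 0 < r ∧ Q = closedBall c r := by
  obtain ⟨a, l, hl, rfl⟩ := hQ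
  exact ⟨_, _, by positivity, icc_eq_closedBall a hl⟩

theorem volume_closedBall_eq (c : Fin n → ℝ) {r : ℝ} (hr : 0 ≤ r) :
    volume (closedBall c r) = ENNReal.ofReal (2 * r) ^ n := by
  rw [Real.volume_pi_closedBall c hr, Fintype.card_fin, ENNReal.ofReal_pow (by positivity)]

theorem volume_closedBall_ne_zero (c : Fin n → ℝ) {r : ℝ} (hr : 0 < r) :
    volume (closedBall c r) ≠ 0 := (measure_closedBall_pos _ _ hr).ne'

theorem volume_closedBall_ne_top (c : Fin n → ℝ) (r : ℝ) :
    volume (closedBall c r) ≠ ∞ := measure_closedBall_lt_top.ne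

theorem volume_closedBall_mul (c c' : Fin n → ℝ) {t r : ℝ} (ht : 0 ≤ t) (hr : 0 ≤ r) :
    volume (closedBall c' (t * r)) = ENNReal.ofReal t ^ n * volume (closedBall c r) := by
  rw [volume_closedBall_eq _ (by positivity), volume_closedBall_eq _ hr, ← mul_pow,
    ← ENNReal.ofReal_mul ht]
  congr 2
  ring

theorem setLAverage_closedBall (g : (Fin n → ℝ) → ℝ≥0∞) (c : Fin n → ℝ) (r : ℝ) :
    ⨍⁻ y in closedBall c r, g y ∂volume = (∫⁻ y in closedBall c r, g y) / volume (closedBall c r) := by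
  rw [setLAverage_eq]

theorem setLAverage_le_iff {g : (Fin n → ℝ) → ℝ≥0∞} {c : Fin n → ℝ} {r : ℝ} (hr : 0 < r)
    {a : ℝ≥0∞} : ⨍⁻ y in closedBall c r, g y ∂volume ≤ a ↔
      ∫⁻ y in closedBall c r, g y ≤ a * volume (closedBall c r) := by
  rw [setLAverage_closedBall, ENNReal.div_le_iff (volume_closedBall_ne_zero c hr)
    (volume_closedBall_ne_top c r)]

theorem lt_setLAverage_iff {g : (Fin n → ℝ) → ℝ≥0∞} {c : Fin n → ℝ} {r : ℝ} (hr : 0 < r)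
    {a : ℝ≥0∞} : a < ⨍⁻ y in closedBall c r, g y ∂volume ↔
      a * volume (closedBall c r) < ∫⁻ y in closedBall c r, g y := by
  rw [← not_le, setLAverage_le_iff hr, not_le]

theorem setLAverage_mul_volume {g : (Fin n → ℝ) → ℝ≥0∞} {c : Fin n → ℝ} {r : ℝ} (hr : 0 < r) :
    (⨍⁻ y in closedBall c r, g y ∂volume) * volume (closedBall c r) = ∫⁻ y in closedBall c r, g y := by
  rw [setLAverage_closedBall, ENNReal.div_mul_cancel (volume_closedBall_ne_zero c hr)
    (volume_closedBall_ne_top c r)]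

/-- The part of a cube inside a larger cube lies in a translate of it inside the larger cube. -/
theorem exists_closedBall_between (c b : Fin n → ℝ) {r R : ℝ} (hr : 0 ≤ r) (hrR : r ≤ R) :
    ∃ c', closedBall c r ∩ closedBall b R ⊆ closedBall c' r ∧ closedBall c' r ⊆ closedBall b R := by
  refine ⟨fun i => max (b i - (R - r)) (min (c i) (b i + (R - r))), ?_, ?_⟩
  · rintro x ⟨h1, h2⟩
    rw [mem_closedBall, dist_pi_le_iff (by linarith)] at *
    intro i
    have h1 := h1 i
    have h2 := h2 i
    simp only [Real.dist_eq, abs_le] at *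
    constructor
    · rcases max_cases (b i - (R - r)) (min (c i) (b i + (R - r))) with h | h <;>
      rcases min_cases (c i) (b i + (R - r)) with h' | h' <;> linarith [h.1, h'.1]
    · rcases max_cases (b i - (R - r)) (min (c i) (b i + (R - r))) with h | h <;>
      rcases min_cases (c i) (b i + (R - r)) with h' | h' <;> linarith [h.1, h'.1]
  · intro x h1
    rw [mem_closedBall, dist_pi_le_iff (by linarith)] at *
    intro i
    have h1 := h1 i
    simp only [Real.dist_eq, abs_le] at *
    constructor
    · rcases max_cases (b i - (R - r)) (min (c i) (b i + (R - r))) with h | h <;>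
      rcases min_cases (c i) (b i + (R - r)) with h' | h' <;> linarith [h.1, h'.1]
    · rcases max_cases (b i - (R - r)) (min (c i) (b i + (R - r))) with h | h <;>
      rcases min_cases (c i) (b i + (R - r)) with h' | h' <;> linarith [h.1, h'.1]

/-! ### The maximal operator on `[0,∞]`-valued functions -/

/-- The maximal operator acting on `[0,∞]`-valued functions. -/
def supAverage (g : (Fin n → ℝ) → ℝ≥0∞) (x : Fin n → ℝ) : ℝ≥0∞ :=
  ⨆ (Q : Set (Fin n → ℝ)) (_ : IsCube Q) (_ : x ∈ Q), ⨍⁻ y in Q, g y ∂volume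

theorem maximalFn_eq (f : (Fin n → ℝ) → ℝ) : maximalFn f = supAverage (fun y => ‖f y‖ₑ) := rfl

theorem setLAverage_le_supAverage (g : (Fin n → ℝ) → ℝ≥0∞) {c x : Fin n → ℝ} {r : ℝ} (hr : 0 < r)
    (hx : x ∈ closedBall c r) : ⨍⁻ y in closedBall c r, g y ∂volume ≤ supAverage g x :=
  le_iSup₂_of_le (closedBall c r) (isCube_closedBall c hr) (le_iSup_of_le hx le_rfl)

theorem supAverage_le {g : (Fin n → ℝ) → ℝ≥0∞} {x : Fin n → ℝ} {a : ℝ≥0∞}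
    (h : ∀ c r, 0 < r → x ∈ closedBall c r → ⨍⁻ y in closedBall c r, g y ∂volume ≤ a) :
    supAverage g x ≤ a := by
  refine iSup₂_le fun Q hQ => iSup_le fun hx => ?_
  obtain ⟨c, r, hr, rfl⟩ := hQ.exists_eq_closedBall
  exact h c r hr hx

theorem lt_supAverage_iff {g : (Fin n → ℝ) → ℝ≥0∞} {x : Fin n → ℝ} {a : ℝ≥0∞} :
    a < supAverage g x ↔
      ∃ c r, 0 < r ∧ x ∈ closedBall c r ∧ a < ⨍⁻ y in closedBall c r, g y ∂volume := by
  constructor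
  · intro h
    by_contra! H
    exact absurd (supAverage_le H) (not_le.2 h)
  · rintro ⟨c, r, hr, hx, h⟩
    exact h.trans_le (setLAverage_le_supAverage g hr hx)

theorem supAverage_mono {g h : (Fin n → ℝ) → ℝ≥0∞} (hgh : g ≤ h) (x : Fin n → ℝ) :
    supAverage g x ≤ supAverage h x :=
  supAverage_le fun c r hr hx => (by
    rw [setLAverage_closedBall, setLAverage_closedBall]
    gcongr
    exact hgh _ : _ ≤ ⨍⁻ y in closedBall c r, h y ∂volume).trans (setLAverage_le_supAverage h hr hx)

/-- A cube with average above `a` keeps this property when it is slightly enlarged, because its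
volume is continuous in the radius, and the enlarged cube contains a neighbourhood of the point.
Hence maximal functions are measurable, whatever `g` is. -/
theorem isOpen_lt_supAverage (g : (Fin n → ℝ) → ℝ≥0∞) (a : ℝ≥0∞) :
    IsOpen {x | a < supAverage g x} := by
  rw [isOpen_iff_mem_nhds]
  intro x hx
  obtain ⟨c, r, hr, hxc, h⟩ := lt_supAverage_iff.1 hx
  rw [lt_setLAverage_iff hr] at h
  have ha : a ≠ ∞ := by
    rintro rfl
    rw [ENNReal.top_mul (volume_closedBall_ne_zero c hr)] at h
    exact not_top_lt h
  have hlim : Tendsto (fun ρ : ℝ => a * volume (closedBall c ρ)) (𝓝[>] r)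
      (𝓝 (a * volume (closedBall c r))) := by
    have : Tendsto (fun ρ : ℝ => a * ENNReal.ofReal (2 * ρ) ^ n) (𝓝[>] r)
        (𝓝 (a * ENNReal.ofReal (2 * r) ^ n)) := by
      apply tendsto_nhdsWithin_of_tendsto_nhds
      refine ENNReal.Tendsto.const_mul (ENNReal.Tendsto.pow ?_) (Or.inr ha)
      exact (ENNReal.continuous_ofReal.comp (continuous_const.mul continuous_id)).tendsto r
    rw [volume_closedBall_eq c hr.le]
    refine this.congr' ?_
    filter_upwards [self_mem_nhdsWithin] with ρ hρ
    rw [volume_closedBall_eq c (hr.le.trans (le_of_lt hρ))]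
  have hev := hlim.eventually (gt_mem_nhds h)
  obtain ⟨ρ, hρ, hrρ⟩ := (hev.and self_mem_nhdsWithin).exists
  have hrρ : r < ρ := hrρ
  filter_upwards [closedBall_mem_nhds x (sub_pos.2 hrρ)] with y hy
  refine lt_supAverage_iff.2 ⟨c, ρ, hr.trans hrρ, ?_, ?_⟩
  · rw [mem_closedBall] at *
    linarith [dist_triangle y x c]
  · rw [lt_setLAverage_iff (hr.trans hrρ)]
    exact hρ.trans_le (lintegral_mono_set (closedBall_subset_closedBall hrρ.le))

theorem measurable_supAverage (g : (Fin n → ℝ) → ℝ≥0∞) : Measurable (supAverage g) :=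
  measurable_of_Ioi fun a => (isOpen_lt_supAverage g a).measurableSet

theorem supAverage_const_add_le (g : (Fin n → ℝ) → ℝ≥0∞) (a : ℝ≥0∞) (x : Fin n → ℝ) :
    supAverage (fun y => a + g y) x ≤ a + supAverage g x := by
  refine supAverage_le fun c r hr hx => ?_
  rw [setLAverage_le_iff hr, lintegral_add_left measurable_const, lintegral_const, add_mul,
    Measure.restrict_apply_univ]
  gcongr
  rw [← setLAverage_le_iff hr]
  exact setLAverage_le_supAverage g hr hx

/-! ### Weak type estimates by the Vitali covering lemma -/

/-- A disjoint family of cubes with positive radii is countable. -/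
theorem countable_of_pairwiseDisjoint_closedBall {ι : Type*} {u : Set ι} {x : ι → Fin n → ℝ}
    {r : ι → ℝ} (hr : ∀ a ∈ u, 0 < r a)
    (hd : u.PairwiseDisjoint fun a => closedBall (x a) (r a)) : u.Countable := by
  refine hd.countable_of_nonempty_interior fun a ha => ⟨x a, ?_⟩
  exact ball_subset_interior_closedBall (mem_ball_self (hr a ha))

/-- If `μ` satisfies an averaging inequality of `A_s` type over cubes, then the maximal operator is
of weak type `(s, s)` with respect to `μ`. -/
theorem mul_measure_lt_supAverage_le {μ : Measure (Fin n → ℝ)} {B : ℝ≥0∞} {s : ℝ} (hs : 0 < s)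
    (H : ∀ (c : Fin n → ℝ) (r : ℝ), 0 < r → ∀ g : (Fin n → ℝ) → ℝ≥0∞, Measurable g →
      (⨍⁻ y in closedBall c r, g y ∂volume) ^ s * μ (closedBall c r)
        ≤ B * ∫⁻ y in closedBall c r, g y ^ s ∂μ)
    {g : (Fin n → ℝ) → ℝ≥0∞} (hg : Measurable g) (a : ℝ≥0∞) :
    a ^ s * μ {x | a < supAverage g x} ≤ B * (5 ^ n) ^ s * ∫⁻ y, g y ^ s ∂μ := by
  -- Vitali's lemma needs bounded radii, so the level set is exhausted by the parts covered by cubes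
  -- of radius at most `k`.
  let E : ℕ → Set (Fin n → ℝ) := fun k =>
    {x | ∃ (c : Fin n → ℝ) (r : ℝ), 0 < r ∧ r ≤ k ∧ x ∈ closedBall c r ∧ a < ⨍⁻ y in closedBall c r, g y ∂volume}
  have hE : {x | a < supAverage g x} = ⋃ k, E k := by
    ext x
    simp only [mem_ofPred_eq, mem_iUnion, lt_supAverage_iff, E]
    constructor
    · rintro ⟨c, r, hr, hx, h⟩
      obtain ⟨k, hk⟩ := exists_nat_ge r
      exact ⟨k, c, r, hr, hk, hx, h⟩
    · rintro ⟨k, c, r, hr, -, hx, h⟩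
      exact ⟨c, r, hr, hx, h⟩
  have hmono : Monotone E := by
    rintro k l hkl x ⟨c, r, hr, hk, hx, h⟩
    exact ⟨c, r, hr, hk.trans (by exact_mod_cast hkl), hx, h⟩
  rw [hE, hmono.measure_iUnion, ENNReal.mul_iSup]
  refine iSup_le fun k => ?_
  let t : Set ((Fin n → ℝ) × ℝ) := {b | 0 < b.2 ∧ b.2 ≤ k ∧
    a < ⨍⁻ y in closedBall b.1 b.2, g y ∂volume}
  obtain ⟨u, hut, hd, hcov⟩ := Vitali.exists_disjoint_subfamily_covering_enlargement_closedBall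
    t (fun b => b.1) (fun b => b.2) k (fun b hb => hb.2.1) 5 (by norm_num)
  have huc : u.Countable := countable_of_pairwiseDisjoint_closedBall (fun b hb => (hut hb).1) hd
  have hsub : E k ⊆ ⋃ b ∈ u, closedBall b.1 (5 * b.2) := by
    rintro x ⟨c, r, hr, hk, hx, h⟩
    obtain ⟨b, hb, hbs⟩ := hcov (c, r) ⟨hr, hk, h⟩
    exact mem_biUnion hb (hbs hx)
  have hball : ∀ b ∈ u, a ^ s * μ (closedBall b.1 (5 * b.2)) ≤
      B * (5 ^ n) ^ s * ∫⁻ y in closedBall b.1 b.2, g y ^ s ∂μ := by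
    intro b hb
    obtain ⟨hb0, -, hav⟩ := hut hb
    have hm : MeasurableSet (closedBall b.1 b.2) := measurableSet_closedBall
    have h5 : (0:ℝ) < 5 * b.2 := by positivity
    have hsub5 : closedBall b.1 b.2 ⊆ closedBall b.1 (5 * b.2) :=
      closedBall_subset_closedBall (by linarith)
    -- The hypothesis is tested on the dilated cube with `g` cut off to the small one: the
    -- right-hand side stays on disjoint cubes, and the average drops by the factor 5^n only.
    have h := H b.1 (5 * b.2) h5 ((closedBall b.1 b.2).indicator g) (hg.indicator hm)
    have e1 : ∫⁻ y in closedBall b.1 (5 * b.2), (closedBall b.1 b.2).indicator g y ^ s ∂μ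
        = ∫⁻ y in closedBall b.1 b.2, g y ^ s ∂μ := by
      have : (fun y => (closedBall b.1 b.2).indicator g y ^ s)
          = (closedBall b.1 b.2).indicator (fun y => g y ^ s) := by
        ext y
        by_cases hy : y ∈ closedBall b.1 b.2
        · simp [hy]
        · simp [hy, ENNReal.zero_rpow_of_pos hs]
      rw [this, lintegral_indicator hm, Measure.restrict_restrict hm, inter_eq_left.2 hsub5]
    have e2 : a ≤ 5 ^ n *
        ⨍⁻ y in closedBall b.1 (5 * b.2), (closedBall b.1 b.2).indicator g y ∂volume := by
      rw [lt_setLAverage_iff hb0] at hav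
      rw [setLAverage_closedBall, lintegral_indicator hm, Measure.restrict_restrict hm,
        inter_eq_left.2 hsub5, volume_closedBall_mul b.1 b.1 (by norm_num) hb0.le, ← mul_div_assoc]
      have h5n : ENNReal.ofReal 5 ^ n = 5 ^ n := by norm_num
      rw [h5n, ENNReal.mul_div_mul_left _ _ (by positivity) (by finiteness)]
      rw [ENNReal.le_div_iff_mul_le (Or.inl (volume_closedBall_ne_zero _ hb0))
        (Or.inl (volume_closedBall_ne_top _ _))]
      exact hav.le
    calc a ^ s * μ (closedBall b.1 (5 * b.2))
        ≤ (5 ^ n * ⨍⁻ y in closedBall b.1 (5 * b.2),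
            (closedBall b.1 b.2).indicator g y ∂volume) ^ s * μ (closedBall b.1 (5 * b.2)) := by
          gcongr
      _ = (5 ^ n) ^ s * ((⨍⁻ y in closedBall b.1 (5 * b.2),
            (closedBall b.1 b.2).indicator g y ∂volume) ^ s * μ (closedBall b.1 (5 * b.2))) := by
          rw [ENNReal.mul_rpow_of_nonneg _ _ hs.le, mul_assoc]
      _ ≤ (5 ^ n) ^ s * (B * ∫⁻ y in closedBall b.1 b.2, g y ^ s ∂μ) := by
          rw [e1] at h
          gcongr
      _ = _ := by ring
  calc a ^ s * μ (E k) ≤ a ^ s * ∑' b : u, μ (closedBall b.1.1 (5 * b.1.2)) := by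
        gcongr
        exact (measure_mono hsub).trans (measure_biUnion_le μ huc _)
    _ = ∑' b : u, a ^ s * μ (closedBall b.1.1 (5 * b.1.2)) := ENNReal.tsum_mul_left.symm
    _ ≤ ∑' b : u, B * (5 ^ n) ^ s * ∫⁻ y in closedBall b.1.1 b.1.2, g y ^ s ∂μ :=
        ENNReal.tsum_le_tsum fun b => hball b.1 b.2
    _ = B * (5 ^ n) ^ s * ∑' b : u, ∫⁻ y in closedBall b.1.1 b.1.2, g y ^ s ∂μ :=
        ENNReal.tsum_mul_left
    _ = B * (5 ^ n) ^ s * ∫⁻ y in ⋃ b ∈ u, closedBall b.1 b.2, g y ^ s ∂μ := by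
        rw [lintegral_biUnion huc (fun b _ => measurableSet_closedBall) hd]
    _ ≤ _ := by
        gcongr
        exact Measure.restrict_le_self

/-! ### Sums in `L^θ` -/

theorem rpow_tsum_le_tsum_rpow {θ : ℝ} (h0 : 0 < θ) (h1 : θ ≤ 1) (a : ℕ → ℝ≥0∞) :
    (∑' k, a k) ^ θ ≤ ∑' k, a k ^ θ := by
  have hfin : ∀ N, (∑ k ∈ Finset.range N, a k) ^ θ ≤ ∑ k ∈ Finset.range N, a k ^ θ := by
    intro N
    induction N with
    | zero => simp [ENNReal.zero_rpow_of_pos h0]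
    | succ N ih =>
      rw [Finset.sum_range_succ, Finset.sum_range_succ]
      exact (ENNReal.rpow_add_le_add_rpow _ _ h0.le h1).trans (by gcongr)
  have := (ENNReal.continuous_rpow_const (y := θ)).tendsto (∑' k, a k)
  exact le_of_tendsto (this.comp (ENNReal.tendsto_nat_tsum a))
    (Eventually.of_forall fun N => (hfin N).trans (ENNReal.sum_le_tsum _))

/-- Minkowski's inequality for series of `[0,∞]`-valued functions. -/
theorem lintegral_rpow_tsum_le {α : Type*} [MeasurableSpace α] {μ : Measure α} {θ : ℝ}
    (h1 : 1 ≤ θ) {a : ℕ → α → ℝ≥0∞} (ha : ∀ k, Measurable (a k)) :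
    (∫⁻ x, (∑' k, a k x) ^ θ ∂μ) ^ (1 / θ) ≤ ∑' k, (∫⁻ x, a k x ^ θ ∂μ) ^ (1 / θ) := by
  have h0 : 0 < θ := by linarith
  have hfin : ∀ N, (∫⁻ x, (∑ k ∈ Finset.range N, a k x) ^ θ ∂μ) ^ (1 / θ) ≤
      ∑ k ∈ Finset.range N, (∫⁻ x, a k x ^ θ ∂μ) ^ (1 / θ) := by
    intro N
    induction N with
    | zero => simp [ENNReal.zero_rpow_of_pos h0, h0]
    | succ N ih =>
      simp only [Finset.sum_range_succ]
      have hm : Measurable fun x => ∑ k ∈ Finset.range N, a k x :=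
        Finset.measurable_sum _ fun k _ => ha k
      exact (ENNReal.lintegral_Lp_add_le hm.aemeasurable (ha N).aemeasurable h1).trans
        (by gcongr)
  have hlim : Tendsto (fun N => ∫⁻ x, (∑ k ∈ Finset.range N, a k x) ^ θ ∂μ) atTop
      (𝓝 (∫⁻ x, (∑' k, a k x) ^ θ ∂μ)) := by
    refine lintegral_tendsto_of_tendsto_of_monotone (fun N => ?_) (ae_of_all _ fun x => ?_)
      (ae_of_all _ fun x => ?_)
    · exact ((Finset.measurable_sum _ fun k _ => ha k).pow_const θ).aemeasurable
    · intro N M hNM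
      dsimp only
      gcongr
    · exact ((ENNReal.continuous_rpow_const (y := θ)).tendsto _).comp
        (ENNReal.tendsto_nat_tsum fun k => a k x)
  exact le_of_tendsto (((ENNReal.continuous_rpow_const (y := 1 / θ)).tendsto _).comp hlim)
    (Eventually.of_forall fun N => (hfin N).trans (ENNReal.sum_le_tsum _))

/-- From 2^x ≥ 1 + x log 2 ≥ 1 + x/2 one gets 1 - 2^(-x) ≥ x/(x+2). The order 1/x for small x is
what later becomes the A_∞ constant. -/
theorem tsum_two_rpow_le {x : ℝ} (hx : 0 < x) :
    ∑' k : ℕ, (2 : ℝ≥0∞) ^ (-(x * k)) ≤ ENNReal.ofReal (1 + 2 / x) := by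
  have hlog : (1 : ℝ) / 2 < Real.log 2 := by linarith [Real.log_two_gt_d9]
  have h2x : 1 + x / 2 ≤ (2 : ℝ) ^ x := by
    rw [Real.rpow_def_of_pos two_pos]
    nlinarith [Real.add_one_le_exp (Real.log 2 * x)]
  have hpos : (0 : ℝ) < 2 ^ x := by positivity
  have hb : (2 : ℝ) ^ (-x) ≤ (1 + x / 2)⁻¹ := by
    rw [Real.rpow_neg two_pos.le]
    gcongr
  have hb0 : (0 : ℝ) < 2 ^ (-x) := by positivity
  have hlt : (2 : ℝ) ^ (-x) < 1 := hb.trans_lt (inv_lt_one_of_one_lt₀ (by linarith))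
  have e : ∀ k : ℕ, (2 : ℝ≥0∞) ^ (-(x * k)) = ENNReal.ofReal ((2 : ℝ) ^ (-x)) ^ k := by
    intro k
    rw [← ENNReal.ofReal_rpow_of_pos two_pos, ← ENNReal.rpow_natCast, ← ENNReal.rpow_mul]
    simp
  simp_rw [e]
  rw [ENNReal.tsum_geometric, ← ENNReal.ofReal_one, ← ENNReal.ofReal_sub _ hb0.le,
    ← ENNReal.ofReal_inv_of_pos (by linarith)]
  apply ENNReal.ofReal_le_ofReal
  have : x / (x + 2) ≤ 1 - (2 : ℝ) ^ (-x) := by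
    have : (1 + x / 2)⁻¹ = 1 - x / (x + 2) := by field_simp; ring
    linarith
  calc (1 - (2 : ℝ) ^ (-x))⁻¹ ≤ (x / (x + 2))⁻¹ := by gcongr
    _ = 1 + 2 / x := by field_simp

/-! ### Lorentz functionals of distribution functions -/

/-- The integral `∫₀^∞ s^q G(s) ds/s`. -/
def powIntegral (q : ℝ) (G : ℝ → ℝ≥0∞) : ℝ≥0∞ :=
  ∫⁻ s in Ioi (0 : ℝ), ENNReal.ofReal s ^ q * G s / ENNReal.ofReal s

/-- The measure `s^q ds/s` on `(0,∞)`. -/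
def powMeasure (q : ℝ) : Measure ℝ :=
  (volume.restrict (Ioi (0 : ℝ))).withDensity
    fun s => ENNReal.ofReal s ^ q / ENNReal.ofReal s

theorem measurable_ofReal_rpow_div (q : ℝ) :
    Measurable fun s : ℝ => ENNReal.ofReal s ^ q / ENNReal.ofReal s := by fun_prop

theorem powIntegral_eq (q : ℝ) {G : ℝ → ℝ≥0∞} (hG : Measurable G) :
    powIntegral q G = ∫⁻ s, G s ∂powMeasure q := by
  rw [powMeasure, lintegral_withDensity_eq_lintegral_mul _ (measurable_ofReal_rpow_div q) hG,
    powIntegral]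
  refine lintegral_congr fun s => ?_
  simp only [Pi.mul_apply, div_eq_mul_inv]
  ring

theorem powIntegral_mono {q : ℝ} {G H : ℝ → ℝ≥0∞} (h : ∀ s, 0 < s → G s ≤ H s) :
    powIntegral q G ≤ powIntegral q H := by
  refine setLIntegral_mono' measurableSet_Ioi fun s hs => ?_
  gcongr
  exact h s hs

theorem lintegral_Ioi_comp_mul_left (h : ℝ → ℝ≥0∞) {a : ℝ} (ha : 0 < a) :
    ∫⁻ s in Ioi (0 : ℝ), h s = ENNReal.ofReal a * ∫⁻ s in Ioi (0 : ℝ), h (a * s) := by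
  have he : MeasurableEmbedding (fun s : ℝ => a * s) :=
    (Homeomorph.mulLeft₀ a ha.ne').measurableEmbedding
  have hv := Real.smul_map_volume_mul_left ha.ne'
  have hpre : (fun s : ℝ => a * s) ⁻¹' Ioi 0 = Ioi 0 := by
    ext s
    simp [ha]
  conv_lhs => rw [← hv]
  rw [Measure.restrict_smul, lintegral_smul_measure, he.restrict_map, he.lintegral_map, hpre,
    abs_of_pos ha, smul_eq_mul]

theorem powIntegral_comp_mul_left (q : ℝ) (G : ℝ → ℝ≥0∞) {a : ℝ} (ha : 0 < a) :
    powIntegral q (fun s => G (a * s)) = ENNReal.ofReal a ^ (-q) * powIntegral q G := by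
  have ha0 : ENNReal.ofReal a ≠ 0 := by simpa using ha
  unfold powIntegral
  rw [lintegral_Ioi_comp_mul_left (fun s => ENNReal.ofReal s ^ q * G s / ENNReal.ofReal s) ha,
    ← mul_assoc, ← lintegral_const_mul' _ _ (ENNReal.mul_ne_top
      (ENNReal.rpow_ne_top_of_ne_zero ha0 ENNReal.ofReal_ne_top) ENNReal.ofReal_ne_top)]
  refine setLIntegral_congr_fun measurableSet_Ioi fun s hs => ?_
  have hs : 0 < s := hs
  have hs0 : ENNReal.ofReal s ≠ 0 := by simpa using hs
  have e1 : ENNReal.ofReal a ^ (-q) * ENNReal.ofReal a ^ q = 1 := by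
    rw [← ENNReal.rpow_add _ _ ha0 ENNReal.ofReal_ne_top]; simp
  simp only
  rw [ENNReal.ofReal_mul ha.le, ENNReal.mul_rpow_of_ne_top ENNReal.ofReal_ne_top
    ENNReal.ofReal_ne_top, div_eq_mul_inv, div_eq_mul_inv,
    ENNReal.mul_inv (Or.inl ha0) (Or.inl ENNReal.ofReal_ne_top)]
  calc ENNReal.ofReal s ^ q * G (a * s) * (ENNReal.ofReal s)⁻¹
      = 1 * 1 * (ENNReal.ofReal s ^ q * G (a * s) * (ENNReal.ofReal s)⁻¹) := by simp
    _ = (ENNReal.ofReal a ^ (-q) * ENNReal.ofReal a ^ q)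
        * (ENNReal.ofReal a * (ENNReal.ofReal a)⁻¹)
        * (ENNReal.ofReal s ^ q * G (a * s) * (ENNReal.ofReal s)⁻¹) := by
          rw [e1, ENNReal.mul_inv_cancel ha0 ENNReal.ofReal_ne_top]
    _ = _ := by ring

/-- The Lorentz functional of a distribution function. -/
def distNorm (p : ℝ) (q : ℝ≥0∞) (F : ℝ → ℝ≥0∞) : ℝ≥0∞ :=
  if q = ∞ then ⨆ (s : ℝ) (_ : 0 < s), ENNReal.ofReal s * F s ^ (1 / p)
  else (ENNReal.ofReal p * powIntegral q.toReal (fun s => F s ^ (q.toReal / p)))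
    ^ (1 / q.toReal)

theorem lorentzNorm_eq_distNorm (p : ℝ) (q : ℝ≥0∞) (w : (Fin n → ℝ) → ℝ)
    (g : (Fin n → ℝ) → ℝ≥0∞) : lorentzNorm p q w g =
      distNorm p q (fun s => weightMeasure w {x | ENNReal.ofReal s < g x}) := rfl

theorem distNorm_mono {p : ℝ} (hp : 0 < p) {q : ℝ≥0∞} {F G : ℝ → ℝ≥0∞}
    (h : ∀ s, 0 < s → F s ≤ G s) : distNorm p q F ≤ distNorm p q G := by
  unfold distNorm
  split_ifs
  · gcongr with s hs
    exact h s hs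
  · gcongr
    refine powIntegral_mono fun s hs => ?_
    gcongr
    exact h s hs

/-- Homogeneity of the norm: if `F` is the distribution function of f, then `F (a * ·)` is that of
f/a. -/
theorem distNorm_comp_mul_left {p : ℝ} {q : ℝ≥0∞} (hq : q ≠ 0) (F : ℝ → ℝ≥0∞)
    {a : ℝ} (ha : 0 < a) :
    ENNReal.ofReal a * distNorm p q (fun s => F (a * s)) = distNorm p q F := by
  have ha0 : ENNReal.ofReal a ≠ 0 := by simpa using ha
  unfold distNorm
  split_ifs with hqt
  · simp only [ENNReal.mul_iSup]
    apply le_antisymm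
    · refine iSup₂_le fun s hs => le_iSup₂_of_le (a * s) (by positivity) ?_
      rw [ENNReal.ofReal_mul ha.le, mul_assoc]
    · refine iSup₂_le fun s hs => le_iSup₂_of_le (a⁻¹ * s) (by positivity) ?_
      rw [← mul_assoc, ← ENNReal.ofReal_mul ha.le, mul_inv_cancel_left₀ ha.ne']
  · have hq0 : 0 < q.toReal := ENNReal.toReal_pos hq hqt
    rw [powIntegral_comp_mul_left q.toReal (fun s => F s ^ (q.toReal / p)) ha, mul_left_comm,
      ENNReal.mul_rpow_of_nonneg _ _ (by positivity), ← mul_assoc, ← ENNReal.rpow_mul]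
    rw [show -q.toReal * (1 / q.toReal) = -1 by field_simp, ENNReal.rpow_neg_one,
      ENNReal.mul_inv_cancel ha0 ENNReal.ofReal_ne_top, one_mul]

theorem two_rpow_mul_two_rpow (x y : ℝ) : (2 : ℝ≥0∞) ^ x * 2 ^ y = 2 ^ (x + y) :=
  (ENNReal.rpow_add _ _ two_ne_zero ENNReal.ofNat_ne_top).symm

theorem ofReal_two_pow_rpow (k : ℕ) (x : ℝ) :
    ENNReal.ofReal (2 ^ k) ^ x = (2 : ℝ≥0∞) ^ (k * x) := by
  rw [ENNReal.ofReal_pow two_pos.le, ← ENNReal.rpow_natCast, ← ENNReal.rpow_mul]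
  simp

/-- Each term is bounded by the Chebyshev-type estimate F(2^k a) ≤ N^p (2^k a)^(-p), which leaves a
geometric series of ratio 2^(-(p-s)). -/
theorem distNorm_top_tsum_le {p s : ℝ} (hp : 0 < p) (hs : s < p)
    {F : ℝ → ℝ≥0∞} (B : ℝ≥0∞) :
    distNorm p ∞ (fun a => B * ∑' k : ℕ, 2 ^ ((k + 1) * s) * F (2 ^ k * a)) ≤
      B ^ (1 / p) * 2 ^ (s / p) * ENNReal.ofReal (1 + 2 / (p - s)) ^ (1 / p)
        * distNorm p ∞ F := by
  have hp' : (1 / p) * p = 1 := by field_simp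
  set N := distNorm p ∞ F with hN
  have hF : ∀ a, 0 < a → ENNReal.ofReal a ^ p * F a ≤ N ^ p := by
    intro a ha
    have : ENNReal.ofReal a * F a ^ (1 / p) ≤ N := by
      rw [hN, distNorm, if_pos rfl]
      exact le_iSup₂_of_le a ha le_rfl
    calc ENNReal.ofReal a ^ p * F a = (ENNReal.ofReal a * F a ^ (1 / p)) ^ p := by
          rw [ENNReal.mul_rpow_of_nonneg _ _ hp.le, ← ENNReal.rpow_mul, hp', ENNReal.rpow_one]
      _ ≤ N ^ p := by gcongr
  rw [distNorm, if_pos rfl]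
  refine iSup₂_le fun a ha => ?_
  have hterm : ∀ k : ℕ, ENNReal.ofReal a ^ p * (2 ^ ((k + 1) * s) * F (2 ^ k * a)) ≤
      2 ^ s * N ^ p * 2 ^ (-((p - s) * k)) := by
    intro k
    have h := hF (2 ^ k * a) (by positivity)
    rw [ENNReal.ofReal_mul (by positivity), ENNReal.mul_rpow_of_nonneg _ _ hp.le,
      ofReal_two_pow_rpow] at h
    calc ENNReal.ofReal a ^ p * (2 ^ ((k + 1) * s) * F (2 ^ k * a))
        = 2 ^ (s + -((p - s) * k)) * (2 ^ (k * p) * ENNReal.ofReal a ^ p * F (2 ^ k * a)) := by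
          have : (2 : ℝ≥0∞) ^ ((k + 1) * s) = 2 ^ (s + -((p - s) * k)) * 2 ^ (k * p) := by
            rw [two_rpow_mul_two_rpow]; congr 1; ring
          rw [this]; ring
      _ ≤ 2 ^ (s + -((p - s) * k)) * N ^ p := by gcongr
      _ = _ := by rw [← two_rpow_mul_two_rpow]; ring
  calc ENNReal.ofReal a * (B * ∑' k : ℕ, 2 ^ ((k + 1) * s) * F (2 ^ k * a)) ^ (1 / p)
      = (B * ∑' k : ℕ, ENNReal.ofReal a ^ p * (2 ^ ((k + 1) * s) * F (2 ^ k * a))) ^ (1 / p) := by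
        rw [ENNReal.tsum_mul_left, mul_left_comm, ENNReal.mul_rpow_of_nonneg (ENNReal.ofReal a ^ p)
          _ (by positivity), ← ENNReal.rpow_mul, mul_comm p, hp', ENNReal.rpow_one]
    _ ≤ (B * ∑' k : ℕ, 2 ^ s * N ^ p * 2 ^ (-((p - s) * k))) ^ (1 / p) := by
        exact ENNReal.rpow_le_rpow (mul_le_mul_right (ENNReal.tsum_le_tsum hterm) _) (by positivity)
    _ ≤ (B * (2 ^ s * N ^ p * ENNReal.ofReal (1 + 2 / (p - s)))) ^ (1 / p) := by
        rw [ENNReal.tsum_mul_left]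
        gcongr
        exact tsum_two_rpow_le (by linarith)
    _ = _ := by
        have h1 : 0 ≤ 1 / p := by positivity
        rw [ENNReal.mul_rpow_of_nonneg _ _ h1, ENNReal.mul_rpow_of_nonneg _ _ h1,
          ENNReal.mul_rpow_of_nonneg _ _ h1, ← ENNReal.rpow_mul, ← ENNReal.rpow_mul, mul_comm p,
          hp', ENNReal.rpow_one, mul_one_div]
        ring

/-- Since q/p ≤ 1, the power q/p passes inside the sum. Dilation by 2^k gains 2^(-kq) against the
weight 2^(ksq/p), so the ratio is 2^(-q(p-s)/p). -/
theorem powIntegral_tsum_le_of_le {p q s : ℝ} (hq : 0 < q) (hqp : q ≤ p) (hs : s < p)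
    {F : ℝ → ℝ≥0∞} (hF : Measurable F) (B : ℝ≥0∞) :
    powIntegral q (fun a => (B * ∑' k : ℕ, 2 ^ ((k + 1) * s) * F (2 ^ k * a)) ^ (q / p)) ≤
      B ^ (q / p) * 2 ^ (s * (q / p)) * ENNReal.ofReal (1 + 2 / (q * (p - s) / p))
        * powIntegral q (fun a => F a ^ (q / p)) := by
  have hp : 0 < p := hq.trans_le hqp
  have hθ : 0 < q / p := by positivity
  have hθ1 : q / p ≤ 1 := (div_le_one hp).2 hqp
  have hm : ∀ k : ℕ, Measurable fun a : ℝ => F (2 ^ k * a) ^ (q / p) := fun k =>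
    (hF.comp (measurable_const_mul _)).pow_const _
  have hc : ∀ k : ℕ, ∀ a, (2 ^ ((k + 1) * s) * F (2 ^ k * a)) ^ (q / p) =
      2 ^ ((k + 1) * s * (q / p)) * F (2 ^ k * a) ^ (q / p) := fun k a => by
    rw [ENNReal.mul_rpow_of_nonneg _ _ hθ.le, ← ENNReal.rpow_mul]
  calc powIntegral q (fun a => (B * ∑' k : ℕ, 2 ^ ((k + 1) * s) * F (2 ^ k * a)) ^ (q / p))
      ≤ powIntegral q (fun a => B ^ (q / p) *
          ∑' k : ℕ, 2 ^ ((k + 1) * s * (q / p)) * F (2 ^ k * a) ^ (q / p)) := by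
        refine powIntegral_mono fun a _ => ?_
        rw [ENNReal.mul_rpow_of_nonneg _ _ hθ.le]
        gcongr
        simpa only [hc] using rpow_tsum_le_tsum_rpow hθ hθ1
          (fun k : ℕ => 2 ^ ((k + 1) * s) * F (2 ^ k * a))
    _ = B ^ (q / p) * ∑' k : ℕ, 2 ^ ((k + 1) * s * (q / p)) *
          powIntegral q (fun a => F (2 ^ k * a) ^ (q / p)) := by
        rw [powIntegral_eq, lintegral_const_mul, lintegral_tsum]
        · congr 2
          ext k
          rw [lintegral_const_mul _ (hm k), powIntegral_eq _ (hm k)]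
        · exact fun k => ((hm k).const_mul _).aemeasurable
        · exact Measurable.tsum fun k => (hm k).const_mul _
        · exact (Measurable.tsum fun k => (hm k).const_mul _).const_mul _
    _ = B ^ (q / p) * ∑' k : ℕ, 2 ^ (s * (q / p)) * powIntegral q (fun a => F a ^ (q / p)) *
          2 ^ (-(q * (p - s) / p * k)) := by
        congr 2
        ext k
        rw [powIntegral_comp_mul_left q (fun a => F a ^ (q / p)) (by positivity),
          ofReal_two_pow_rpow]
        have : (2 : ℝ≥0∞) ^ ((k + 1) * s * (q / p)) * 2 ^ (k * -q) =
            2 ^ (s * (q / p)) * 2 ^ (-(q * (p - s) / p * k)) := by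
          rw [two_rpow_mul_two_rpow, two_rpow_mul_two_rpow]
          congr 1
          field_simp
          ring
        rw [← mul_assoc, this]
        ring
    _ ≤ B ^ (q / p) * (2 ^ (s * (q / p)) * powIntegral q (fun a => F a ^ (q / p)) *
          ENNReal.ofReal (1 + 2 / (q * (p - s) / p))) := by
        rw [ENNReal.tsum_mul_left]
        gcongr
        exact tsum_two_rpow_le (div_pos (mul_pos hq (by linarith)) hp)
    _ = _ := by ring

/-- Since q/p ≥ 1, Minkowski's inequality in L^(q/p) of s^q ds/s applies. After the power p/q,
dilation by 2^k gains 2^(-kp) against 2^(ks), so the ratio is 2^(-(p-s)). -/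
theorem powIntegral_tsum_rpow_le_of_ge {p q s : ℝ} (hp : 0 < p) (hpq : p ≤ q) (hs : s < p)
    {F : ℝ → ℝ≥0∞} (hF : Measurable F) (B : ℝ≥0∞) :
    powIntegral q (fun a => (B * ∑' k : ℕ, 2 ^ ((k + 1) * s) * F (2 ^ k * a)) ^ (q / p)) ^ (p / q) ≤
      B * 2 ^ s * ENNReal.ofReal (1 + 2 / (p - s))
        * powIntegral q (fun a => F a ^ (q / p)) ^ (p / q) := by
  have hq : 0 < q := hp.trans_le hpq
  have hθ : 0 < q / p := by positivity
  have hθ1 : 1 ≤ q / p := (one_le_div hp).2 hpq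
  have hθi : 1 / (q / p) = p / q := by field_simp
  have hθm : (q / p) * (p / q) = 1 := by field_simp
  have hpq0 : 0 ≤ p / q := by positivity
  have hm : ∀ k : ℕ, Measurable fun a : ℝ => B * (2 ^ ((k + 1) * s) * F (2 ^ k * a)) := fun k =>
    ((hF.comp (measurable_const_mul _)).const_mul _).const_mul _
  have hm' : ∀ k : ℕ, Measurable fun a : ℝ => F (2 ^ k * a) ^ (q / p) := fun k =>
    (hF.comp (measurable_const_mul _)).pow_const _
  simp_rw [← ENNReal.tsum_mul_left]
  rw [powIntegral_eq _ ((Measurable.tsum hm).pow_const _), ← hθi]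
  refine (lintegral_rpow_tsum_le hθ1 hm).trans ?_
  rw [hθi]
  have hterm : ∀ k : ℕ, (∫⁻ a, (B * (2 ^ ((k + 1) * s) * F (2 ^ k * a))) ^ (q / p)
      ∂powMeasure q) ^ (p / q) =
      B * 2 ^ s * powIntegral q (fun a => F a ^ (q / p)) ^ (p / q) * 2 ^ (-((p - s) * k)) := by
    intro k
    have e : ∀ a, (B * (2 ^ ((k + 1) * s) * F (2 ^ k * a))) ^ (q / p) =
        B ^ (q / p) * 2 ^ ((k + 1) * s * (q / p)) * F (2 ^ k * a) ^ (q / p) := fun a => by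
      rw [ENNReal.mul_rpow_of_nonneg _ _ hθ.le, ENNReal.mul_rpow_of_nonneg _ _ hθ.le,
        ← ENNReal.rpow_mul, ← mul_assoc (B ^ (q / p))]
    simp_rw [e]
    rw [lintegral_const_mul _ (hm' k), ← powIntegral_eq _ (hm' k),
      powIntegral_comp_mul_left q (fun a => F a ^ (q / p)) (by positivity), ofReal_two_pow_rpow,
      ENNReal.mul_rpow_of_nonneg _ _ hpq0, ENNReal.mul_rpow_of_nonneg _ _ hpq0,
      ENNReal.mul_rpow_of_nonneg _ _ hpq0, ← ENNReal.rpow_mul, ← ENNReal.rpow_mul,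
      ← ENNReal.rpow_mul, hθm, ENNReal.rpow_one]
    have : (2 : ℝ≥0∞) ^ ((k + 1) * s * (q / p) * (p / q)) * 2 ^ (k * -q * (p / q)) =
        2 ^ s * 2 ^ (-((p - s) * k)) := by
      rw [two_rpow_mul_two_rpow, two_rpow_mul_two_rpow]
      congr 1
      field_simp
      ring
    calc _ = B * ((2 : ℝ≥0∞) ^ ((k + 1) * s * (q / p) * (p / q)) * 2 ^ (k * -q * (p / q))) *
          powIntegral q (fun a => F a ^ (q / p)) ^ (p / q) := by ring
      _ = _ := by rw [this]; ring
  simp_rw [hterm]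
  rw [ENNReal.tsum_mul_left]
  calc _ ≤ B * 2 ^ s * powIntegral q (fun a => F a ^ (q / p)) ^ (p / q) *
        ENNReal.ofReal (1 + 2 / (p - s)) := by
        gcongr
        exact tsum_two_rpow_le (by linarith)
    _ = _ := by ring

theorem invMin_of_le {p : ℝ} (hp : 0 ≤ p) {q : ℝ≥0∞} (h : ENNReal.ofReal p ≤ q) :
    invMin p q = 1 / p := by
  rw [invMin, min_eq_left h, ENNReal.toReal_ofReal hp]

theorem invMin_of_ge {p : ℝ} {q : ℝ≥0∞} (h : q ≤ ENNReal.ofReal p) :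
    invMin p q = 1 / q.toReal := by
  rw [invMin, min_eq_right h]

theorem invMin_pos {p : ℝ} (hp : 0 < p) {q : ℝ≥0∞} (hq : q ≠ 0) : 0 < invMin p q := by
  refine one_div_pos.2 (ENNReal.toReal_pos ?_ ?_)
  · simp [hp, hq]
  · exact ((min_le_left _ _).trans_lt ENNReal.ofReal_lt_top).ne

/-- Interpolation: a series of weak type `(s, s)` form controls Lorentz functionals of index
`p > s`. -/
theorem distNorm_le_of_le_tsum {p s : ℝ} (hp : 0 < p) (hs : s < p) {q : ℝ≥0∞}
    (hq : q ≠ 0) {F G : ℝ → ℝ≥0∞} (hF : Measurable F) {B : ℝ≥0∞}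
    (h : ∀ a : ℝ, 0 < a → G (2 * a) ≤ B * ∑' k : ℕ, 2 ^ ((k + 1) * s) * F (2 ^ k * a)) :
    distNorm p q G ≤ 4 * B ^ (1 / p) *
      ENNReal.ofReal (1 + 2 / ((p - s) / (p * invMin p q))) ^ invMin p q * distNorm p q F := by
  have h2 : (2 : ℝ≥0∞) * 2 ^ (s / p) ≤ 4 := by
    calc (2 : ℝ≥0∞) * 2 ^ (s / p) ≤ 2 * 2 ^ (1 : ℝ) := by
          gcongr
          · norm_num
          · exact (div_le_one hp).2 hs.le
      _ = 4 := by norm_num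
  -- The quantity (p-s)/(p · `invMin p q`) is p-s when p ≤ q and q(p-s)/p when q ≤ p: one formula
  -- covers the rates of decay of all three series.
  have hmain : distNorm p q (fun a => G (2 * a)) ≤ B ^ (1 / p) * 2 ^ (s / p) *
      ENNReal.ofReal (1 + 2 / ((p - s) / (p * invMin p q))) ^ invMin p q * distNorm p q F := by
    refine (distNorm_mono hp h).trans ?_
    rcases eq_or_ne q ∞ with rfl | hqt
    · rw [invMin_of_le hp.le le_top]
      have := distNorm_top_tsum_le hp hs (F := F) B
      rwa [mul_one_div, div_self hp.ne', div_one]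
    have hq0 : 0 < q.toReal := ENNReal.toReal_pos hq hqt
    have hqi : 0 ≤ 1 / q.toReal := by positivity
    rw [distNorm, if_neg hqt, distNorm, if_neg hqt, ENNReal.mul_rpow_of_nonneg _ _ hqi,
      ENNReal.mul_rpow_of_nonneg _ _ hqi]
    rcases le_total q (ENNReal.ofReal p) with hqp | hqp
    · have hqp' : q.toReal ≤ p := ENNReal.toReal_le_of_le_ofReal hp.le hqp
      rw [invMin_of_ge hqp]
      have hx : (p - s) / (p * (1 / q.toReal)) = q.toReal * (p - s) / p := by field_simp
      rw [hx]
      have := ENNReal.rpow_le_rpow (powIntegral_tsum_le_of_le hq0 hqp' hs hF B) hqi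
      rw [ENNReal.mul_rpow_of_nonneg _ _ hqi, ENNReal.mul_rpow_of_nonneg _ _ hqi,
        ENNReal.mul_rpow_of_nonneg _ _ hqi, ← ENNReal.rpow_mul, ← ENNReal.rpow_mul] at this
      rw [show q.toReal / p * (1 / q.toReal) = 1 / p by field_simp,
        show s * (q.toReal / p) * (1 / q.toReal) = s / p by field_simp] at this
      calc _ ≤ ENNReal.ofReal p ^ (1 / q.toReal) * _ := mul_le_mul_right this _
        _ = _ := by ring
    · have hqp' : p ≤ q.toReal := by
        rwa [← ENNReal.ofReal_le_iff_le_toReal hqt]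
      rw [invMin_of_le hp.le hqp]
      have hpi : 0 ≤ 1 / p := by positivity
      have := ENNReal.rpow_le_rpow (powIntegral_tsum_rpow_le_of_ge hp hqp' hs hF B) hpi
      rw [ENNReal.mul_rpow_of_nonneg _ _ hpi, ENNReal.mul_rpow_of_nonneg _ _ hpi,
        ENNReal.mul_rpow_of_nonneg _ _ hpi, ← ENNReal.rpow_mul, ← ENNReal.rpow_mul,
        ← ENNReal.rpow_mul] at this
      rw [show p / q.toReal * (1 / p) = 1 / q.toReal by field_simp, mul_one_div] at this
      rw [mul_one_div, div_self hp.ne', div_one]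
      calc _ ≤ ENNReal.ofReal p ^ (1 / q.toReal) * _ := mul_le_mul_right this _
        _ = _ := by ring
  rw [← distNorm_comp_mul_left hq G two_pos]
  calc _ ≤ ENNReal.ofReal 2 * _ := mul_le_mul_right hmain _
    _ = 2 * 2 ^ (s / p) * B ^ (1 / p) *
        ENNReal.ofReal (1 + 2 / ((p - s) / (p * invMin p q))) ^ invMin p q * distNorm p q F := by
        rw [ENNReal.ofReal_ofNat]; ring
    _ ≤ _ := by gcongr

/-! ### The sharp reverse Hölder inequality -/

/-- Lebesgue differentiation along cubes centred at the point. -/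
theorem ae_le_supAverage {g : (Fin n → ℝ) → ℝ≥0∞} (hg : Measurable g)
    (hfin : ∫⁻ y, g y ≠ ∞) : ∀ᵐ x, g x ≤ supAverage g x := by
  filter_upwards [(Besicovitch.vitaliFamily (volume : Measure (Fin n → ℝ))).ae_tendsto_lintegral_div
    hg.aemeasurable hfin] with x hx
  refine le_of_tendsto (hx.comp (Besicovitch.tendsto_filterAt volume x)) ?_
  filter_upwards [self_mem_nhdsWithin] with r hr
  have hr : 0 < r := hr
  refine le_trans (le_of_eq ?_) (setLAverage_le_supAverage g hr (mem_closedBall_self hr.le))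
  rw [setLAverage_closedBall]
  rfl

theorem setLIntegral_indicator_closedBall (h : (Fin n → ℝ) → ℝ≥0∞) (s : Set (Fin n → ℝ))
    (c : Fin n → ℝ) (r : ℝ) :
    ∫⁻ y in s, (closedBall c r).indicator h y = ∫⁻ y in closedBall c r ∩ s, h y := by
  rw [lintegral_indicator measurableSet_closedBall,
    Measure.restrict_restrict measurableSet_closedBall]

theorem radius_le_of_closedBall_subset [NeZero n] {c c' : Fin n → ℝ} {r r' : ℝ} (hr : 0 ≤ r)
    (hr' : 0 ≤ r') (h : closedBall c r ⊆ closedBall c' r') : r ≤ r' := by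
  have := measure_mono (μ := volume) h
  rw [volume_closedBall_eq _ hr, volume_closedBall_eq _ hr',
    ENNReal.pow_le_pow_left_iff (NeZero.ne n), ENNReal.ofReal_le_ofReal_iff (by positivity)] at this
  linarith

/-- Calderón--Zygmund cubes: the part of a level set of the maximal function of `h χ_Q` in
`Q = closedBall b R`, at a height at least the average of `h`, contains disjoint cubes whose
bounded dilations within `Q` cover it; the average of `h` over the dilated cubes is at most the
height, and the maximal function localizes to them. -/
theorem exists_calderonZygmund_cubes [NeZero n] (h : (Fin n → ℝ) → ℝ≥0∞) (b : Fin n → ℝ) {R : ℝ}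
    (hR : 0 < R) {a : ℝ≥0∞} (ha : ⨍⁻ y in closedBall b R, h y ∂volume ≤ a) :
    ∃ (u : Set (Fin n → ℝ)) (c c' : (Fin n → ℝ) → Fin n → ℝ) (r r' : (Fin n → ℝ) → ℝ),
      u.Countable ∧ (u.PairwiseDisjoint fun i => closedBall (c i) (r i)) ∧
      (∀ i ∈ u, closedBall (c i) (r i) ⊆
        {x | a < supAverage ((closedBall b R).indicator h) x} ∩ closedBall b R) ∧
      (∀ i ∈ u, 0 < r' i ∧ ∫⁻ y in closedBall (c' i) (r' i), h y ≤
        25 ^ n * a * volume (closedBall (c i) (r i))) ∧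
      ∀ x ∈ {x | a < supAverage ((closedBall b R).indicator h) x} ∩ closedBall b R,
        ∃ i ∈ u, x ∈ closedBall (c' i) (r' i) ∧
          supAverage ((closedBall b R).indicator h) x ≤
            supAverage ((closedBall (c' i) (r' i)).indicator h) x := by
  set Q := closedBall b R with hQ
  set Ω := {x | a < supAverage (Q.indicator h) x} ∩ Q with hΩ
  have hclamp : ∀ (c : Fin n → ℝ) (ρ : ℝ), 0 < ρ → ∃ (c' : Fin n → ℝ) (ρ' : ℝ), 0 < ρ' ∧ ρ' ≤ R ∧
      ρ' ≤ ρ ∧ closedBall c ρ ∩ Q ⊆ closedBall c' ρ' ∧ closedBall c' ρ' ⊆ Q ∧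
        (ρ' = ρ ∨ closedBall c' ρ' = Q) := by
    intro c ρ hρ
    rcases le_total ρ R with hρR | hρR
    · obtain ⟨c', h1, h2⟩ := exists_closedBall_between c b hρ.le hρR
      exact ⟨c', ρ, hρ, hρR, le_rfl, h1, h2, Or.inl rfl⟩
    · exact ⟨b, R, hR, le_rfl, hρR, inter_subset_right, Subset.rfl, Or.inr rfl⟩
  let Rad : (Fin n → ℝ) → Set ℝ := fun x => {r | 0 < r ∧ r ≤ R ∧ ∃ c, x ∈ closedBall c r ∧
    closedBall c r ⊆ Q ∧ a < ⨍⁻ y in closedBall c r, h y ∂volume}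
  -- Cubes that leave `Q` give nothing new. One of radius at most `R` can be translated into `Q`
  -- without losing mass of `h` on `Q`; a larger one has average at most `a`, because `Q` has.
  have hlocal : ∀ x ∈ Q, ∀ c r, 0 < r → x ∈ closedBall c r →
      a < ⨍⁻ y in closedBall c r, Q.indicator h y ∂volume → r ∈ Rad x := by
    intro x hx c r hr hxc hav
    rw [lt_setLAverage_iff hr, setLIntegral_indicator_closedBall] at hav
    rcases le_or_gt r R with hrR | hrR
    · obtain ⟨c', h1, h2⟩ := exists_closedBall_between c b hr.le hrR
      refine ⟨hr, hrR, c', h1 ⟨hxc, hx⟩, h2, ?_⟩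
      rw [lt_setLAverage_iff hr, volume_closedBall_eq c' hr.le, ← volume_closedBall_eq c hr.le]
      refine hav.trans_le (lintegral_mono_set ?_)
      rw [inter_comm]
      exact h1
    · exfalso
      refine absurd hav (not_lt.2 ?_)
      calc ∫⁻ y in closedBall b R ∩ closedBall c r, h y ≤ ∫⁻ y in closedBall b R, h y :=
            lintegral_mono_set inter_subset_left
        _ ≤ a * volume (closedBall b R) := (setLAverage_le_iff hR).1 ha
        _ ≤ _ := by
            rw [volume_closedBall_eq _ hR.le, volume_closedBall_eq _ hr.le]
            gcongr
  -- The supremum of the radii need not be attained, so a cube with more than half of it is chosen.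
  have hmax : ∀ x ∈ Ω, ∃ r c, 0 < r ∧ r ≤ R ∧ x ∈ closedBall c r ∧ closedBall c r ⊆ Q ∧
      a < ⨍⁻ y in closedBall c r, h y ∂volume ∧ ∀ ρ ∈ Rad x, ρ ≤ 2 * r := by
    rintro x ⟨hx, hxQ⟩
    obtain ⟨c, r, hr, hxc, hav⟩ := lt_supAverage_iff.1 hx
    have hne : (Rad x).Nonempty := ⟨r, hlocal x hxQ c r hr hxc hav⟩
    have hbdd : BddAbove (Rad x) := ⟨R, fun ρ hρ => hρ.2.1⟩
    have hpos : 0 < sSup (Rad x) := hr.trans_le (le_csSup hbdd (hlocal x hxQ c r hr hxc hav))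
    obtain ⟨ρ, ⟨hρ0, hρR, c', h1, h2, h3⟩, hlt⟩ := exists_lt_of_lt_csSup hne (half_lt_self hpos)
    exact ⟨ρ, c', hρ0, hρR, h1, h2, h3, fun ρ' hρ' => by linarith [le_csSup hbdd hρ']⟩
  choose! r c hr0 hrR hxc hcQ hav hlargest using hmax
  obtain ⟨u, hut, hd, hcov⟩ := Vitali.exists_disjoint_subfamily_covering_enlargement_closedBall
    Ω c r R hrR 5 (by norm_num)
  -- The factor 25 is 5 + 2·10. A point x of the level set lies in a 5-fold dilated selected cube,
  -- its own cube has radius at most 5 r_i, hence every cube through x with average above `a` has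
  -- radius at most 10 r_i and stays within distance 25 r_i of the centre.
  have hdil := fun i : Fin n → ℝ => hclamp (c i) (25 * r i)
  choose! c' r' hdil using fun i (hi : 0 < 25 * r i) => hdil i hi
  refine ⟨u, c, c', r, r', countable_of_pairwiseDisjoint_closedBall (fun i hi => hr0 i (hut hi)) hd,
    hd, ?_, ?_, ?_⟩
  · intro i hi y hy
    refine ⟨?_, hcQ i (hut hi) hy⟩
    refine lt_supAverage_iff.2 ⟨c i, r i, hr0 i (hut hi), hy, ?_⟩
    have := hav i (hut hi)
    rw [lt_setLAverage_iff (hr0 i (hut hi))] at this ⊢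
    rwa [setLIntegral_indicator_closedBall, inter_eq_right.2 (hcQ i (hut hi))]
  · intro i hi
    have hri := hr0 i (hut hi)
    obtain ⟨h1, h2, h3, h4, h5, h6⟩ := hdil i (by positivity)
    refine ⟨h1, ?_⟩
    have hle : ∫⁻ y in closedBall (c' i) (r' i), h y ≤ a * volume (closedBall (c' i) (r' i)) := by
      rcases h6 with h6 | h6
      -- An average above `a` on the dilated cube would make 25 r_i an admissible radius at the
      -- point `i`, although all of these are at most 2 r_i.
      · rw [← setLAverage_le_iff h1]
        by_contra! hlt
        have hmem : r' i ∈ Rad i := by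
          refine ⟨h1, h2, c' i, h4 ⟨?_, (hut hi).2⟩, h5, hlt⟩
          exact closedBall_subset_closedBall (by linarith) (hxc i (hut hi))
        have := hlargest i (hut hi) _ hmem
        linarith
      · rw [h6]
        exact (setLAverage_le_iff hR).1 ha
    calc ∫⁻ y in closedBall (c' i) (r' i), h y ≤ a * volume (closedBall (c' i) (r' i)) := hle
      _ ≤ a * volume (closedBall (c' i) (25 * r i)) := by gcongr
      _ = a * (25 ^ n * volume (closedBall (c i) (r i))) := by
          rw [volume_closedBall_mul (c i) _ (by norm_num) hri.le, ENNReal.ofReal_ofNat]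
      _ = _ := by ring
  · rintro x hx
    obtain ⟨i, hi, hsub⟩ := hcov x hx
    have hri := hr0 i (hut hi)
    have hrx := hr0 x hx
    obtain ⟨h1, h2, h3, h4, h5, h6⟩ := hdil i (by positivity)
    have hx5 : x ∈ closedBall (c i) (5 * r i) := hsub (hxc x hx)
    have h525 : closedBall (c i) (5 * r i) ⊆ closedBall (c i) (25 * r i) :=
      closedBall_subset_closedBall (by linarith)
    have hxr : r x ≤ 5 * r i := radius_le_of_closedBall_subset hrx.le (by positivity) hsub
    refine ⟨i, hi, h4 ⟨h525 hx5, hx.2⟩, supAverage_le fun d ρ hρ hxd => ?_⟩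
    rcases le_or_gt (⨍⁻ y in closedBall d ρ, Q.indicator h y ∂volume) a with hle | hlt
    -- Cubes with average at most `a` do not matter: the cube chosen for x has a larger average and
    -- lies inside the dilated cube.
    · have hsubx : closedBall (c x) (r x) ⊆ closedBall (c' i) (r' i) := fun y hy =>
        h4 ⟨h525 (hsub hy), hcQ x hx hy⟩
      refine hle.trans (le_trans ?_ (setLAverage_le_supAverage _ hrx (hxc x hx)))
      have := hav x hx
      rw [lt_setLAverage_iff hrx] at this
      rw [setLAverage_closedBall, setLIntegral_indicator_closedBall, inter_eq_right.2 hsubx,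
        ENNReal.le_div_iff_mul_le (Or.inl (volume_closedBall_ne_zero _ hrx))
          (Or.inl (volume_closedBall_ne_top _ _))]
      exact this.le
    · have hρ2 : ρ ≤ 2 * r x := hlargest x hx _ (hlocal x hx.2 d ρ hρ hxd hlt)
      refine le_trans ?_ (setLAverage_le_supAverage _ hρ hxd)
      rw [setLAverage_closedBall, setLAverage_closedBall, setLIntegral_indicator_closedBall,
        setLIntegral_indicator_closedBall]
      gcongr ?_ / _
      refine lintegral_mono_set fun y hy => ⟨h4 ⟨?_, hy.1⟩, hy.2⟩
      have e1 := hy.2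
      rw [mem_closedBall] at *
      have := dist_triangle y d (c i)
      have := dist_triangle d x (c i)
      rw [dist_comm d x] at this
      linarith

/-- A reverse weak type estimate: the dilated cubes cover the level set, the mass of each is
controlled by its undilated cube, and these are disjoint and contained in the level set. -/
theorem setLIntegral_level_le [NeZero n] (h : (Fin n → ℝ) → ℝ≥0∞) (b : Fin n → ℝ) {R : ℝ}
    (hR : 0 < R) {a : ℝ≥0∞} (ha : ⨍⁻ y in closedBall b R, h y ∂volume ≤ a) :
    ∫⁻ y in {x | a < supAverage ((closedBall b R).indicator h) x} ∩ closedBall b R, h y ≤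
      25 ^ n * a *
        volume ({x | a < supAverage ((closedBall b R).indicator h) x} ∩ closedBall b R) := by
  obtain ⟨u, c, c', r, r', hu, hd, hsub, hint, hcov⟩ := exists_calderonZygmund_cubes h b hR ha
  set Ω := {x | a < supAverage ((closedBall b R).indicator h) x} ∩ closedBall b R
  have hΩ : Ω ⊆ ⋃ i ∈ u, closedBall (c' i) (r' i) := fun x hx => by
    obtain ⟨i, hi, hxi, -⟩ := hcov x hx
    exact mem_biUnion hi hxi
  have := hu.to_subtype
  calc ∫⁻ y in Ω, h y ≤ ∫⁻ y in ⋃ i ∈ u, closedBall (c' i) (r' i), h y := lintegral_mono_set hΩ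
    _ ≤ ∑' i : u, ∫⁻ y in closedBall (c' i) (r' i), h y := by
        rw [biUnion_eq_iUnion]
        exact lintegral_iUnion_le _ _
    _ ≤ ∑' i : u, 25 ^ n * a * volume (closedBall (c i) (r i)) :=
        ENNReal.tsum_le_tsum fun i => (hint i i.2).2
    _ = 25 ^ n * a * volume (⋃ i ∈ u, closedBall (c i) (r i)) := by
        rw [ENNReal.tsum_mul_left, measure_biUnion hu hd fun i _ => measurableSet_closedBall]
    _ ≤ _ := by
        gcongr
        exact iUnion₂_subset hsub

/-- As for `h` itself, except that the localized maximal function on each dilated cube is first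
integrated by the A_∞ condition `hS` on that cube, at the price of a factor `S`. -/
theorem setLIntegral_supAverage_level_le [NeZero n] (h : (Fin n → ℝ) → ℝ≥0∞) {S : ℝ≥0∞}
    (hS : ∀ (c : Fin n → ℝ) (r : ℝ), 0 < r →
      ∫⁻ x in closedBall c r, supAverage ((closedBall c r).indicator h) x ≤
        S * ∫⁻ x in closedBall c r, h x) (b : Fin n → ℝ) {R : ℝ}
    (hR : 0 < R) {a : ℝ≥0∞} (ha : ⨍⁻ y in closedBall b R, h y ∂volume ≤ a) :
    ∫⁻ y in {x | a < supAverage ((closedBall b R).indicator h) x} ∩ closedBall b R,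
        supAverage ((closedBall b R).indicator h) y ≤
      25 ^ n * S * a *
        volume ({x | a < supAverage ((closedBall b R).indicator h) x} ∩ closedBall b R) := by
  obtain ⟨u, c, c', r, r', hu, hd, hsub, hint, hcov⟩ := exists_calderonZygmund_cubes h b hR ha
  set M := supAverage ((closedBall b R).indicator h)
  set Ω := {x | a < M x} ∩ closedBall b R
  let T : (Fin n → ℝ) → Set (Fin n → ℝ) := fun i =>
    {x | M x ≤ supAverage ((closedBall (c' i) (r' i)).indicator h) x} ∩ closedBall (c' i) (r' i)
  have hΩ : Ω ⊆ ⋃ i ∈ u, T i := fun x hx => by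
    obtain ⟨i, hi, hxi, hM⟩ := hcov x hx
    exact mem_biUnion hi ⟨hM, hxi⟩
  have hT : ∀ i, MeasurableSet (T i) := fun i =>
    (measurableSet_le (measurable_supAverage _) (measurable_supAverage _)).inter
      measurableSet_closedBall
  have := hu.to_subtype
  calc ∫⁻ y in Ω, M y ≤ ∫⁻ y in ⋃ i ∈ u, T i, M y := lintegral_mono_set hΩ
    _ ≤ ∑' i : u, ∫⁻ y in T i, M y := by
        rw [biUnion_eq_iUnion]
        exact lintegral_iUnion_le _ _
    _ ≤ ∑' i : u, S * (25 ^ n * a * volume (closedBall (c i) (r i))) := by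
        refine ENNReal.tsum_le_tsum fun i => ?_
        calc ∫⁻ y in T i, M y
            ≤ ∫⁻ y in T i, supAverage ((closedBall (c' i) (r' i)).indicator h) y :=
              setLIntegral_mono' (hT i) fun x hx => hx.1
          _ ≤ ∫⁻ y in closedBall (c' i) (r' i),
                supAverage ((closedBall (c' i) (r' i)).indicator h) y :=
              lintegral_mono_set inter_subset_right
          _ ≤ S * ∫⁻ y in closedBall (c' i) (r' i), h y := hS _ _ (hint i i.2).1
          _ ≤ _ := mul_le_mul_right (hint i i.2).2 _
    _ = 25 ^ n * S * a * volume (⋃ i ∈ u, closedBall (c i) (r i)) := by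
        rw [ENNReal.tsum_mul_left, ENNReal.tsum_mul_left,
          measure_biUnion hu hd fun i _ => measurableSet_closedBall]
        ring
    _ ≤ _ := by
        gcongr
        exact iUnion₂_subset hsub

/-- Integration of a reverse weak type estimate. -/
theorem lintegral_rpow_le_of_level_le {α : Type*} [MeasurableSpace α] {μ ν : Measure α}
    {g : α → ℝ} (hg0 : ∀ x, 0 ≤ g x) (hg : Measurable g) {a ε : ℝ} (ha : 0 ≤ a) (hε : 0 < ε)
    {K : ℝ≥0∞} (h : ∀ t, 0 < t → a ≤ t → μ {x | t < g x} ≤ K * ENNReal.ofReal t * ν {x | t < g x}) :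
    ∫⁻ x, ENNReal.ofReal (g x ^ ε) ∂μ ≤ ENNReal.ofReal (a ^ ε) * μ univ +
      K * ENNReal.ofReal ε * ∫⁻ x, ENNReal.ofReal (g x ^ (1 + ε)) ∂ν := by
  have hconst : ENNReal.ofReal (a ^ ε) * μ univ =
      ENNReal.ofReal ε * ∫⁻ t in Ioi (0 : ℝ), μ {x | t < a} * ENNReal.ofReal (t ^ (ε - 1)) := by
    rw [← lintegral_rpow_eq_lintegral_meas_lt_mul μ (f := fun _ => a) (ae_of_all _ fun _ => ha)
      aemeasurable_const hε, lintegral_const]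
  have hm : Measurable fun t : ℝ => μ {x : α | t < a} * ENNReal.ofReal (t ^ (ε - 1)) := by
    have : Antitone fun t : ℝ => μ {x : α | t < a} := fun s t hst =>
      measure_mono fun x (hx : t < a) => hst.trans_lt hx
    exact this.measurable.mul (by fun_prop)
  have hm' : Measurable fun t : ℝ => ν {x : α | t < g x} * ENNReal.ofReal (t ^ (1 + ε - 1)) := by
    have : Antitone fun t : ℝ => ν {x : α | t < g x} := fun s t hst =>
      measure_mono fun x (hx : t < g x) => hst.trans_lt hx
    exact this.measurable.mul (by fun_prop)
  rw [hconst, lintegral_rpow_eq_lintegral_meas_lt_mul μ (ae_of_all _ hg0) hg.aemeasurable hε,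
    lintegral_rpow_eq_lintegral_meas_lt_mul ν (ae_of_all _ hg0) hg.aemeasurable
      (by positivity : 0 < 1 + ε)]
  calc _ ≤ ENNReal.ofReal ε * ∫⁻ t in Ioi (0 : ℝ), (μ {x | t < a} * ENNReal.ofReal (t ^ (ε - 1)) +
        K * (ν {x | t < g x} * ENNReal.ofReal (t ^ (1 + ε - 1)))) := by
        refine mul_le_mul_right (setLIntegral_mono' measurableSet_Ioi fun t ht => ?_) _
        have ht : 0 < t := ht
        rcases lt_or_ge t a with hta | hta
        · refine le_add_right ?_
          exact mul_le_mul_left (measure_mono fun _ _ => hta) _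
        · refine le_add_left ?_
          calc _ ≤ K * ENNReal.ofReal t * ν {x | t < g x} * ENNReal.ofReal (t ^ (ε - 1)) := by
                gcongr
                exact h t ht hta
            _ = K * (ν {x | t < g x} * (ENNReal.ofReal t * ENNReal.ofReal (t ^ (ε - 1)))) := by ring
            _ = _ := by
                rw [← ENNReal.ofReal_mul ht.le, ← Real.rpow_one_add' ht.le (by linarith)]
                congr 4
                ring
    _ = ENNReal.ofReal ε *
          (∫⁻ t in Ioi (0 : ℝ), μ {x | t < a} * ENNReal.ofReal (t ^ (ε - 1))) +
        K * ENNReal.ofReal ε *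
          ∫⁻ t in Ioi (0 : ℝ), ν {x | t < g x} * ENNReal.ofReal (t ^ (1 + ε - 1)) := by
        rw [lintegral_add_left hm, lintegral_const_mul _ hm']
        ring
    _ ≤ _ := by
        gcongr
        -- The layer-cake formula for the power 1+ε carries a factor 1+ε, which is not needed.
        refine le_mul_of_one_le_left zero_le ?_
        rw [← ENNReal.ofReal_one]
        exact ENNReal.ofReal_le_ofReal (by linarith)

/-- The level-set estimates are integrated twice, with M dx and then with h dx. The first bounds the
integral of min(M,N)^(1+ε) by a multiple of `S`; in the second this integral is multiplied by ε, and
S ε is small. So the final constant is 2, independent of `S`. -/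
theorem setLIntegral_truncated_rpow_mul_le [NeZero n] {h : (Fin n → ℝ) → ℝ≥0∞}
    (hh : Measurable h) {S : ℝ≥0∞} (hST : S ≠ ∞)
    (hS : ∀ (c : Fin n → ℝ) (r : ℝ), 0 < r →
      ∫⁻ x in closedBall c r, supAverage ((closedBall c r).indicator h) x ≤
        S * ∫⁻ x in closedBall c r, h x) (b : Fin n → ℝ) {R : ℝ}
    (hR : 0 < R) (hfin : ∫⁻ x in closedBall b R, h x ≠ ∞) {ε : ℝ} (hε : 0 < ε)
    (hεS : 2 * (25 ^ n * S * ENNReal.ofReal ε) ≤ 1) (N : ℝ≥0) :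
    ∫⁻ x in closedBall b R,
      min (supAverage ((closedBall b R).indicator h) x) N ^ ε * h x ≤
      2 * (⨍⁻ y in closedBall b R, h y ∂volume) ^ ε * ∫⁻ x in closedBall b R, h x := by
  set Q := closedBall b R with hQ
  set M := supAverage (Q.indicator h) with hM
  set m := ⨍⁻ y in Q, h y ∂volume with hm
  have hMm : Measurable M := measurable_supAverage _
  have hmT : m ≠ ∞ := by
    rw [hm, hQ, setLAverage_closedBall]
    exact ENNReal.div_ne_top hfin (volume_closedBall_ne_zero _ hR)
  let g : (Fin n → ℝ) → ℝ := fun x => (min (M x) N).toReal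
  have hminT : ∀ x, min (M x) (N : ℝ≥0∞) ≠ ∞ := fun x =>
    ((min_le_right _ _).trans_lt ENNReal.coe_lt_top).ne
  have hg0 : ∀ x, 0 ≤ g x := fun x => ENNReal.toReal_nonneg
  have hgm : Measurable g := (hMm.min measurable_const).ennreal_toReal
  have hgr : ∀ x, ∀ e : ℝ, 0 ≤ e → ENNReal.ofReal (g x ^ e) = min (M x) N ^ e := fun x e he => by
    rw [← ENNReal.ofReal_rpow_of_nonneg (hg0 x) he, ENNReal.ofReal_toReal (hminT x)]
  -- Truncation at `N` leaves the level sets below `N` unchanged and empties the others.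
  have hlev : ∀ t, 0 < t → {x | t < g x} = ∅ ∨ {x | t < g x} = {x | ENNReal.ofReal t < M x} := by
    intro t ht
    have key : ∀ x, t < g x ↔ ENNReal.ofReal t < min (M x) N := fun x =>
      (ENNReal.ofReal_lt_iff_lt_toReal ht.le (hminT x)).symm
    rcases lt_or_ge (ENNReal.ofReal t) N with htN | htN
    · right
      ext x
      simp only [mem_ofPred_eq, key, lt_min_iff, htN, and_true]
    · left
      ext x
      simp only [mem_ofPred_eq, key, lt_min_iff, not_lt.2 htN, and_false, mem_empty_iff_false]
  have hmean : ∀ t, m.toReal ≤ t → m ≤ ENNReal.ofReal t := fun t ht => by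
    rw [← ENNReal.ofReal_toReal hmT]
    exact ENNReal.ofReal_le_ofReal ht
  have hma : ENNReal.ofReal (m.toReal ^ ε) = m ^ ε := by
    rw [← ENNReal.ofReal_rpow_of_nonneg ENNReal.toReal_nonneg hε.le, ENNReal.ofReal_toReal hmT]
  have hmeas : ∀ t, MeasurableSet {x | t < g x} := fun t => measurableSet_lt measurable_const hgm
  have hpowm : ∀ e : ℝ, Measurable fun x => min (M x) (N : ℝ≥0∞) ^ e := fun e =>
    (hMm.min measurable_const).pow_const e
  have h1 : ∫⁻ x in Q, M x * min (M x) N ^ ε ≤ m ^ ε * (∫⁻ x in Q, M x) +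
      25 ^ n * S * ENNReal.ofReal ε * ∫⁻ x in Q, min (M x) N ^ (1 + ε) := by
    have := lintegral_rpow_le_of_level_le (μ := (volume.restrict Q).withDensity M)
      (ν := volume.restrict Q) hg0 hgm (a := m.toReal) ENNReal.toReal_nonneg hε
      (K := 25 ^ n * S) (fun t ht hat => by
        rw [withDensity_apply _ (hmeas t), Measure.restrict_restrict (hmeas t),
          Measure.restrict_apply (hmeas t)]
        rcases hlev t ht with e | e
        · simp [e]
        · rw [e]
          exact setLIntegral_supAverage_level_le h hS b hR (hmean t hat))
    simp only [hgr _ _ hε.le, hgr _ _ (by positivity : (0:ℝ) ≤ 1 + ε), hma] at this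
    rwa [lintegral_withDensity_eq_lintegral_mul _ hMm (hpowm ε),
      withDensity_apply _ MeasurableSet.univ, Measure.restrict_univ] at this
  have h2 : ∫⁻ x in Q, h x * min (M x) N ^ ε ≤ m ^ ε * (∫⁻ x in Q, h x) +
      25 ^ n * ENNReal.ofReal ε * ∫⁻ x in Q, min (M x) N ^ (1 + ε) := by
    have := lintegral_rpow_le_of_level_le (μ := (volume.restrict Q).withDensity h)
      (ν := volume.restrict Q) hg0 hgm (a := m.toReal) ENNReal.toReal_nonneg hε
      (K := 25 ^ n) (fun t ht hat => by
        rw [withDensity_apply _ (hmeas t), Measure.restrict_restrict (hmeas t),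
          Measure.restrict_apply (hmeas t)]
        rcases hlev t ht with e | e
        · simp [e]
        · rw [e]
          exact setLIntegral_level_le h b hR (hmean t hat))
    simp only [hgr _ _ hε.le, hgr _ _ (by positivity : (0:ℝ) ≤ 1 + ε), hma] at this
    rwa [lintegral_withDensity_eq_lintegral_mul _ hh (hpowm ε),
      withDensity_apply _ MeasurableSet.univ, Measure.restrict_univ] at this
  have hMint : ∫⁻ x in Q, M x ≤ S * ∫⁻ x in Q, h x := hS b R hR
  have hMT : ∫⁻ x in Q, M x ≠ ∞ := (hMint.trans_lt (ENNReal.mul_lt_top hST.lt_top hfin.lt_top)).ne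
  set J := ∫⁻ x in Q, min (M x) (N : ℝ≥0∞) ^ (1 + ε) with hJ
  set I := ∫⁻ x in Q, M x * min (M x) (N : ℝ≥0∞) ^ ε with hI
  have hJI : J ≤ I := by
    refine lintegral_mono fun x => ?_
    dsimp only
    rw [ENNReal.rpow_add_of_nonneg _ _ zero_le_one hε.le, ENNReal.rpow_one]
    gcongr
    exact min_le_left _ _
  have hIT : I ≠ ∞ := by
    have : I ≤ ∫⁻ x in Q, M x * (N : ℝ≥0∞) ^ ε := by
      refine lintegral_mono fun x => ?_
      dsimp only
      gcongr
      exact min_le_right _ _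
    rw [lintegral_mul_const _ hMm] at this
    exact (this.trans_lt (ENNReal.mul_lt_top hMT.lt_top (by finiteness))).ne
  -- The smallness `hεS` allows half of `I` to be absorbed; this requires `I` finite, which is what
  -- the truncation secures.
  have hI2 : I ≤ 2 * (m ^ ε * ∫⁻ x in Q, M x) := by
    have e : 2 * I ≤ 2 * (m ^ ε * ∫⁻ x in Q, M x) + I := by
      calc 2 * I ≤ 2 * (m ^ ε * (∫⁻ x in Q, M x) + 25 ^ n * S * ENNReal.ofReal ε * I) := by
            gcongr
            exact h1.trans (by gcongr)
        _ = 2 * (m ^ ε * ∫⁻ x in Q, M x) + 2 * (25 ^ n * S * ENNReal.ofReal ε) * I := by ring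
        _ ≤ 2 * (m ^ ε * ∫⁻ x in Q, M x) + 1 * I := by gcongr
        _ = _ := by rw [one_mul]
    rw [two_mul I] at e
    exact (ENNReal.add_le_add_iff_right hIT).1 e
  calc ∫⁻ x in Q, min (M x) N ^ ε * h x = ∫⁻ x in Q, h x * min (M x) N ^ ε := by
        simp_rw [mul_comm]
    _ ≤ m ^ ε * (∫⁻ x in Q, h x) + 25 ^ n * ENNReal.ofReal ε * J := h2
    _ ≤ m ^ ε * (∫⁻ x in Q, h x) + 25 ^ n * ENNReal.ofReal ε *
          (2 * (m ^ ε * (S * ∫⁻ x in Q, h x))) := by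
        gcongr
        exact hJI.trans (hI2.trans (by gcongr))
    _ = m ^ ε * (∫⁻ x in Q, h x) +
          2 * (25 ^ n * S * ENNReal.ofReal ε) * (m ^ ε * ∫⁻ x in Q, h x) := by ring
    _ ≤ m ^ ε * (∫⁻ x in Q, h x) + 1 * (m ^ ε * ∫⁻ x in Q, h x) := by gcongr
    _ = _ := by ring

/-- The sharp reverse Hölder inequality. -/
theorem setLAverage_rpow_le [NeZero n] {h : (Fin n → ℝ) → ℝ≥0∞}
    (hh : Measurable h) {S : ℝ≥0∞} (hST : S ≠ ∞)
    (hS : ∀ (c : Fin n → ℝ) (r : ℝ), 0 < r →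
      ∫⁻ x in closedBall c r, supAverage ((closedBall c r).indicator h) x ≤
        S * ∫⁻ x in closedBall c r, h x) (b : Fin n → ℝ) {R : ℝ}
    (hR : 0 < R) (hfin : ∫⁻ x in closedBall b R, h x ≠ ∞) {ε : ℝ} (hε : 0 < ε)
    (hεS : 2 * (25 ^ n * S * ENNReal.ofReal ε) ≤ 1) :
    ⨍⁻ x in closedBall b R, h x ^ (1 + ε) ∂volume ≤
      2 * (⨍⁻ y in closedBall b R, h y ∂volume) ^ (1 + ε) := by
  rw [setLAverage_le_iff hR]
  have hlim : Tendsto (fun N : ℕ => ∫⁻ x in closedBall b R,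
      min (supAverage ((closedBall b R).indicator h) x) (N : ℝ≥0) ^ ε * h x) atTop
      (𝓝 (∫⁻ x in closedBall b R, supAverage ((closedBall b R).indicator h) x ^ ε * h x)) := by
    refine lintegral_tendsto_of_tendsto_of_monotone (fun N => ?_) (ae_of_all _ fun x => ?_) ?_
    · exact ((((measurable_supAverage _).min measurable_const).pow_const ε).mul hh).aemeasurable
    · intro N N' hN
      dsimp only
      gcongr
    · have hae : ∀ᵐ x ∂volume.restrict (closedBall b R), h x < ∞ :=
        ae_lt_top hh hfin
      filter_upwards [hae] with x hx
      refine ENNReal.Tendsto.mul_const ?_ (Or.inr hx.ne)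
      refine ((ENNReal.continuous_rpow_const (y := ε)).tendsto _).comp ?_
      have : Tendsto (fun N : ℕ => min (supAverage ((closedBall b R).indicator h) x)
          (((N : ℝ≥0) : ℝ≥0∞))) atTop (𝓝 (min (supAverage ((closedBall b R).indicator h) x) ∞)) := by
        refine tendsto_const_nhds.min ?_
        simpa using ENNReal.tendsto_nat_nhds_top
      simpa using this
  have hle := le_of_tendsto hlim (Eventually.of_forall fun N =>
    setLIntegral_truncated_rpow_mul_le hh hST hS b hR hfin hε hεS N)
  have hae : ∀ᵐ x ∂volume.restrict (closedBall b R),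
      h x ≤ supAverage ((closedBall b R).indicator h) x := by
    have hfin' : ∫⁻ x, (closedBall b R).indicator h x ≠ ∞ := by
      rwa [lintegral_indicator measurableSet_closedBall]
    filter_upwards [ae_restrict_mem measurableSet_closedBall,
      ae_restrict_of_ae (ae_le_supAverage (hh.indicator measurableSet_closedBall) hfin')]
      with x hx hle
    simpa [hx] using hle
  calc ∫⁻ x in closedBall b R, h x ^ (1 + ε)
      ≤ ∫⁻ x in closedBall b R, supAverage ((closedBall b R).indicator h) x ^ ε * h x := by
        refine lintegral_mono_ae ?_
        filter_upwards [hae] with x hx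
        rw [add_comm, ENNReal.rpow_add_of_nonneg _ _ hε.le zero_le_one, ENNReal.rpow_one]
        gcongr
    _ ≤ _ := hle
    _ = _ := by
        rw [← setLAverage_mul_volume hR, add_comm,
          ENNReal.rpow_add_of_nonneg _ _ hε.le zero_le_one, ENNReal.rpow_one]
        ring

/-! ### Weights through measurable densities -/

theorem supAverage_congr_ae {g h : (Fin n → ℝ) → ℝ≥0∞} (hgh : g =ᵐ[volume] h) :
    supAverage g = supAverage h := by
  ext x
  exact iSup_congr fun Q => iSup_congr fun _ => iSup_congr fun _ =>
    laverage_congr (ae_restrict_of_ae hgh)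

/-- Setting the density to 1 on the exceptional null set makes it positive and finite everywhere, so
that its real powers multiply and cancel pointwise. -/
theorem IsWeight.exists_density {w : (Fin n → ℝ) → ℝ} (hw : IsWeight w) :
    ∃ W : (Fin n → ℝ) → ℝ≥0∞, Measurable W ∧ (∀ x, W x ≠ 0) ∧ (∀ x, W x ≠ ∞) ∧
      (fun x => ENNReal.ofReal (w x)) =ᵐ[volume] W ∧
      ∀ p, (fun x => ENNReal.ofReal (dualWeight p w x)) =ᵐ[volume]
        fun x => W x ^ (1 - p.conjExponent) := by
  have hm := hw.locallyIntegrable.aestronglyMeasurable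
  let v := hm.mk w
  have hv : Measurable v := hm.stronglyMeasurable_mk.measurable
  refine ⟨fun x => if 0 < v x then ENNReal.ofReal (v x) else 1, ?_, ?_, ?_, ?_, ?_⟩
  · exact Measurable.ite (measurableSet_lt measurable_const hv) hv.ennreal_ofReal measurable_const
  · intro x
    dsimp only
    split_ifs with h <;> simp [h]
  · intro x
    dsimp only
    split_ifs with h <;> simp
  · filter_upwards [hm.ae_eq_mk, hw.pos] with x hx hpos
    rw [hx] at hpos
    rw [if_pos hpos, hx]
  · intro p
    filter_upwards [hm.ae_eq_mk, hw.pos] with x hx hpos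
    rw [dualWeight, ENNReal.ofReal_rpow_of_pos hpos |>.symm]
    rw [hx] at hpos ⊢
    rw [if_pos hpos]

theorem weightMeasure_eq {w : (Fin n → ℝ) → ℝ} {W : (Fin n → ℝ) → ℝ≥0∞}
    (h : (fun x => ENNReal.ofReal (w x)) =ᵐ[volume] W) :
    weightMeasure w = volume.withDensity W := withDensity_congr_ae h

theorem setLAverage_congr_ae {g h : (Fin n → ℝ) → ℝ≥0∞} (hgh : g =ᵐ[volume] h)
    (s : Set (Fin n → ℝ)) : ⨍⁻ x in s, g x ∂volume = ⨍⁻ x in s, h x ∂volume :=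
  laverage_congr (ae_restrict_of_ae hgh)

theorem mul_le_apConst {p : ℝ} {w : (Fin n → ℝ) → ℝ} {W : (Fin n → ℝ) → ℝ≥0∞}
    (hW : (fun x => ENNReal.ofReal (w x)) =ᵐ[volume] W)
    (hd : (fun x => ENNReal.ofReal (dualWeight p w x)) =ᵐ[volume]
        fun x => W x ^ (1 - p.conjExponent)) (c : Fin n → ℝ) {r : ℝ} (hr : 0 < r) :
    (⨍⁻ x in closedBall c r, W x ∂volume) *
      (⨍⁻ x in closedBall c r, W x ^ (1 - p.conjExponent) ∂volume) ^ (p - 1) ≤ apConst p w := by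
  rw [← setLAverage_congr_ae hW, ← setLAverage_congr_ae hd]
  exact le_iSup₂_of_le (closedBall c r) (isCube_closedBall c hr) le_rfl

theorem setLIntegral_closedBall_pos {W : (Fin n → ℝ) → ℝ≥0∞} (hm : Measurable W)
    (h0 : ∀ x, W x ≠ 0) (c : Fin n → ℝ) {r : ℝ} (hr : 0 < r) :
    0 < ∫⁻ x in closedBall c r, W x := by
  rw [setLIntegral_pos_iff hm]
  have : Function.support W = univ := by
    ext x
    simp [h0 x]
  rw [this, univ_inter]
  exact measure_closedBall_pos _ _ hr

theorem setLAverage_closedBall_pos {W : (Fin n → ℝ) → ℝ≥0∞} (hm : Measurable W)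
    (h0 : ∀ x, W x ≠ 0) (c : Fin n → ℝ) {r : ℝ} (hr : 0 < r) :
    0 < ⨍⁻ x in closedBall c r, W x ∂volume := by
  rw [setLAverage_closedBall]
  exact ENNReal.div_pos (setLIntegral_closedBall_pos hm h0 c hr).ne' (volume_closedBall_ne_top _ _)

/-- Averages over cubes are controlled by the `A_s` constant of the cube (Hölder's inequality). -/
theorem setLAverage_rpow_mul_le {W g : (Fin n → ℝ) → ℝ≥0∞} (hW : Measurable W) (hg : Measurable g)
    (h0 : ∀ x, W x ≠ 0) (hT : ∀ x, W x ≠ ∞) {s : ℝ} (hs : 1 < s) (c : Fin n → ℝ) {r : ℝ}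
    (hr : 0 < r) :
    (⨍⁻ x in closedBall c r, g x ∂volume) ^ s * ∫⁻ x in closedBall c r, W x ≤
      ((⨍⁻ x in closedBall c r, W x ∂volume) *
        (⨍⁻ x in closedBall c r, W x ^ (-1 / (s - 1)) ∂volume) ^ (s - 1)) *
        ∫⁻ x in closedBall c r, g x ^ s * W x := by
  have hs0 : 0 < s := by linarith
  have hs1 : 0 < s - 1 := by linarith
  set Q := closedBall c r
  have hconj : s.HolderConjugate s.conjExponent := Real.HolderConjugate.conjExponent hs
  have hce : s.conjExponent = s / (s - 1) := rfl
  -- Hölder for the factorization g = (g W^(1/s)) · W^(-1/s).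
  have hhold := ENNReal.lintegral_mul_le_Lp_mul_Lq (volume.restrict Q) hconj
    (f := fun x => g x * W x ^ (1 / s)) (g := fun x => W x ^ (-1 / s))
    (hg.mul (hW.pow_const _)).aemeasurable (hW.pow_const _).aemeasurable
  have e1 : ∀ x, ((fun x => g x * W x ^ (1 / s)) * fun x => W x ^ (-1 / s)) x = g x := fun x => by
    simp only [Pi.mul_apply]
    rw [mul_assoc, ← ENNReal.rpow_add _ _ (h0 x) (hT x), show 1 / s + -1 / s = 0 by ring,
      ENNReal.rpow_zero, mul_one]
  have e2 : ∀ x, (g x * W x ^ (1 / s)) ^ s = g x ^ s * W x := fun x => by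
    rw [ENNReal.mul_rpow_of_nonneg _ _ hs0.le, ← ENNReal.rpow_mul, one_div_mul_cancel hs0.ne',
      ENNReal.rpow_one]
  have e3 : ∀ x, (W x ^ (-1 / s)) ^ s.conjExponent = W x ^ (-1 / (s - 1)) := fun x => by
    rw [← ENNReal.rpow_mul, hce]
    congr 1
    field_simp
  simp only [e1, e2, e3] at hhold
  have hpow : (∫⁻ x in Q, g x) ^ s ≤ (∫⁻ x in Q, g x ^ s * W x) *
      (∫⁻ x in Q, W x ^ (-1 / (s - 1))) ^ (s - 1) := by
    have := ENNReal.rpow_le_rpow hhold hs0.le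
    rwa [ENNReal.mul_rpow_of_nonneg _ _ hs0.le, ← ENNReal.rpow_mul, ← ENNReal.rpow_mul,
      one_div_mul_cancel hs0.ne', ENNReal.rpow_one,
      show 1 / s.conjExponent * s = s - 1 by rw [hce]; field_simp] at this
  have hV0 := volume_closedBall_ne_zero c hr
  have hVT := volume_closedBall_ne_top c r
  simp only [Q, setLAverage_closedBall] at *
  set V := volume (closedBall c r)
  rw [ENNReal.div_rpow_of_nonneg _ _ hs0.le, ENNReal.div_rpow_of_nonneg _ _ hs1.le]
  have hVs : V ^ s = V * V ^ (s - 1) := by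
    conv_lhs => rw [show s = 1 + (s - 1) by ring]
    rw [ENNReal.rpow_add _ _ hV0 hVT, ENNReal.rpow_one]
  calc _ ≤ ((∫⁻ x in closedBall c r, g x ^ s * W x) *
        (∫⁻ x in closedBall c r, W x ^ (-1 / (s - 1))) ^ (s - 1)) / V ^ s *
          ∫⁻ x in closedBall c r, W x := by gcongr
    _ = _ := by
        rw [hVs]
        simp only [div_eq_mul_inv]
        rw [ENNReal.mul_inv (Or.inl hV0) (Or.inl hVT)]
        ring

/-- On a cube, the maximal function of the localized weight is at least the average of the weight
over that cube. -/
theorem one_le_aInftyConst {v : (Fin n → ℝ) → ℝ} {h : (Fin n → ℝ) → ℝ≥0∞} (hm : Measurable h)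
    (hv : (fun x => ENNReal.ofReal (v x)) =ᵐ[volume] h) (hnn : ∀ᵐ x, 0 ≤ v x)
    (h0 : ∀ x, h x ≠ 0) {c : Fin n → ℝ} {r : ℝ} (hr : 0 < r)
    (hT : ∫⁻ x in closedBall c r, h x ≠ ∞) : 1 ≤ aInftyConst v := by
  refine le_iSup₂_of_le (closedBall c r) (isCube_closedBall c hr) ?_
  have hsig : weightMeasure v (closedBall c r) = ∫⁻ x in closedBall c r, h x := by
    rw [weightMeasure_eq hv, withDensity_apply _ measurableSet_closedBall]
  rw [hsig, ENNReal.le_div_iff_mul_le (Or.inl (setLIntegral_closedBall_pos hm h0 c hr).ne')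
    (Or.inl hT), one_mul]
  have hae : (fun y => ‖(closedBall c r).indicator v y‖ₑ) =ᵐ[volume]
      (closedBall c r).indicator h := by
    filter_upwards [hv, hnn] with x hx hx0
    by_cases hxc : x ∈ closedBall c r
    · rw [indicator_of_mem hxc, indicator_of_mem hxc, ← hx, Real.enorm_of_nonneg hx0]
    · simp [hxc]
  calc ∫⁻ x in closedBall c r, h x
      = ∫⁻ _ in closedBall c r, ⨍⁻ y in closedBall c r, h y ∂volume := by
        rw [lintegral_const, Measure.restrict_apply_univ, setLAverage_mul_volume hr]
    _ ≤ _ := by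
        refine setLIntegral_mono' measurableSet_closedBall fun x hx => ?_
        rw [maximalFn_eq, supAverage_congr_ae hae]
        refine le_trans (le_of_eq ?_) (setLAverage_le_supAverage _ hr hx)
        rw [setLAverage_closedBall, setLAverage_closedBall, setLIntegral_indicator_closedBall,
          inter_self]

theorem setLIntegral_supAverage_le_aInftyConst {v : (Fin n → ℝ) → ℝ} {h : (Fin n → ℝ) → ℝ≥0∞}
    (hm : Measurable h) (hv : (fun x => ENNReal.ofReal (v x)) =ᵐ[volume] h)
    (hnn : ∀ᵐ x, 0 ≤ v x) (h0 : ∀ x, h x ≠ 0) {c : Fin n → ℝ} {r : ℝ} (hr : 0 < r)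
    (hT : ∫⁻ x in closedBall c r, h x ≠ ∞) :
    ∫⁻ x in closedBall c r, supAverage ((closedBall c r).indicator h) x ≤
      aInftyConst v * ∫⁻ x in closedBall c r, h x := by
  have hsig : weightMeasure v (closedBall c r) = ∫⁻ x in closedBall c r, h x := by
    rw [weightMeasure_eq hv, withDensity_apply _ measurableSet_closedBall]
  have hae : (fun y => ‖(closedBall c r).indicator v y‖ₑ) =ᵐ[volume]
      (closedBall c r).indicator h := by
    filter_upwards [hv, hnn] with x hx hx0
    by_cases hxc : x ∈ closedBall c r
    · rw [indicator_of_mem hxc, indicator_of_mem hxc, ← hx, Real.enorm_of_nonneg hx0]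
    · simp [hxc]
  have hle : (∫⁻ x in closedBall c r, maximalFn ((closedBall c r).indicator v) x) /
      weightMeasure v (closedBall c r) ≤ aInftyConst v :=
    le_iSup₂_of_le (closedBall c r) (isCube_closedBall c hr) le_rfl
  rw [hsig, ENNReal.div_le_iff (setLIntegral_closedBall_pos hm h0 c hr).ne' hT, maximalFn_eq,
    supAverage_congr_ae hae] at hle
  exact hle

theorem one_sub_conjExponent {p : ℝ} (hp : 1 < p) : 1 - p.conjExponent = -1 / (p - 1) := by
  have : p - 1 ≠ 0 := by linarith
  rw [Real.conjExponent]
  field_simp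
  ring

/-- Hölder's inequality `setLAverage_rpow_mul_le` with g = 1 on a single cube. -/
theorem one_le_apConst {p : ℝ} (hp : 1 < p) {w : (Fin n → ℝ) → ℝ} (hw : IsWeight w) :
    1 ≤ apConst p w := by
  obtain ⟨W, hWm, h0, hT, hW, hd⟩ := hw.exists_density
  have hle := mul_le_apConst hW (hd p) 0 one_pos
  have hh := setLAverage_rpow_mul_le hWm (measurable_const (a := 1)) h0 hT hp 0 one_pos
  rw [one_sub_conjExponent hp] at hle
  have h1 : ⨍⁻ _ in closedBall (0 : Fin n → ℝ) 1, (1 : ℝ≥0∞) ∂volume = 1 := by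
    rw [setLAverage_closedBall, lintegral_one, Measure.restrict_apply_univ,
      ENNReal.div_self (volume_closedBall_ne_zero _ one_pos) (volume_closedBall_ne_top _ _)]
  simp only [h1, ENNReal.one_rpow, one_mul] at hh
  have hI0 := (setLIntegral_closedBall_pos hWm h0 0 one_pos).ne'
  have hIT : ∫⁻ x in closedBall (0 : Fin n → ℝ) 1, W x ≠ ∞ := by
    have := (hw.locallyIntegrable.integrableOn_isCompact
      (isCompact_closedBall (0 : Fin n → ℝ) 1)).lintegral_lt_top
    rw [lintegral_congr_ae (ae_restrict_of_ae hW)] at this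
    exact this.ne
  have := hh.trans (mul_le_mul_left hle _)
  by_contra! hlt
  exact absurd this (not_le.2 (by
    calc _ < 1 * ∫⁻ x in closedBall (0 : Fin n → ℝ) 1, W x :=
          ENNReal.mul_lt_mul_left hI0 hIT hlt
      _ = _ := one_mul _))

/-- The average of `W` over the cube is positive, so an infinite average of the dual weight would
make the A_p constant infinite. -/
theorem setLIntegral_dual_ne_top {p : ℝ} (hp : 1 < p) {w : (Fin n → ℝ) → ℝ}
    (hA : apConst p w ≠ ∞) {W : (Fin n → ℝ) → ℝ≥0∞} (hWm : Measurable W) (h0 : ∀ x, W x ≠ 0)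
    (hW : (fun x => ENNReal.ofReal (w x)) =ᵐ[volume] W)
    (hd : (fun x => ENNReal.ofReal (dualWeight p w x)) =ᵐ[volume]
        fun x => W x ^ (1 - p.conjExponent)) (c : Fin n → ℝ) {r : ℝ} (hr : 0 < r) :
    ∫⁻ x in closedBall c r, W x ^ (1 - p.conjExponent) ≠ ∞ := by
  intro h
  have hle := mul_le_apConst hW hd c hr
  have hinf : ⨍⁻ x in closedBall c r, W x ^ (1 - p.conjExponent) ∂volume = ∞ := by
    rw [setLAverage_closedBall, h, ENNReal.top_div_of_ne_top (volume_closedBall_ne_top _ _)]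
  rw [hinf, ENNReal.top_rpow_of_pos (by linarith),
    ENNReal.mul_top (setLAverage_closedBall_pos hWm h0 c hr).ne', top_le_iff] at hle
  exact hA hle

theorem one_le_aInftyConst_dualWeight {p : ℝ} (hp : 1 < p) {w : (Fin n → ℝ) → ℝ}
    (hw : w ∈ apClass n p) : 1 ≤ aInftyConst (dualWeight p w) := by
  obtain ⟨W, hWm, h0, hT, hW, hd⟩ := hw.1.exists_density
  refine one_le_aInftyConst (hWm.pow_const _) (hd p) ?_ (fun x => ?_) one_pos
    (setLIntegral_dual_ne_top hp hw.2.ne hWm h0 hW (hd p) 0 one_pos)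
  · filter_upwards [hw.1.pos] with x hx
    exact (Real.rpow_pos_of_pos hx _).le
  · simp [ENNReal.rpow_eq_zero_iff, h0 x, hT x]

/-! ### The upper bound -/

theorem exists_two_pow_lt_le {a : ℝ} (ha : 0 < a) {y : ℝ≥0∞} (hy : y ≠ ∞)
    (hay : ENNReal.ofReal a < y) :
    ∃ k : ℕ, ENNReal.ofReal (2 ^ k * a) < y ∧ y ≤ ENNReal.ofReal (2 ^ (k + 1) * a) := by
  have hex : ∃ k : ℕ, y ≤ ENNReal.ofReal (2 ^ (k + 1) * a) := by
    obtain ⟨k, hk⟩ := pow_unbounded_of_one_lt (y.toReal / a) one_lt_two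
    refine ⟨k, ?_⟩
    rw [← ENNReal.ofReal_toReal hy]
    apply ENNReal.ofReal_le_ofReal
    rw [div_lt_iff₀ ha] at hk
    refine hk.le.trans ?_
    gcongr <;> linarith
  classical
  refine ⟨Nat.find hex, ?_, Nat.find_spec hex⟩
  rcases Nat.eq_zero_or_pos (Nat.find hex) with h | h
  · rwa [h, pow_zero, one_mul]
  · have := Nat.find_min hex (Nat.sub_lt h one_pos)
    rw [not_le] at this
    rwa [Nat.sub_add_cancel (show 1 ≤ Nat.find hex from h)] at this

/-- Weak type `(s, s)` bounds the distribution function of the maximal function by a series. -/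
theorem measure_lt_supAverage_le_tsum {μ : Measure (Fin n → ℝ)} {B : ℝ≥0∞} {s : ℝ} (hs : 0 < s)
    (H : ∀ g : (Fin n → ℝ) → ℝ≥0∞, Measurable g → ∀ a : ℝ≥0∞,
      a ^ s * μ {x | a < supAverage g x} ≤ B * ∫⁻ y, g y ^ s ∂μ)
    {φ : (Fin n → ℝ) → ℝ≥0∞} (hφ : Measurable φ) (hφT : ∀ x, φ x ≠ ∞) {a : ℝ} (ha : 0 < a) :
    μ {x | ENNReal.ofReal (2 * a) < supAverage φ x} ≤
      B * ∑' k : ℕ, 2 ^ ((k + 1) * s) * μ {x | ENNReal.ofReal (2 ^ k * a) < φ x} := by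
  have ha0 : ENNReal.ofReal a ≠ 0 := by simpa using ha
  have hms : ∀ t : ℝ≥0∞, MeasurableSet {x | t < φ x} := fun t => measurableSet_lt measurable_const hφ
  -- Since φ ≤ a + g, one has Mφ ≤ a + Mg, and Mφ > 2a forces Mg > a.
  let g := {x | ENNReal.ofReal a < φ x}.indicator φ
  have hg : Measurable g := hφ.indicator (hms _)
  have hsub : {x | ENNReal.ofReal (2 * a) < supAverage φ x} ⊆
      {x | ENNReal.ofReal a < supAverage g x} := by
    intro x hx
    have h1 : supAverage φ x ≤ ENNReal.ofReal a + supAverage g x := by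
      refine le_trans (supAverage_mono (fun y => ?_) x) (supAverage_const_add_le g _ x)
      by_cases hy : ENNReal.ofReal a < φ y
      · exact le_add_left (by simp [g, hy])
      · exact le_add_right (not_lt.1 hy)
    have h2 : ENNReal.ofReal a + ENNReal.ofReal a < ENNReal.ofReal a + supAverage g x := by
      rw [← ENNReal.ofReal_add ha.le ha.le, ← two_mul]
      exact lt_of_lt_of_le hx h1
    exact (ENNReal.add_lt_add_iff_left ENNReal.ofReal_ne_top).1 h2
  -- Where φ exceeds `a` it lies in a band 2^k a < φ ≤ 2^(k+1) a, as φ is finite; the term of that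
  -- index alone dominates.
  have hpt : ∀ x, g x ^ s ≤ ∑' k : ℕ, ENNReal.ofReal a ^ s * 2 ^ ((k + 1) * s) *
      {x | ENNReal.ofReal (2 ^ k * a) < φ x}.indicator 1 x := by
    intro x
    by_cases hx : ENNReal.ofReal a < φ x
    · obtain ⟨k, hk1, hk2⟩ := exists_two_pow_lt_le ha (hφT x) hx
      refine le_trans ?_ (ENNReal.le_tsum k)
      have e : g x = φ x := by simp [g, hx]
      rw [e, indicator_of_mem (by exact hk1), Pi.one_apply, mul_one]
      refine (ENNReal.rpow_le_rpow hk2 hs.le).trans (le_of_eq ?_)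
      rw [ENNReal.ofReal_mul (by positivity), ENNReal.mul_rpow_of_nonneg _ _ hs.le, mul_comm,
        ENNReal.ofReal_pow two_pos.le, ← ENNReal.rpow_natCast, ← ENNReal.rpow_mul]
      simp
    · simp [g, hx, ENNReal.zero_rpow_of_pos hs]
  have hint : ∫⁻ x, g x ^ s ∂μ ≤ ENNReal.ofReal a ^ s * ∑' k : ℕ, 2 ^ ((k + 1) * s) *
      μ {x | ENNReal.ofReal (2 ^ k * a) < φ x} := by
    refine (lintegral_mono hpt).trans (le_of_eq ?_)
    rw [lintegral_tsum fun k => ((measurable_one.indicator (hms _)).const_mul _).aemeasurable,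
      ← ENNReal.tsum_mul_left]
    congr 1
    ext k
    rw [lintegral_const_mul _ (measurable_one.indicator (hms _)), lintegral_indicator_one (hms _),
      mul_assoc]
  have hmain := (H g hg (ENNReal.ofReal a)).trans (mul_le_mul_right hint B)
  rw [mul_left_comm] at hmain
  refine (measure_mono hsub).trans ?_
  have has0 : ENNReal.ofReal a ^ s ≠ 0 := by simp [ENNReal.rpow_eq_zero_iff, ha]
  have hasT : ENNReal.ofReal a ^ s ≠ ∞ := by finiteness
  exact (ENNReal.mul_le_mul_iff_right has0 hasT).1 hmain

theorem lorentzNorm_congr_ae {p : ℝ} {q : ℝ≥0∞} {w : (Fin n → ℝ) → ℝ} {g h : (Fin n → ℝ) → ℝ≥0∞}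
    (hgh : g =ᵐ[volume] h) : lorentzNorm p q w g = lorentzNorm p q w h := by
  have : ∀ s, weightMeasure w {x | s < g x} = weightMeasure w {x | s < h x} := fun s => by
    refine measure_congr ?_
    have hac : weightMeasure w ≪ volume := withDensity_absolutelyContinuous _ _
    filter_upwards [hac.ae_eq hgh] with x hx
    show (s < g x) = (s < h x)
    rw [hx]
  unfold lorentzNorm
  simp only [this]

theorem maximalNorm_le {p : ℝ} {q : ℝ≥0∞} {w : (Fin n → ℝ) → ℝ} {C : ℝ≥0∞}
    (h : ∀ φ : (Fin n → ℝ) → ℝ≥0∞, Measurable φ → (∀ x, φ x ≠ ∞) →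
      lorentzNorm p q w (supAverage φ) ≤ C * lorentzNorm p q w φ) : maximalNorm p q w ≤ C := by
  refine iSup_le fun f => iSup_le fun hf => iSup₂_le fun _ _ => ?_
  refine ENNReal.div_le_of_le_mul ?_
  have hae : (fun x => ‖f x‖ₑ) =ᵐ[volume] fun x => ‖hf.mk f x‖ₑ := by
    filter_upwards [hf.ae_eq_mk] with x hx
    rw [hx]
  rw [maximalFn_eq, supAverage_congr_ae hae, lorentzNorm_congr_ae hae]
  exact h _ hf.stronglyMeasurable_mk.measurable.enorm fun x => enorm_ne_top

/-- A bound uniform in `p`, needed for a constant depending on `n` and `q` only. For q = ∞ the value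
1 / `q.toReal` is 1/0 = 0, and the bound reads 1/p ≤ 1. -/
theorem invMin_le (p : ℝ) (hp : 1 < p) {q : ℝ≥0∞} : invMin p q ≤ 1 + 1 / q.toReal := by
  rcases le_total q (ENNReal.ofReal p) with h | h
  · rw [invMin_of_ge h]
    linarith
  · rw [invMin_of_le (by linarith) h]
    have : 1 / p ≤ 1 := (div_le_one (by linarith)).2 hp.le
    have : 0 ≤ 1 / q.toReal := by positivity
    linarith

/-- The mixed bound in terms of the reverse Hölder exponent. -/
theorem maximalNorm_le_of_reverseHolder {p : ℝ} (hp : 1 < p) {q : ℝ≥0∞} (hq : q ≠ 0)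
    {w : (Fin n → ℝ) → ℝ} {W : (Fin n → ℝ) → ℝ≥0∞} (hWm : Measurable W) (h0 : ∀ x, W x ≠ 0)
    (hT : ∀ x, W x ≠ ∞) (hW : (fun x => ENNReal.ofReal (w x)) =ᵐ[volume] W)
    (hd : (fun x => ENNReal.ofReal (dualWeight p w x)) =ᵐ[volume]
        fun x => W x ^ (1 - p.conjExponent)) {ε : ℝ} (hε : 0 < ε)
    (hRH : ∀ (c : Fin n → ℝ) (r : ℝ), 0 < r →
      ⨍⁻ x in closedBall c r, (W x ^ (1 - p.conjExponent)) ^ (1 + ε) ∂volume ≤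
      2 * (⨍⁻ x in closedBall c r, W x ^ (1 - p.conjExponent) ∂volume) ^ (1 + ε)) :
    maximalNorm p q w ≤ 8 * 5 ^ n * apConst p w ^ (1 / p) *
      ENNReal.ofReal (1 + 2 * (p.conjExponent * invMin p q * (1 + 1 / ε))) ^ invMin p q := by
  have hp0 : 0 < p := by linarith
  have hp1 : 0 < p - 1 := by linarith
  have hr0 : 0 < 1 + ε := by linarith
  set A := apConst p w
  -- The choice (s-1)(1+ε) = p-1 makes the dual weight of the A_s condition equal to σ^(1+ε), to
  -- which the reverse Hölder inequality applies.
  set s := 1 + (p - 1) / (1 + ε) with hs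
  have hs1 : 1 < s := by
    have : 0 < (p - 1) / (1 + ε) := by positivity
    linarith
  have hsp : s < p := by
    have : (p - 1) / (1 + ε) < p - 1 := div_lt_self hp1 (by linarith)
    linarith
  have hs0 : 0 < s := by linarith
  set μ := volume.withDensity W with hμ
  have hexp : ∀ x, W x ^ (-1 / (s - 1)) = (W x ^ (1 - p.conjExponent)) ^ (1 + ε) := fun x => by
    rw [← ENNReal.rpow_mul, one_sub_conjExponent hp, hs]
    congr 1
    rw [add_sub_cancel_left]
    field_simp
  have hH : ∀ (c : Fin n → ℝ) (r : ℝ), 0 < r → ∀ g : (Fin n → ℝ) → ℝ≥0∞, Measurable g →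
      (⨍⁻ y in closedBall c r, g y ∂volume) ^ s * μ (closedBall c r)
        ≤ 2 ^ (p - 1) * A * ∫⁻ y in closedBall c r, g y ^ s ∂μ := by
    intro c r hr g hg
    rw [hμ, withDensity_apply _ measurableSet_closedBall,
      setLIntegral_withDensity_eq_setLIntegral_mul _ hWm (hg.pow_const s) measurableSet_closedBall]
    refine (setLAverage_rpow_mul_le hWm hg h0 hT hs1 c hr).trans ?_
    simp only [Pi.mul_apply, mul_comm (W _)]
    gcongr ?_ * _
    simp only [hexp]
    have hs1' : 0 ≤ s - 1 := by linarith
    have hss : s - 1 = (p - 1) / (1 + ε) := by rw [hs]; ring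
    calc _ ≤ (⨍⁻ x in closedBall c r, W x ∂volume) *
          (2 * (⨍⁻ x in closedBall c r, W x ^ (1 - p.conjExponent) ∂volume) ^ (1 + ε)) ^ (s - 1) := by
          gcongr
          exact hRH c r hr
      _ = 2 ^ (s - 1) * ((⨍⁻ x in closedBall c r, W x ∂volume) *
          (⨍⁻ x in closedBall c r, W x ^ (1 - p.conjExponent) ∂volume) ^ (p - 1)) := by
          rw [ENNReal.mul_rpow_of_nonneg _ _ hs1', ← ENNReal.rpow_mul,
            show (1 + ε) * (s - 1) = p - 1 by rw [hss]; field_simp]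
          ring
      _ ≤ 2 ^ (p - 1) * A := by
          gcongr
          · norm_num
          · exact mul_le_apConst hW hd c hr
  refine maximalNorm_le fun φ hφ hφT => ?_
  rw [lorentzNorm_eq_distNorm, lorentzNorm_eq_distNorm, weightMeasure_eq hW]
  have hFm : Measurable fun t : ℝ => μ {x | ENNReal.ofReal t < φ x} := by
    have : Antitone fun t : ℝ => μ {x | ENNReal.ofReal t < φ x} := fun t t' htt =>
      measure_mono fun x (hx : ENNReal.ofReal t' < φ x) =>
        (ENNReal.ofReal_le_ofReal htt).trans_lt hx
    exact this.measurable
  have hkey := distNorm_le_of_le_tsum hp0 hsp hq hFm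
    (G := fun t => μ {x | ENNReal.ofReal t < supAverage φ x})
    (B := 2 ^ (p - 1) * A * (5 ^ n) ^ s) (fun a ha =>
      measure_lt_supAverage_le_tsum hs0
        (fun g hg a => mul_measure_lt_supAverage_le hs0 hH hg a) hφ hφT ha)
  refine hkey.trans ?_
  gcongr ?_ * _
  have hinv : 0 < invMin p q := invMin_pos hp0 hq
  -- Here p - s = (p-1)ε/(1+ε), so p/(p-s) = p'(1+1/ε).
  have e1 : 2 / ((p - s) / (p * invMin p q)) =
      2 * (p.conjExponent * invMin p q * (1 + 1 / ε)) := by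
    have : p - s = (p - 1) * ε / (1 + ε) := by rw [hs]; field_simp; ring
    rw [this, Real.conjExponent]
    field_simp
    ring
  rw [e1]
  gcongr ?_ * _
  have hp1' : 0 ≤ 1 / p := by positivity
  rw [ENNReal.mul_rpow_of_nonneg _ _ hp1', ENNReal.mul_rpow_of_nonneg _ _ hp1',
    ← ENNReal.rpow_mul, ← ENNReal.rpow_mul]
  -- The root of order `p` makes the constant uniform in `p`: the exponents (p-1)/p and s/p are at
  -- most 1.
  calc 4 * ((2 : ℝ≥0∞) ^ ((p - 1) * (1 / p)) * A ^ (1 / p) * (5 ^ n) ^ (s * (1 / p)))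
      ≤ 4 * ((2 : ℝ≥0∞) ^ (1 : ℝ) * A ^ (1 / p) * (5 ^ n) ^ (1 : ℝ)) := by
        gcongr
        · norm_num
        · rw [mul_one_div, div_le_one hp0]; linarith
        · exact one_le_pow₀ (by norm_num)
        · rw [mul_one_div, div_le_one hp0]; linarith
    _ = _ := by
        rw [ENNReal.rpow_one, ENNReal.rpow_one]
        ring

/-- The mixed `A_p`-`A_∞` bound for the maximal operator on Lorentz spaces. -/
theorem exists_maximalNorm_le [NeZero n] {q : ℝ≥0∞} (hq : q ≠ 0) : ∃ C : ℝ≥0, ∀ p : ℝ, 1 < p →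
    ∀ w ∈ apClass n p, maximalNorm p q w ≤
      C * ENNReal.ofReal p.conjExponent ^ invMin p q * apConst p w ^ (1 / p) *
        aInftyConst (dualWeight p w) ^ invMin p q := by
  -- `K` collects the constants of `hbase`: 1 + 1/ε ≤ 3·25^n S, times 2 and the uniform bound for
  -- `invMin`; the initial 1 is absorbed since p' S ≥ 1.
  set K : ℝ := 1 + 6 * 25 ^ n * (1 + 1 / q.toReal) with hK
  have hK1 : 1 ≤ K := by
    have : 0 ≤ 6 * 25 ^ n * (1 + 1 / q.toReal) := by positivity
    linarith
  refine ⟨8 * 5 ^ n * Real.toNNReal K ^ (1 + 1 / q.toReal), fun p hp w hw => ?_⟩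
  have hp0 : 0 < p := by linarith
  have hinv : 0 < invMin p q := invMin_pos hp0 hq
  have hA1 := one_le_apConst hp hw.1
  have hS1 := one_le_aInftyConst_dualWeight hp hw
  set A := apConst p w
  set S := aInftyConst (dualWeight p w) with hS
  have hconj : 1 ≤ p.conjExponent := by
    rw [Real.conjExponent, one_le_div (by linarith)]
    linarith
  have hC : ((8 * 5 ^ n * Real.toNNReal K ^ (1 + 1 / q.toReal) : ℝ≥0) : ℝ≥0∞) =
      8 * 5 ^ n * ENNReal.ofReal K ^ (1 + 1 / q.toReal) := by
    push_cast
    rw [ENNReal.coe_rpow_of_nonneg _ (by positivity)]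
    rfl
  have hK1' : 1 ≤ ENNReal.ofReal K := by
    rw [← ENNReal.ofReal_one]
    exact ENNReal.ofReal_le_ofReal hK1
  -- With `S` infinite the right-hand side is infinite, because its other factors are nonzero.
  rcases eq_or_ne S ∞ with hST | hST
  · rw [hC, hST, ENNReal.top_rpow_of_pos hinv, ENNReal.mul_top]
    · exact le_top
    · have h1 : (1 : ℝ≥0∞) ≤ ENNReal.ofReal p.conjExponent := by
        rw [← ENNReal.ofReal_one]
        exact ENNReal.ofReal_le_ofReal hconj
      have h2 := ENNReal.one_le_rpow h1 hinv
      have h3 := ENNReal.one_le_rpow hA1 (by positivity : 0 < 1 / p)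
      have h4 := ENNReal.one_le_rpow hK1' (by positivity : 0 < 1 + 1 / q.toReal)
      refine mul_ne_zero (mul_ne_zero (mul_ne_zero (by simp) ?_) ?_) ?_ <;>
        refine (lt_of_lt_of_le one_pos ?_).ne' <;> assumption
  obtain ⟨W, hWm, h0, hT, hW, hd⟩ := hw.1.exists_density
  have hSr : 1 ≤ S.toReal := by
    rwa [← ENNReal.toReal_one, ENNReal.toReal_le_toReal ENNReal.one_ne_top hST]
  set ε : ℝ := 1 / (2 * 25 ^ n * S.toReal) with hε
  have hε0 : 0 < ε := by positivity
  have hεS : 2 * (25 ^ n * S * ENNReal.ofReal ε) ≤ 1 := by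
    rw [← ENNReal.ofReal_toReal hST]
    have : (2 : ℝ≥0∞) * (25 ^ n * ENNReal.ofReal S.toReal * ENNReal.ofReal ε) =
        ENNReal.ofReal (2 * (25 ^ n * S.toReal * ε)) := by
      rw [ENNReal.ofReal_mul (by positivity), ENNReal.ofReal_mul (by positivity),
        ENNReal.ofReal_mul (by positivity), ENNReal.ofReal_pow (by positivity)]
      simp
    rw [this, ← ENNReal.ofReal_one]
    apply ENNReal.ofReal_le_ofReal
    rw [hε]
    apply le_of_eq
    field_simp
  have hfin : ∀ (c : Fin n → ℝ) (r : ℝ), 0 < r →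
      ∫⁻ x in closedBall c r, W x ^ (1 - p.conjExponent) ≠ ∞ := fun c r hr =>
    setLIntegral_dual_ne_top hp hw.2.ne hWm h0 hW (hd p) c hr
  have hσm : Measurable fun x => W x ^ (1 - p.conjExponent) := hWm.pow_const _
  have hnn : ∀ᵐ x, 0 ≤ dualWeight p w x := by
    filter_upwards [hw.1.pos] with x hx
    exact (Real.rpow_pos_of_pos hx _).le
  have hRH := fun (c : Fin n → ℝ) (r : ℝ) (hr : 0 < r) =>
    setLAverage_rpow_le hσm hST (fun c r hr => setLIntegral_supAverage_le_aInftyConst hσm (hd p) hnn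
      (fun x => by simp [ENNReal.rpow_eq_zero_iff, h0 x, hT x]) hr (hfin c r hr)) c hr (hfin c r hr)
      hε0 hεS
  refine (maximalNorm_le_of_reverseHolder hp hq hWm h0 hT hW (hd p) hε0 hRH).trans ?_
  rw [hC]
  have hbase : ENNReal.ofReal (1 + 2 * (p.conjExponent * invMin p q * (1 + 1 / ε))) ≤
      ENNReal.ofReal p.conjExponent * S * ENNReal.ofReal K := by
    conv_rhs => rw [← ENNReal.ofReal_toReal hST]
    rw [← ENNReal.ofReal_mul (by linarith), ← ENNReal.ofReal_mul (by positivity)]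
    apply ENNReal.ofReal_le_ofReal
    have h25 : (1 : ℝ) ≤ 25 ^ n := one_le_pow₀ (by norm_num)
    have e : 1 + 1 / ε ≤ 3 * 25 ^ n * S.toReal := by
      rw [hε, one_div_one_div]
      nlinarith
    have hPS : 1 ≤ p.conjExponent * S.toReal := by nlinarith
    calc 1 + 2 * (p.conjExponent * invMin p q * (1 + 1 / ε))
        ≤ p.conjExponent * S.toReal +
          2 * (p.conjExponent * (1 + 1 / q.toReal) * (3 * 25 ^ n * S.toReal)) := by
          gcongr
          exact invMin_le p hp
      _ = _ := by rw [hK]; ring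
  calc _ ≤ 8 * 5 ^ n * A ^ (1 / p) *
        (ENNReal.ofReal p.conjExponent * S * ENNReal.ofReal K) ^ invMin p q := by gcongr
    _ ≤ 8 * 5 ^ n * A ^ (1 / p) * (ENNReal.ofReal p.conjExponent ^ invMin p q * S ^ invMin p q *
          ENNReal.ofReal K ^ (1 + 1 / q.toReal)) := by
        rw [ENNReal.mul_rpow_of_nonneg _ _ hinv.le, ENNReal.mul_rpow_of_nonneg _ _ hinv.le]
        gcongr
        exact invMin_le p hp
    _ = _ := by ring

/-! ### Radial weights whose dual weight is in `A_1` -/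

theorem ae_ne_zero [NeZero n] : ∀ᵐ x : Fin n → ℝ, x ≠ 0 := by
  rw [ae_iff]
  simp only [ne_eq, not_not]
  exact measure_singleton (0 : Fin n → ℝ)

/-- For a decreasing radial function the A_1 condition needs checking only on cubes centred at 0. A
cube near the origin is enclosed in a centred one of three times the radius; on a cube far from it
the function varies by a bounded factor. -/
theorem setLAverage_radial_le [NeZero n] {s : ℝ → ℝ} (hs : AntitoneOn s (Ioi 0))
    {K : ℝ≥0∞} (hK : ∀ R, 0 < R →
      ⨍⁻ y in closedBall (0 : Fin n → ℝ) R, ENNReal.ofReal (s ‖y‖) ∂volume ≤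
        K * ENNReal.ofReal (s R))
    (c : Fin n → ℝ) {r : ℝ} (hr : 0 < r) {x : Fin n → ℝ} (hx : x ∈ closedBall c r) (hx0 : x ≠ 0) :
    ⨍⁻ y in closedBall c r, ENNReal.ofReal (s ‖y‖) ∂volume ≤
      3 ^ n * K * ENNReal.ofReal (s ‖x‖) := by
  have hxn : 0 < ‖x‖ := norm_pos_iff.2 hx0
  have h3 : ENNReal.ofReal 3 ^ n = (3 : ℝ≥0∞) ^ n := by rw [ENNReal.ofReal_ofNat]
  have hxc : ‖x‖ ≤ ‖c‖ + r := by
    rw [mem_closedBall, dist_eq_norm] at hx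
    linarith [norm_le_norm_add_norm_sub' x c]
  rw [setLAverage_le_iff hr]
  have hK' : ∀ R, 0 < R → ∫⁻ y in closedBall (0 : Fin n → ℝ) R, ENNReal.ofReal (s ‖y‖) ≤
        K * ENNReal.ofReal (s R) * volume (closedBall (0 : Fin n → ℝ) R) := fun R hR =>
    (setLAverage_le_iff hR).1 (hK R hR)
  rcases le_or_gt ‖c‖ (2 * r) with hc | hc
  · have hsub : closedBall c r ⊆ closedBall 0 (3 * r) := by
      intro y hy
      rw [mem_closedBall, dist_eq_norm] at hy
      rw [mem_closedBall, dist_zero_right]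
      linarith [norm_le_norm_add_norm_sub' y c]
    calc _ ≤ ∫⁻ y in closedBall (0 : Fin n → ℝ) (3 * r), ENNReal.ofReal (s ‖y‖) :=
          lintegral_mono_set hsub
      _ ≤ K * ENNReal.ofReal (s (3 * r)) * volume (closedBall (0 : Fin n → ℝ) (3 * r)) :=
          hK' _ (by positivity)
      _ = 3 ^ n * K * ENNReal.ofReal (s (3 * r)) * volume (closedBall c r) := by
          rw [volume_closedBall_mul c 0 (by norm_num) hr.le, h3]
          ring
      _ ≤ _ := by
          gcongr
          exact hs hxn (mem_Ioi.2 (by positivity)) (by linarith)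
  -- On the cube the norm lies between `t` and ‖c‖ + r < 3t. Comparing the masses of the centred
  -- cubes of radii `t` and 3t bounds s(t) by a multiple of s(3t).
  · set t := ‖c‖ - r with ht
    have ht0 : 0 < t := by linarith
    have hupper : ∫⁻ y in closedBall c r, ENNReal.ofReal (s ‖y‖) ≤
        ENNReal.ofReal (s t) * volume (closedBall c r) := by
      rw [← setLIntegral_const]
      refine setLIntegral_mono' measurableSet_closedBall fun y hy => ?_
      have hy' : t ≤ ‖y‖ := by
        rw [mem_closedBall, dist_eq_norm, norm_sub_rev] at hy
        linarith [norm_le_norm_add_norm_sub' c y]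
      exact ENNReal.ofReal_le_ofReal (hs ht0 (mem_Ioi.2 (ht0.trans_le hy')) hy')
    have hV0 := volume_closedBall_ne_zero (0 : Fin n → ℝ) ht0
    have hVT := volume_closedBall_ne_top (0 : Fin n → ℝ) t
    have hcomp : ENNReal.ofReal (s t) ≤ 3 ^ n * K * ENNReal.ofReal (s (3 * t)) := by
      rw [← ENNReal.mul_le_mul_iff_left hV0 hVT]
      calc ENNReal.ofReal (s t) * volume (closedBall (0 : Fin n → ℝ) t)
          ≤ ∫⁻ y in closedBall (0 : Fin n → ℝ) t, ENNReal.ofReal (s ‖y‖) := by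
            rw [← setLIntegral_const]
            refine lintegral_mono_ae ?_
            filter_upwards [ae_restrict_mem measurableSet_closedBall,
              ae_restrict_of_ae ae_ne_zero] with y hy hy0
            rw [mem_closedBall, dist_zero_right] at hy
            exact ENNReal.ofReal_le_ofReal (hs (norm_pos_iff.2 hy0) ht0 hy)
        _ ≤ ∫⁻ y in closedBall (0 : Fin n → ℝ) (3 * t), ENNReal.ofReal (s ‖y‖) :=
            lintegral_mono_set (closedBall_subset_closedBall (by linarith))
        _ ≤ K * ENNReal.ofReal (s (3 * t)) * volume (closedBall (0 : Fin n → ℝ) (3 * t)) :=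
            hK' _ (by positivity)
        _ = _ := by
            rw [volume_closedBall_mul (0 : Fin n → ℝ) 0 (by norm_num) ht0.le, h3]
            ring
    refine hupper.trans ?_
    gcongr
    refine hcomp.trans ?_
    gcongr
    exact hs hxn (mem_Ioi.2 (by positivity)) (by linarith)

/-- The weight on `ℝⁿ` whose dual weight is the radial function with profile `s`. -/
def radialWeight (n : ℕ) (p : ℝ) (s : ℝ → ℝ) : (Fin n → ℝ) → ℝ := fun x => s ‖x‖ ^ (1 - p)

theorem dualWeight_radialWeight {p : ℝ} (hp : 1 < p) {s : ℝ → ℝ} (hs0 : ∀ t, 0 ≤ t → 0 ≤ s t) :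
    dualWeight p (radialWeight n p s) = fun x => s ‖x‖ := by
  ext x
  rw [dualWeight, radialWeight, ← Real.rpow_mul (hs0 _ (norm_nonneg _)), one_sub_conjExponent hp]
  have : p - 1 ≠ 0 := by linarith
  rw [show (1 - p) * (-1 / (p - 1)) = 1 by field_simp; ring, Real.rpow_one]

theorem measurable_radialWeight {p : ℝ} {s : ℝ → ℝ} (hsm : Measurable s) :
    Measurable (radialWeight n p s) :=
  (hsm.comp measurable_norm).pow_const _

theorem isWeight_radialWeight [NeZero n] {p : ℝ} (hp : 1 < p) {s : ℝ → ℝ} (hsm : Measurable s)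
    (hpos : ∀ t, 0 < t → 0 < s t) (hs : AntitoneOn s (Ioi 0)) : IsWeight (radialWeight n p s) := by
  constructor
  · rw [locallyIntegrable_iff]
    intro k hk
    obtain ⟨R, hR, hkR⟩ := hk.isBounded.subset_closedBall_lt 0 0
    refine IntegrableOn.mono_set ?_ hkR
    refine Measure.integrableOn_of_bounded (M := s R ^ (1 - p)) measure_closedBall_lt_top.ne
      (measurable_radialWeight hsm).aestronglyMeasurable ?_
    filter_upwards [ae_restrict_mem measurableSet_closedBall,
      ae_restrict_of_ae ae_ne_zero] with y hy hy0
    rw [mem_closedBall, dist_zero_right] at hy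
    have hyn : 0 < ‖y‖ := norm_pos_iff.2 hy0
    rw [radialWeight, Real.norm_of_nonneg (Real.rpow_pos_of_pos (hpos _ hyn) _).le]
    exact Real.rpow_le_rpow_of_nonpos (hpos _ hR) (hs hyn hR hy) (by linarith)
  · filter_upwards [ae_ne_zero] with x hx
    exact Real.rpow_pos_of_pos (hpos _ (norm_pos_iff.2 hx)) _

/-- The A_1 condition for σ gives w(x)(avg σ)^(p-1) ≤ κ^(p-1) at every nonzero x of the cube,
because w = σ^(1-p); averaging in x gives the claim. -/
theorem apConst_radialWeight_le [NeZero n] {p : ℝ} (hp : 1 < p) {s : ℝ → ℝ}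
    (hs0 : ∀ t, 0 ≤ t → 0 ≤ s t) (hpos : ∀ t, 0 < t → 0 < s t) {κ : ℝ≥0∞}
    (hκ : ∀ (c : Fin n → ℝ) (r : ℝ), 0 < r → ∀ x ∈ closedBall c r, x ≠ 0 →
      ⨍⁻ y in closedBall c r, ENNReal.ofReal (s ‖y‖) ∂volume ≤ κ * ENNReal.ofReal (s ‖x‖)) :
    apConst p (radialWeight n p s) ≤ κ ^ (p - 1) := by
  have hp1 : 0 ≤ p - 1 := by linarith
  refine iSup₂_le fun Q hQ => ?_
  obtain ⟨c, r, hr, rfl⟩ := hQ.exists_eq_closedBall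
  rw [dualWeight_radialWeight hp hs0]
  set m := ⨍⁻ y in closedBall c r, ENNReal.ofReal (s ‖y‖) ∂volume
  rcases eq_or_ne κ ∞ with hκT | hκT
  · rw [hκT, ENNReal.top_rpow_of_pos (by linarith)]
    exact le_top
  have hpt : ∀ x ∈ closedBall c r, x ≠ 0 →
      ENNReal.ofReal (radialWeight n p s x) * m ^ (p - 1) ≤ κ ^ (p - 1) := by
    intro x hx hx0
    have hsx := hpos _ (norm_pos_iff.2 hx0)
    have hsx0 : ENNReal.ofReal (s ‖x‖) ≠ 0 := by simpa using hsx
    calc _ ≤ ENNReal.ofReal (radialWeight n p s x) * (κ * ENNReal.ofReal (s ‖x‖)) ^ (p - 1) := by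
          gcongr
          exact hκ c r hr x hx hx0
      _ = κ ^ (p - 1) *
          (ENNReal.ofReal (s ‖x‖) ^ (1 - p) * ENNReal.ofReal (s ‖x‖) ^ (p - 1)) := by
          rw [radialWeight, ← ENNReal.ofReal_rpow_of_pos hsx, ENNReal.mul_rpow_of_nonneg _ _ hp1]
          ring
      _ = κ ^ (p - 1) := by
          rw [← ENNReal.rpow_add _ _ hsx0 ENNReal.ofReal_ne_top]
          simp
  have hmT : m ^ (p - 1) ≠ ∞ := by
    obtain ⟨x, hx, hx0⟩ : ∃ x ∈ closedBall c r, x ≠ 0 := by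
      have : (ball c r \ {0}).Nonempty := by
        have := (isOpen_ball (x := c) (ε := r)).measure_pos volume ⟨c, mem_ball_self hr⟩
        by_contra! hemp
        have h2 : volume (ball c r) ≤ 0 := by
          calc _ ≤ volume ({0} : Set (Fin n → ℝ)) := measure_mono (sdiff_eq_empty.1 hemp)
            _ = 0 := measure_singleton 0
        exact absurd this (not_lt.2 h2)
      obtain ⟨x, hx, hx0⟩ := this
      exact ⟨x, ball_subset_closedBall hx, hx0⟩
    have := hκ c r hr x hx hx0
    exact ENNReal.rpow_ne_top_of_nonneg hp1
      (this.trans_lt (ENNReal.mul_lt_top hκT.lt_top ENNReal.ofReal_lt_top)).ne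
  rw [setLAverage_closedBall, ← ENNReal.mul_div_right_comm, ← lintegral_mul_const' _ _ hmT,
    ENNReal.div_le_iff (volume_closedBall_ne_zero c hr) (volume_closedBall_ne_top c r),
    ← setLIntegral_const]
  refine lintegral_mono_ae ?_
  filter_upwards [ae_restrict_mem measurableSet_closedBall, ae_restrict_of_ae ae_ne_zero]
    with x hx hx0 using hpt x hx hx0

/-- An A_1 weight satisfies Mσ ≤ κσ almost everywhere, and this is integrated over the cube. -/
theorem aInftyConst_radial_le [NeZero n] {s : ℝ → ℝ} (hs0 : ∀ t, 0 ≤ t → 0 ≤ s t) (hsm : Measurable s)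
    {κ : ℝ≥0∞}
    (hκ : ∀ (c : Fin n → ℝ) (r : ℝ), 0 < r → ∀ x ∈ closedBall c r, x ≠ 0 →
      ⨍⁻ y in closedBall c r, ENNReal.ofReal (s ‖y‖) ∂volume ≤ κ * ENNReal.ofReal (s ‖x‖)) :
    aInftyConst (fun x : Fin n → ℝ => s ‖x‖) ≤ κ := by
  refine iSup₂_le fun Q hQ => ENNReal.div_le_of_le_mul ?_
  have hm : Measurable fun x : Fin n → ℝ => ENNReal.ofReal (s ‖x‖) :=
    (hsm.comp measurable_norm).ennreal_ofReal
  obtain ⟨c, r, hr, rfl⟩ := hQ.exists_eq_closedBall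
  rw [weightMeasure, withDensity_apply _ measurableSet_closedBall, ← lintegral_const_mul _ hm]
  refine lintegral_mono_ae ?_
  filter_upwards [ae_restrict_of_ae ae_ne_zero] with x hx0
  rw [maximalFn_eq]
  refine (supAverage_mono (h := fun y => ENNReal.ofReal (s ‖y‖)) (fun y => ?_) x).trans
    (supAverage_le fun c r hr hx => hκ c r hr x hx hx0)
  by_cases hy : y ∈ closedBall c r
  · simp [hy, Real.enorm_of_nonneg (hs0 _ (norm_nonneg _))]
  · simp [hy]

/-! ### The two extremal profiles -/

/-- Polar coordinates for the supremum norm, whose unit ball has volume 2^n: the integral is n 2^n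
∫_0^R r^(nδ-1) dr. -/
theorem setLIntegral_closedBall_norm_rpow [NeZero n] {δ : ℝ} (hδ : 0 < δ) {R : ℝ}
    (hR : 0 < R) :
    ∫⁻ x in closedBall (0 : Fin n → ℝ) R, ENNReal.ofReal (‖x‖ ^ (-(n * (1 - δ)))) =
      ENNReal.ofReal (2 ^ n * R ^ (n * δ) / δ) := by
  have hn : 0 < n := Nat.pos_of_ne_zero (NeZero.ne n)
  have hn' : (0 : ℝ) < n := by exact_mod_cast hn
  have : Nontrivial (Fin n → ℝ) := by
    have : Nonempty (Fin n) := ⟨⟨0, hn⟩⟩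
    infer_instance
  set f : ℝ → ℝ := (Iic R).indicator fun y => y ^ (-(n * (1 - δ))) with hf
  have hind : ∀ x : Fin n → ℝ, (closedBall (0 : Fin n → ℝ) R).indicator
      (fun x => ‖x‖ ^ (-(n * (1 - δ)))) x = f ‖x‖ := fun x => by
    by_cases h : ‖x‖ ≤ R <;> simp [hf, h]
  have hdim : Module.finrank ℝ (Fin n → ℝ) = n := by simp
  have heq : EqOn (fun y : ℝ => y ^ (Module.finrank ℝ (Fin n → ℝ) - 1) • f y)
      ((Ioc 0 R).indicator fun y => y ^ (n * δ - 1)) (Ioi 0) := by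
    intro y hy
    have hy : 0 < y := hy
    by_cases h : y ≤ R
    · simp only [hdim, hf, smul_eq_mul]
      rw [indicator_of_mem (by exact h), indicator_of_mem (by exact ⟨hy, h⟩), ← Real.rpow_natCast,
        ← Real.rpow_add hy]
      congr 1
      rw [Nat.cast_sub hn]
      push_cast
      ring
    · simp [hf, h]
  have hexp : -1 < n * δ - 1 := by nlinarith
  have hint1 : IntegrableOn (fun y : ℝ => y ^ (n * δ - 1)) (Ioc 0 R) :=
    (intervalIntegral.intervalIntegrable_rpow' hexp).1
  have hint : Integrable (fun x : Fin n → ℝ => f ‖x‖) := by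
    rw [integrable_fun_norm_addHaar, integrableOn_congr_fun heq measurableSet_Ioi]
    exact ((integrable_indicator_iff measurableSet_Ioc).2 hint1).integrableOn
  have hval : ∫ x : Fin n → ℝ, f ‖x‖ = 2 ^ n * R ^ (n * δ) / δ := by
    rw [integral_fun_norm_addHaar, setIntegral_congr_fun measurableSet_Ioi heq, hdim,
      setIntegral_indicator measurableSet_Ioc, inter_eq_right.2 Ioc_subset_Ioi_self,
      ← intervalIntegral.integral_of_le hR.le, integral_rpow (Or.inl hexp)]
    have hv : volume.real (ball (0 : Fin n → ℝ) 1) = 2 ^ n := by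
      rw [measureReal_def, Real.volume_pi_ball _ one_pos]
      simp
    rw [hv, sub_add_cancel, Real.zero_rpow (by positivity)]
    simp only [nsmul_eq_mul, smul_eq_mul]
    field_simp
    ring
  rw [← hval, ofReal_integral_eq_lintegral_ofReal hint, ← lintegral_indicator
    measurableSet_closedBall]
  · refine lintegral_congr fun x => ?_
    rw [← hind]
    by_cases h : x ∈ closedBall (0 : Fin n → ℝ) R
    · rw [indicator_of_mem h, indicator_of_mem h]
    · rw [indicator_of_notMem h, indicator_of_notMem h, ENNReal.ofReal_zero]
  · refine ae_of_all _ fun x => ?_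
    show 0 ≤ f ‖x‖
    rw [← hind]
    exact indicator_nonneg (fun y _ => Real.rpow_nonneg (norm_nonneg y) _) x

theorem volume_closedBall_eq_ofReal (c : Fin n → ℝ) {r : ℝ} (hr : 0 ≤ r) :
    volume (closedBall c r) = ENNReal.ofReal ((2 * r) ^ n) := by
  rw [volume_closedBall_eq c hr, ENNReal.ofReal_pow (by positivity)]

theorem rpow_mul_pow_eq {R : ℝ} (hR : 0 < R) (δ : ℝ) :
    R ^ (-((n : ℝ) * (1 - δ))) * (2 * R) ^ n = 2 ^ n * R ^ (n * δ) := by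
  rw [mul_pow, ← Real.rpow_natCast R n, mul_left_comm, ← Real.rpow_add hR]
  congr 2
  ring

theorem setLAverage_closedBall_norm_rpow [NeZero n] {δ : ℝ} (hδ : 0 < δ) {R : ℝ} (hR : 0 < R) :
    ⨍⁻ x in closedBall (0 : Fin n → ℝ) R, ENNReal.ofReal (‖x‖ ^ (-(n * (1 - δ)))) ∂volume =
      ENNReal.ofReal (1 / δ) * ENNReal.ofReal (R ^ (-(n * (1 - δ)))) := by
  rw [setLAverage_closedBall, setLIntegral_closedBall_norm_rpow hδ hR,
    volume_closedBall_eq_ofReal _ hR.le, ← ENNReal.ofReal_div_of_pos (by positivity),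
    ← ENNReal.ofReal_mul (by positivity)]
  congr 1
  rw [← rpow_mul_pow_eq hR]
  field_simp

theorem antitoneOn_rpow_neg {a : ℝ} (ha : 0 ≤ a) :
    AntitoneOn (fun t : ℝ => t ^ (-a)) (Ioi 0) := fun _ ht _ _ htu =>
  Real.rpow_le_rpow_of_nonpos ht htu (by linarith)

/-- The profile equal to `δ⁻¹` up to `1` and to `t ^ (-n(1-δ))` beyond. -/
def truncatedProfile (n : ℕ) (δ t : ℝ) : ℝ := if t ≤ 1 then δ⁻¹ else t ^ (-(n * (1 - δ)))

theorem measurable_truncatedProfile (δ : ℝ) : Measurable (truncatedProfile n δ) :=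
  Measurable.ite measurableSet_Iic measurable_const (by fun_prop)

theorem truncatedProfile_pos {δ : ℝ} (hδ : 0 < δ) (t : ℝ) :
    0 < truncatedProfile n δ t := by
  unfold truncatedProfile
  split_ifs with h
  · positivity
  · exact Real.rpow_pos_of_pos (by linarith) _

theorem antitone_truncatedProfile {δ : ℝ} (hδ : 0 < δ) (hδ1 : δ < 1) :
    Antitone (truncatedProfile n δ) := by
  have hn : (0 : ℝ) ≤ n * (1 - δ) := mul_nonneg (Nat.cast_nonneg n) (by linarith)
  intro t u htu
  unfold truncatedProfile
  split_ifs with h1 h2 h2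
  · exact le_rfl
  · linarith
  · calc u ^ (-(n * (1 - δ))) ≤ 1 :=
          Real.rpow_le_one_of_one_le_of_nonpos (by linarith) (by linarith)
      _ ≤ δ⁻¹ := (one_le_inv₀ hδ).2 hδ1.le
  · exact antitoneOn_rpow_neg hn (mem_Ioi.2 (by linarith)) (mem_Ioi.2 (by linarith)) htu

/-- Beyond radius 1 the profile is at most δ⁻¹ on the unit cube plus the pure power. The two masses
are 2^n/δ and 2^n R^(nδ)/δ, and the first is at most the second. -/
theorem setLAverage_truncatedProfile_le [NeZero n] {δ : ℝ} (hδ : 0 < δ) (hδ1 : δ < 1) {R : ℝ}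
    (hR : 0 < R) :
    ⨍⁻ x in closedBall (0 : Fin n → ℝ) R, ENNReal.ofReal (truncatedProfile n δ ‖x‖) ∂volume ≤
      ENNReal.ofReal (2 / δ) * ENNReal.ofReal (truncatedProfile n δ R) := by
  rw [setLAverage_le_iff hR]
  rcases le_or_gt R 1 with h | h
  · calc ∫⁻ x in closedBall (0 : Fin n → ℝ) R, ENNReal.ofReal (truncatedProfile n δ ‖x‖)
        ≤ ∫⁻ x in closedBall (0 : Fin n → ℝ) R, ENNReal.ofReal (truncatedProfile n δ R) := by
          refine setLIntegral_mono' measurableSet_closedBall fun x hx => ?_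
          rw [mem_closedBall, dist_zero_right] at hx
          rw [truncatedProfile, truncatedProfile, if_pos h, if_pos (hx.trans h)]
      _ = 1 * ENNReal.ofReal (truncatedProfile n δ R) * volume (closedBall (0 : Fin n → ℝ) R) := by
          rw [setLIntegral_const, one_mul]
      _ ≤ _ := by
          gcongr
          rw [← ENNReal.ofReal_one]
          apply ENNReal.ofReal_le_ofReal
          rw [one_le_div hδ]
          linarith
  · have hR1 : 1 ≤ R ^ (n * δ) := Real.one_le_rpow h.le (by positivity)
    calc ∫⁻ x in closedBall (0 : Fin n → ℝ) R, ENNReal.ofReal (truncatedProfile n δ ‖x‖)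
        ≤ ∫⁻ x in closedBall (0 : Fin n → ℝ) R,
            ((closedBall (0 : Fin n → ℝ) 1).indicator (fun _ => ENNReal.ofReal δ⁻¹) x +
              ENNReal.ofReal (‖x‖ ^ (-(n * (1 - δ))))) := by
          refine lintegral_mono fun x => ?_
          by_cases hx : ‖x‖ ≤ 1
          · simp [truncatedProfile, hx]
          · simp [truncatedProfile, hx]
      _ = ENNReal.ofReal δ⁻¹ * ENNReal.ofReal (2 ^ n) +
            ENNReal.ofReal (2 ^ n * R ^ (n * δ) / δ) := by
          rw [lintegral_add_left (measurable_const.indicator measurableSet_closedBall),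
            setLIntegral_closedBall_norm_rpow hδ hR, lintegral_indicator measurableSet_closedBall,
            Measure.restrict_restrict measurableSet_closedBall,
            inter_eq_left.2 (closedBall_subset_closedBall h.le), setLIntegral_const,
            volume_closedBall_eq_ofReal _ zero_le_one, mul_one]
      _ ≤ ENNReal.ofReal (2 / δ * (2 ^ n * R ^ (n * δ))) := by
          rw [← ENNReal.ofReal_mul (by positivity), ← ENNReal.ofReal_add (by positivity)
            (by positivity)]
          apply ENNReal.ofReal_le_ofReal
          have : δ⁻¹ * 2 ^ n ≤ δ⁻¹ * 2 ^ n * R ^ (n * δ) := le_mul_of_one_le_right (by positivity) hR1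
          calc _ ≤ δ⁻¹ * 2 ^ n * R ^ (n * δ) + 2 ^ n * R ^ (n * δ) / δ := by gcongr
            _ = _ := by field_simp; ring
      _ = _ := by
          rw [volume_closedBall_eq_ofReal _ hR.le, truncatedProfile, if_neg (not_le.2 h), mul_assoc,
            ← ENNReal.ofReal_mul (by positivity), rpow_mul_pow_eq hR,
            ← ENNReal.ofReal_mul (by positivity)]

/-- Constants of the weights with the power profile. -/
theorem power_weight_constants [NeZero n] {p : ℝ} (hp : 1 < p) {δ : ℝ} (hδ : 0 < δ) (hδ1 : δ < 1) :
    radialWeight n p (fun t => t ^ (-(n * (1 - δ)))) ∈ apClass n p ∧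
    apConst p (radialWeight n p (fun t => t ^ (-(n * (1 - δ))))) ≤
      ENNReal.ofReal (2 * 3 ^ n / δ) ^ (p - 1) ∧
    aInftyConst (dualWeight p (radialWeight n p (fun t => t ^ (-(n * (1 - δ)))))) ≤
      ENNReal.ofReal (2 * 3 ^ n / δ) := by
  have hn : (0 : ℝ) ≤ n * (1 - δ) := mul_nonneg (Nat.cast_nonneg n) (by linarith)
  have hanti := antitoneOn_rpow_neg hn
  have hs0 : ∀ t : ℝ, 0 ≤ t → 0 ≤ t ^ (-(n * (1 - δ))) := fun t ht => Real.rpow_nonneg ht _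
  have hpos : ∀ t : ℝ, 0 < t → 0 < t ^ (-(n * (1 - δ))) := fun t ht => Real.rpow_pos_of_pos ht _
  have hsm : Measurable fun t : ℝ => t ^ (-(n * (1 - δ))) := by fun_prop
  have hκ := fun (c : Fin n → ℝ) (r : ℝ) (hr : 0 < r) (x : Fin n → ℝ) (hx : x ∈ closedBall c r)
    (hx0 : x ≠ 0) => setLAverage_radial_le hanti (K := ENNReal.ofReal (1 / δ))
      (fun R hR => (setLAverage_closedBall_norm_rpow hδ hR).le) c hr hx hx0
  have hle : (3 : ℝ≥0∞) ^ n * ENNReal.ofReal (1 / δ) ≤ ENNReal.ofReal (2 * 3 ^ n / δ) := by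
    have : (3 : ℝ≥0∞) ^ n = ENNReal.ofReal (3 ^ n) := by
      rw [ENNReal.ofReal_pow (by norm_num)]; simp
    rw [this, ← ENNReal.ofReal_mul (by positivity)]
    apply ENNReal.ofReal_le_ofReal
    rw [mul_one_div]
    gcongr
    linarith [pow_pos (three_pos (α := ℝ)) n]
  have hp1 : 0 ≤ p - 1 := by linarith
  have hA := (apConst_radialWeight_le hp hs0 hpos hκ).trans (ENNReal.rpow_le_rpow hle hp1)
  refine ⟨⟨isWeight_radialWeight hp hsm hpos hanti, hA.trans_lt ?_⟩, hA, ?_⟩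
  · exact (ENNReal.rpow_ne_top_of_nonneg hp1 ENNReal.ofReal_ne_top).lt_top
  · rw [dualWeight_radialWeight hp hs0]
    exact (aInftyConst_radial_le hs0 hsm hκ).trans hle

/-- Constants of the weights with the truncated profile. -/
theorem truncated_weight_constants [NeZero n] {p : ℝ} (hp : 1 < p) {δ : ℝ} (hδ : 0 < δ)
    (hδ1 : δ < 1) :
    radialWeight n p (truncatedProfile n δ) ∈ apClass n p ∧
    apConst p (radialWeight n p (truncatedProfile n δ)) ≤
      ENNReal.ofReal (2 * 3 ^ n / δ) ^ (p - 1) ∧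
    aInftyConst (dualWeight p (radialWeight n p (truncatedProfile n δ))) ≤
      ENNReal.ofReal (2 * 3 ^ n / δ) := by
  have hanti := (antitone_truncatedProfile (n := n) hδ hδ1).antitoneOn (Ioi 0)
  have hpos : ∀ t : ℝ, 0 < t → 0 < truncatedProfile n δ t := fun t _ => truncatedProfile_pos hδ t
  have hs0 : ∀ t : ℝ, 0 ≤ t → 0 ≤ truncatedProfile n δ t := fun t _ => (truncatedProfile_pos hδ t).le
  have hsm := measurable_truncatedProfile (n := n) δ
  have hκ := fun (c : Fin n → ℝ) (r : ℝ) (hr : 0 < r) (x : Fin n → ℝ) (hx : x ∈ closedBall c r)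
    (hx0 : x ≠ 0) => setLAverage_radial_le hanti (K := ENNReal.ofReal (2 / δ))
      (fun R hR => setLAverage_truncatedProfile_le hδ hδ1 hR) c hr hx hx0
  have hle : (3 : ℝ≥0∞) ^ n * ENNReal.ofReal (2 / δ) ≤ ENNReal.ofReal (2 * 3 ^ n / δ) := by
    have : (3 : ℝ≥0∞) ^ n = ENNReal.ofReal (3 ^ n) := by
      rw [ENNReal.ofReal_pow (by norm_num)]; simp
    rw [this, ← ENNReal.ofReal_mul (by positivity)]
    apply ENNReal.ofReal_le_ofReal
    apply le_of_eq
    ring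
  have hp1 : 0 ≤ p - 1 := by linarith
  have hA := (apConst_radialWeight_le hp hs0 hpos hκ).trans (ENNReal.rpow_le_rpow hle hp1)
  refine ⟨⟨isWeight_radialWeight hp hsm hpos hanti, hA.trans_lt ?_⟩, hA, ?_⟩
  · exact (ENNReal.rpow_ne_top_of_nonneg hp1 ENNReal.ofReal_ne_top).lt_top
  · rw [dualWeight_radialWeight hp hs0]
    exact (aInftyConst_radial_le hs0 hsm hκ).trans hle

/-! ### Lower bounds for the norm of the maximal operator -/

theorem weightMeasure_absolutelyContinuous (w : (Fin n → ℝ) → ℝ) : weightMeasure w ≪ volume :=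
  withDensity_absolutelyContinuous _ _

theorem IsWeight.weightMeasure_pos {w : (Fin n → ℝ) → ℝ} (hw : IsWeight w) {E : Set (Fin n → ℝ)}
    (hE : volume E ≠ 0) : weightMeasure w E ≠ 0 := by
  obtain ⟨W, hWm, h0, -, hW, -⟩ := hw.exists_density
  rw [weightMeasure_eq hW]
  exact fun h => hE (withDensity_absolutelyContinuous' hWm.aemeasurable (ae_of_all _ h0) h)

theorem lorentzNorm_mono_ae {p : ℝ} (hp : 0 < p) {q : ℝ≥0∞} {w : (Fin n → ℝ) → ℝ}
    {g h : (Fin n → ℝ) → ℝ≥0∞} (hgh : g ≤ᵐ[volume] h) :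
    lorentzNorm p q w g ≤ lorentzNorm p q w h := by
  rw [lorentzNorm_eq_distNorm, lorentzNorm_eq_distNorm]
  refine distNorm_mono hp fun s _ => measure_mono_ae ?_
  filter_upwards [(weightMeasure_absolutelyContinuous w).ae_le hgh] with x hx hs
  exact lt_of_lt_of_le hs hx

theorem lorentzNorm_const_mul {p : ℝ} {q : ℝ≥0∞} (hq : q ≠ 0) (w : (Fin n → ℝ) → ℝ)
    (g : (Fin n → ℝ) → ℝ≥0∞) {a : ℝ} (ha : 0 < a) :
    lorentzNorm p q w (fun x => ENNReal.ofReal a * g x) =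
      ENNReal.ofReal a * lorentzNorm p q w g := by
  rw [lorentzNorm_eq_distNorm, lorentzNorm_eq_distNorm, ← distNorm_comp_mul_left hq _ ha]
  have ha0 : ENNReal.ofReal a ≠ 0 := by simpa using ha
  simp only [ENNReal.ofReal_mul ha.le,
    ENNReal.mul_lt_mul_iff_right ha0 ENNReal.ofReal_ne_top]

theorem le_maximalNorm {p : ℝ} {q : ℝ≥0∞} {w : (Fin n → ℝ) → ℝ} {f : (Fin n → ℝ) → ℝ}
    (hf : Measurable f) (hf0 : ¬ f =ᵐ[volume] 0)
    (h0 : lorentzNorm p q w (fun x => ‖f x‖ₑ) ≠ 0) (hT : lorentzNorm p q w (fun x => ‖f x‖ₑ) ≠ ∞)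
    {Z : ℝ≥0∞} (hZ : Z * lorentzNorm p q w (fun x => ‖f x‖ₑ) ≤
      lorentzNorm p q w (supAverage fun x => ‖f x‖ₑ)) : Z ≤ maximalNorm p q w := by
  refine le_trans ?_ (le_iSup_of_le f (le_iSup₂_of_le hf.aestronglyMeasurable hf0
    (le_iSup_of_le hT.lt_top le_rfl)))
  rw [ENNReal.le_div_iff_mul_le (Or.inl h0) (Or.inl hT)]
  exact hZ

/-! ### Finiteness and positivity of Lorentz functionals -/

theorem setLIntegral_Ioc_rpow {b e : ℝ} (hb : 0 < b) (he : 0 < e) :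
    ∫⁻ t in Ioc 0 b, ENNReal.ofReal (t ^ (e - 1)) = ENNReal.ofReal (b ^ e / e) := by
  have hexp : -1 < e - 1 := by linarith
  rw [← ofReal_integral_eq_lintegral_ofReal (intervalIntegral.intervalIntegrable_rpow' hexp).1,
    ← intervalIntegral.integral_of_le hb.le, integral_rpow (Or.inl hexp), sub_add_cancel,
    Real.zero_rpow he.ne', sub_zero]
  filter_upwards [ae_restrict_mem measurableSet_Ioc] with t ht
  exact Real.rpow_nonneg ht.1.le _

theorem ofReal_rpow_mul_div {t : ℝ} (ht : 0 < t) (q : ℝ) (y : ℝ≥0∞) :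
    ENNReal.ofReal t ^ q * y / ENNReal.ofReal t = y * ENNReal.ofReal (t ^ (q - 1)) := by
  rw [ENNReal.ofReal_rpow_of_pos ht, div_eq_mul_inv, ← ENNReal.ofReal_inv_of_pos ht,
    mul_right_comm, ← ENNReal.ofReal_mul (by positivity), Real.rpow_sub_one ht.ne', mul_comm,
    div_eq_mul_inv]

/-- Boundedness of `F` gives convergence near 0; decay faster than t^(-p) gives it at infinity, for
every `q`. -/
theorem distNorm_ne_top {p : ℝ} (hp : 0 < p) {q : ℝ≥0∞} (hq : q ≠ 0) {F : ℝ → ℝ≥0∞} {M : ℝ≥0∞}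
    (hM : M ≠ ∞) {e : ℝ} (he : p < e) (h1 : ∀ t, 0 < t → F t ≤ M)
    (h2 : ∀ t, 1 ≤ t → F t ≤ M * ENNReal.ofReal (t ^ (-e))) : distNorm p q F ≠ ∞ := by
  have hpi : 0 ≤ 1 / p := by positivity
  unfold distNorm
  split_ifs with hqt
  · refine ne_top_of_le_ne_top (ENNReal.rpow_ne_top_of_nonneg hpi hM) (iSup₂_le fun t ht => ?_)
    rcases le_total t 1 with h | h
    · calc ENNReal.ofReal t * F t ^ (1 / p) ≤ 1 * M ^ (1 / p) := by
            gcongr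
            · exact ENNReal.ofReal_le_one.2 h
            · exact h1 t ht
        _ = _ := one_mul _
    · calc ENNReal.ofReal t * F t ^ (1 / p)
          ≤ ENNReal.ofReal t * (M * ENNReal.ofReal (t ^ (-e))) ^ (1 / p) := by
            gcongr
            exact h2 t h
        _ = ENNReal.ofReal (t ^ (1 - e / p)) * M ^ (1 / p) := by
            rw [ENNReal.mul_rpow_of_nonneg _ _ hpi, ENNReal.ofReal_rpow_of_pos (by positivity),
              ← Real.rpow_mul ht.le, mul_left_comm, ← ENNReal.ofReal_mul ht.le,
              ← Real.rpow_one_add' ht.le, mul_comm]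
            · congr 3
              ring
            · have : e / p > 1 := (one_lt_div hp).2 he
              have : -e * (1 / p) = -(e / p) := by ring
              linarith
        _ ≤ 1 * M ^ (1 / p) := by
            gcongr
            rw [ENNReal.ofReal_le_one]
            refine Real.rpow_le_one_of_one_le_of_nonpos h ?_
            have : e / p > 1 := (one_lt_div hp).2 he
            linarith
        _ = _ := one_mul _
  · have hq0 : 0 < q.toReal := ENNReal.toReal_pos hq hqt
    refine ENNReal.rpow_ne_top_of_nonneg (by positivity)
      (ENNReal.mul_ne_top ENNReal.ofReal_ne_top ?_)
    set q' := q.toReal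
    have hθ : 0 ≤ q' / p := by positivity
    have hMθ : M ^ (q' / p) ≠ ∞ := ENNReal.rpow_ne_top_of_nonneg hθ hM
    rw [powIntegral, ← Ioc_union_Ioi_eq_Ioi (zero_le_one : (0:ℝ) ≤ 1)]
    refine ne_top_of_le_ne_top ?_ (lintegral_union_le _ _ _)
    refine ENNReal.add_ne_top.2 ⟨?_, ?_⟩
    · refine ne_top_of_le_ne_top (b := M ^ (q' / p) * ENNReal.ofReal (1 ^ q' / q'))
        (ENNReal.mul_ne_top hMθ ENNReal.ofReal_ne_top) ?_
      rw [← setLIntegral_Ioc_rpow one_pos hq0, ← lintegral_const_mul' _ _ hMθ]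
      refine setLIntegral_mono' measurableSet_Ioc fun t ht => ?_
      rw [ofReal_rpow_mul_div ht.1]
      gcongr
      exact h1 t ht.1
    · have hexp : -e * (q' / p) + (q' - 1) < -1 := by
        have : q' < e * (q' / p) := by
          rw [mul_div_assoc', lt_div_iff₀ hp]
          nlinarith
        linarith
      have hint := (integrableOn_Ioi_rpow_of_lt hexp one_pos).lintegral_lt_top
      refine ne_top_of_le_ne_top (ENNReal.mul_ne_top hMθ hint.ne) ?_
      rw [← lintegral_const_mul' _ _ hMθ]
      refine setLIntegral_mono' measurableSet_Ioi fun t ht => ?_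
      have ht1 : 1 < t := ht
      have ht0 : 0 < t := by linarith
      rw [ofReal_rpow_mul_div ht0, Real.rpow_add ht0, ENNReal.ofReal_mul (by positivity),
        ← mul_assoc]
      gcongr
      refine (ENNReal.rpow_le_rpow (h2 t ht1.le) hθ).trans (le_of_eq ?_)
      rw [ENNReal.mul_rpow_of_nonneg _ _ hθ, ENNReal.ofReal_rpow_of_pos (by positivity),
        ← Real.rpow_mul ht0.le]

theorem distNorm_ne_zero {p : ℝ} (hp : 0 < p) {q : ℝ≥0∞} (hq : q ≠ 0) {F : ℝ → ℝ≥0∞} {m : ℝ≥0∞}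
    (hm : m ≠ 0) (hF : ∀ t, 0 < t → t < 1 → m ≤ F t) : distNorm p q F ≠ 0 := by
  unfold distNorm
  split_ifs with hqt
  · have h := le_iSup₂ (f := fun (s : ℝ) (_ : 0 < s) => ENNReal.ofReal s * F s ^ (1 / p))
      (1 / 2) (by norm_num)
    refine (lt_of_lt_of_le ?_ h).ne'
    have : F (1 / 2) ≠ 0 := (lt_of_lt_of_le (pos_iff_ne_zero.2 hm)
      (hF (1 / 2) (by norm_num) (by norm_num))).ne'
    have h2 : F (1 / 2) ^ (1 / p) ≠ 0 := by
      intro h0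
      rcases ENNReal.rpow_eq_zero_iff.1 h0 with ⟨h, -⟩ | ⟨-, h⟩
      · exact this h
      · exact absurd h (not_lt.2 (by positivity))
    exact ENNReal.mul_pos (by simp) h2
  · have hq0 : 0 < q.toReal := ENNReal.toReal_pos hq hqt
    set q' := q.toReal
    have hθ : 0 ≤ q' / p := by positivity
    -- `m` may be infinite; the minimum with 1 keeps the constant finite when it is moved into the
    -- integral.
    have hle : (min m 1) ^ (q' / p) * ENNReal.ofReal ((1 / 2) ^ q' / q') ≤
        powIntegral q' fun s => F s ^ (q' / p) := by
      rw [← setLIntegral_Ioc_rpow one_half_pos hq0, ← lintegral_const_mul' _ _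
        (ENNReal.rpow_ne_top_of_nonneg hθ ((min_le_right _ _).trans_lt ENNReal.one_lt_top).ne)]
      refine (setLIntegral_mono' measurableSet_Ioc fun t ht => ?_).trans
        (lintegral_mono_set (show Ioc (0 : ℝ) (1 / 2) ⊆ Ioi 0 from Ioc_subset_Ioi_self))
      rw [ofReal_rpow_mul_div ht.1]
      refine mul_le_mul_left (ENNReal.rpow_le_rpow ?_ hθ) _
      exact (min_le_left _ _).trans (hF t ht.1 (lt_of_le_of_lt ht.2 (by norm_num)))
    have hpos : 0 < (min m 1) ^ (q' / p) * ENNReal.ofReal ((1 / 2) ^ q' / q') := by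
      refine ENNReal.mul_pos ?_ ?_
      · refine (ENNReal.rpow_pos (lt_min (pos_iff_ne_zero.2 hm) one_pos)
          ((min_le_right _ _).trans_lt ENNReal.one_lt_top).ne).ne'
      · have : 0 < (1 / 2 : ℝ) ^ q' / q' := by positivity
        simpa using this
    have h2 := hpos.trans_le hle
    have h3 : ENNReal.ofReal p * powIntegral q' (fun s => F s ^ (q' / p)) ≠ 0 :=
      mul_ne_zero (by simpa using hp) h2.ne'
    have : 0 ≤ 1 / q' := by positivity
    simp [ENNReal.rpow_eq_zero_iff, h3, hq0.le]

theorem volume_closedBall_sdiff_singleton [NeZero n] (c : Fin n → ℝ) {r : ℝ} (hr : 0 < r) :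
    volume (closedBall c r \ {0}) ≠ 0 := by
  rw [measure_sdiff_null (measure_singleton _)]
  exact volume_closedBall_ne_zero c hr

theorem weightMeasure_le_of_le {w : (Fin n → ℝ) → ℝ} {E : Set (Fin n → ℝ)} (hE : MeasurableSet E)
    {a : ℝ} (h : ∀ x ∈ E, w x ≤ a) : weightMeasure w E ≤ ENNReal.ofReal a * volume E := by
  rw [weightMeasure, withDensity_apply _ hE, ← setLIntegral_const]
  exact setLIntegral_mono' hE fun x hx => ENNReal.ofReal_le_ofReal (h x hx)

theorem le_weightMeasure_of_le {w : (Fin n → ℝ) → ℝ} {E : Set (Fin n → ℝ)} (hE : MeasurableSet E)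
    {a : ℝ} (h : ∀ x ∈ E, a ≤ w x) : ENNReal.ofReal a * volume E ≤ weightMeasure w E := by
  rw [weightMeasure, withDensity_apply _ hE, ← setLIntegral_const]
  exact setLIntegral_mono' hE fun x hx => ENNReal.ofReal_le_ofReal (h x hx)

theorem not_ae_zero_of_closedBall [NeZero n] {f : (Fin n → ℝ) → ℝ} {r : ℝ} (hr : 0 < r)
    (h : ∀ x ∈ closedBall (0 : Fin n → ℝ) r, x ≠ 0 → f x ≠ 0) : ¬ f =ᵐ[volume] 0 := by
  intro hf
  refine volume_closedBall_sdiff_singleton (0 : Fin n → ℝ) hr (measure_mono_null ?_ (ae_iff.1 hf))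
  exact fun x hx => h x hx.1 hx.2

/-! ### Lower bound for the power weights -/

theorem le_maximalNorm_power_weight [NeZero n] {p : ℝ} (hp : 1 < p) {q : ℝ≥0∞} (hq : q ≠ 0)
    {δ : ℝ} (hδ : 0 < δ) (hδ1 : δ < 1) :
    ENNReal.ofReal (1 / δ) ≤
      maximalNorm p q (radialWeight n p (fun t => t ^ (-(n * (1 - δ))))) := by
  have hn : (0 : ℝ) < n := by exact_mod_cast Nat.pos_of_ne_zero (NeZero.ne n)
  have hp0 : 0 < p := by linarith
  have hδ' : 0 < 1 - δ := by linarith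
  set a : ℝ := n * (1 - δ) with ha
  have ha0 : 0 < a := by positivity
  set w := radialWeight n p (fun t => t ^ (-a)) with hw
  have hwt : IsWeight w := (power_weight_constants hp hδ hδ1).1.1
  -- The test function is σ on the unit cube. Averaging it over the centred cube through x gives
  -- exactly f(x)/δ.
  set f : (Fin n → ℝ) → ℝ := (closedBall 0 1).indicator fun x => ‖x‖ ^ (-a) with hf
  have hfm : Measurable f :=
    (Measurable.pow_const measurable_norm _).indicator measurableSet_closedBall
  have hφ : ∀ x, ‖f x‖ₑ = (closedBall 0 1).indicator (fun x => ENNReal.ofReal (‖x‖ ^ (-a))) x := by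
    intro x
    by_cases hx : x ∈ closedBall (0 : Fin n → ℝ) 1
    · rw [hf, indicator_of_mem hx, indicator_of_mem hx,
        Real.enorm_of_nonneg (Real.rpow_nonneg (norm_nonneg x) _)]
    · rw [hf, indicator_of_notMem hx, indicator_of_notMem hx, enorm_zero]
  have hone : ∀ x : Fin n → ℝ, x ≠ 0 → ‖x‖ ≤ 1 → 1 ≤ ‖x‖ ^ (-a) := fun x hx0 hx =>
    Real.one_le_rpow_of_pos_of_le_one_of_nonpos (norm_pos_iff.2 hx0) hx (by linarith)
  have hlt : ∀ (t : ℝ) x, 0 < t → ENNReal.ofReal t < ‖f x‖ₑ → ‖x‖ ≤ 1 ∧ t < ‖x‖ ^ (-a) := by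
    intro t x ht h
    rw [hφ] at h
    by_cases hx : x ∈ closedBall (0 : Fin n → ℝ) 1
    · rw [indicator_of_mem hx] at h
      refine ⟨by simpa using hx, ?_⟩
      by_contra! hcon
      exact absurd h (not_lt.2 (ENNReal.ofReal_le_ofReal hcon))
    · simp [hx] at h
  have hms : ∀ t : ℝ, MeasurableSet {x | ENNReal.ofReal t < ‖f x‖ₑ} := fun t =>
    measurableSet_lt measurable_const hfm.enorm
  have hxne : ∀ x : Fin n → ℝ, ∀ t : ℝ, 0 < t → t < ‖x‖ ^ (-a) → x ≠ 0 := by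
    rintro x t ht h rfl
    rw [norm_zero, Real.zero_rpow (by linarith)] at h
    linarith
  have hnT : lorentzNorm p q w (fun x => ‖f x‖ₑ) ≠ ∞ := by
    rw [lorentzNorm_eq_distNorm]
    -- For t ≥ 1 the set {f > t} lies in the cube of radius t^(-1/a), of volume 2^n t^(-1/(1-δ)),
    -- and w < t^(1-p) there; the exponents add up to more than `p`.
    refine distNorm_ne_top (M := ENNReal.ofReal (2 ^ n)) (e := (p - 1) + 1 / (1 - δ)) hp0 hq
      ENNReal.ofReal_ne_top ?_ (fun t ht => ?_) fun t ht => ?_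
    · have : 1 < 1 / (1 - δ) := by
        rw [one_lt_div hδ']
        linarith
      linarith
    · calc _ ≤ ENNReal.ofReal 1 * volume {x | ENNReal.ofReal t < ‖f x‖ₑ} := by
            refine weightMeasure_le_of_le (hms t) fun x hx => ?_
            obtain ⟨h1, h2⟩ := hlt t x ht hx
            exact Real.rpow_le_one_of_one_le_of_nonpos (hone x (hxne x t ht h2) h1) (by linarith)
        _ ≤ ENNReal.ofReal 1 * volume (closedBall (0 : Fin n → ℝ) 1) := by
            gcongr
            intro x hx
            simpa using (hlt t x ht hx).1
        _ = _ := by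
            rw [volume_closedBall_eq_ofReal _ zero_le_one]
            simp
    · have ht0 : 0 < t := by linarith
      calc _ ≤ ENNReal.ofReal (t ^ (1 - p)) * volume {x | ENNReal.ofReal t < ‖f x‖ₑ} := by
            refine weightMeasure_le_of_le (hms t) fun x hx => ?_
            exact Real.rpow_le_rpow_of_nonpos ht0 (hlt t x ht0 hx).2.le (by linarith)
        _ ≤ ENNReal.ofReal (t ^ (1 - p)) * volume (closedBall (0 : Fin n → ℝ) (t ^ (-(1 / a)))) := by
            gcongr
            intro x hx
            obtain ⟨-, h2⟩ := hlt t x ht0 hx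
            have hx0 : 0 < ‖x‖ := norm_pos_iff.2 (hxne x t ht0 h2)
            rw [mem_closedBall, dist_zero_right]
            have := Real.rpow_le_rpow_of_nonpos ht0 h2.le (by
              have : 0 < 1 / a := by positivity
              linarith : -(1 / a) ≤ 0)
            rwa [← Real.rpow_mul hx0.le, show -a * -(1 / a) = 1 by field_simp,
              Real.rpow_one] at this
        _ = _ := by
            rw [volume_closedBall_eq_ofReal _ (Real.rpow_nonneg ht0.le _), mul_pow,
              ← Real.rpow_natCast (t ^ (-(1 / a))), ← Real.rpow_mul ht0.le,
              ← ENNReal.ofReal_mul (by positivity), ← ENNReal.ofReal_mul (by positivity),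
              mul_left_comm, ← Real.rpow_add ht0]
            congr 3
            rw [ha]
            field_simp
            ring
  have hn0 : lorentzNorm p q w (fun x => ‖f x‖ₑ) ≠ 0 := by
    rw [lorentzNorm_eq_distNorm]
    refine distNorm_ne_zero hp0 hq
      (hwt.weightMeasure_pos (volume_closedBall_sdiff_singleton (0 : Fin n → ℝ) one_pos))
      fun t ht0 ht1 => measure_mono ?_
    rintro x ⟨hx, hx0⟩
    show ENNReal.ofReal t < ‖f x‖ₑ
    rw [hφ, indicator_of_mem hx]
    rw [mem_closedBall, dist_zero_right] at hx
    have h1 := hone x hx0 hx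
    exact (ENNReal.ofReal_lt_ofReal_iff (by linarith)).2 (by linarith)
  refine le_maximalNorm hfm (not_ae_zero_of_closedBall one_pos fun x hx hx0 => ?_) hn0 hnT ?_
  · rw [hf, indicator_of_mem hx]
    exact (Real.rpow_pos_of_pos (norm_pos_iff.2 hx0) _).ne'
  rw [← lorentzNorm_const_mul hq _ _ (by positivity)]
  refine lorentzNorm_mono_ae hp0 ?_
  filter_upwards [ae_ne_zero] with x hx0
  have hxn := norm_pos_iff.2 hx0
  by_cases hx : x ∈ closedBall (0 : Fin n → ℝ) 1
  · refine le_trans (le_of_eq ?_)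
      (setLAverage_le_supAverage _ hxn (show x ∈ closedBall 0 ‖x‖ by simp))
    rw [hφ, indicator_of_mem hx, ← setLAverage_closedBall_norm_rpow hδ hxn,
      setLAverage_closedBall, setLAverage_closedBall]
    congr 1
    refine setLIntegral_congr_fun measurableSet_closedBall fun y hy => ?_
    rw [mem_closedBall, dist_zero_right] at hx hy
    rw [hφ, indicator_of_mem]
    simpa using hy.trans hx
  · rw [hφ, indicator_of_notMem hx, mul_zero]
    exact zero_le

/-! ### Lower bound for the truncated weights -/

theorem radialWeight_truncatedProfile_of_le {p δ : ℝ} (hδ : 0 < δ) {x : Fin n → ℝ}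
    (hx : ‖x‖ ≤ 1) : radialWeight n p (truncatedProfile n δ) x = δ ^ (p - 1) := by
  rw [radialWeight, truncatedProfile, if_pos hx, Real.inv_rpow hδ.le, ← Real.rpow_neg hδ.le,
    neg_sub]

theorem radialWeight_truncatedProfile_of_gt {p δ : ℝ} {x : Fin n → ℝ}
    (hx : 1 < ‖x‖) : radialWeight n p (truncatedProfile n δ) x =
      ‖x‖ ^ (n * (1 - δ) * (p - 1)) := by
  rw [radialWeight, truncatedProfile, if_neg (not_le.2 hx), ← Real.rpow_mul (norm_nonneg x)]
  congr 1
  ring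

/-- The shell has volume at least (2^n - 1)T^n ≥ T^n, and the weight on it is at least
(T/2)^(n(1-δ)(p-1)). The result is written in T^n because T^n = 1/t in the application. -/
theorem le_weightMeasure_shell [NeZero n] {p : ℝ} (hp : 1 < p) {δ : ℝ} (hδ : 0 < δ)
    (hδ1 : δ < 1) {T : ℝ} (hT : 2 ≤ T) :
    ENNReal.ofReal ((2 ^ (n * (p - 1)))⁻¹ * (T ^ n) ^ (p - δ * (p - 1))) ≤
      weightMeasure (radialWeight n p (truncatedProfile n δ))
        (ball 0 T \ closedBall 0 (T / 2)) := by
  have hT0 : 0 < T := by linarith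
  have hδ' : 0 < 1 - δ := by linarith
  have hp1 : 0 < p - 1 := by linarith
  set e : ℝ := n * (1 - δ) * (p - 1) with he
  have he0 : 0 ≤ e := by positivity
  have hvol : ENNReal.ofReal (T ^ n) ≤
      volume (ball (0 : Fin n → ℝ) T \ closedBall 0 (T / 2)) := by
    have hsub : closedBall (0 : Fin n → ℝ) (T / 2) ⊆ ball 0 T :=
      closedBall_subset_ball (by linarith)
    rw [measure_sdiff hsub measurableSet_closedBall.nullMeasurableSet
      (volume_closedBall_ne_top _ _), volume_closedBall_eq_ofReal _ (by positivity),
      Real.volume_pi_ball _ hT0, Fintype.card_fin, ← ENNReal.ofReal_sub _ (by positivity)]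
    apply ENNReal.ofReal_le_ofReal
    have h2 : (2 : ℝ) ≤ 2 ^ n := by
      calc (2 : ℝ) = 2 ^ 1 := by norm_num
        _ ≤ 2 ^ n := pow_le_pow_right₀ (by norm_num) (Nat.pos_of_ne_zero (NeZero.ne n))
    have : (2 * (T / 2)) ^ n = T ^ n := by congr 1; ring
    rw [this, mul_pow]
    nlinarith [pow_pos hT0 n]
  have hm : MeasurableSet (ball (0 : Fin n → ℝ) T \ closedBall 0 (T / 2)) :=
    measurableSet_ball.diff measurableSet_closedBall
  refine le_trans ?_ ((mul_le_mul_right hvol _).trans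
    (le_weightMeasure_of_le (a := (T / 2) ^ e) hm fun x hx => ?_))
  · rw [← ENNReal.ofReal_mul (by positivity)]
    apply ENNReal.ofReal_le_ofReal
    have h1 : (T ^ n) ^ (p - δ * (p - 1)) = T ^ e * T ^ n := by
      rw [← Real.rpow_natCast T n, ← Real.rpow_mul hT0.le, ← Real.rpow_add hT0, he]
      congr 1
      ring
    have h2 : (T / 2) ^ e = (2 ^ e)⁻¹ * T ^ e := by
      rw [Real.div_rpow hT0.le two_pos.le]
      ring
    rw [h1, h2, mul_assoc]
    gcongr
    · norm_num
    · rw [he]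
      have : (n : ℝ) * (1 - δ) ≤ n * 1 := by
        gcongr
        linarith
      nlinarith
  · have hx2 : T / 2 < ‖x‖ := by
      have := hx.2
      rwa [mem_closedBall, dist_zero_right, not_le] at this
    rw [radialWeight_truncatedProfile_of_gt (by linarith)]
    gcongr

theorem lt_supAverage_indicator_of_mem_shell [NeZero n] {t : ℝ} (ht : 0 < t) {x : Fin n → ℝ}
    (h1 : 1 ≤ ‖x‖) (h2 : ‖x‖ ^ n < t⁻¹) :
    ENNReal.ofReal t < supAverage ((closedBall (0 : Fin n → ℝ) 1).indicator fun _ => 1) x := by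
  have hx0 : 0 < ‖x‖ := by linarith
  refine lt_of_lt_of_le ?_
    (setLAverage_le_supAverage _ hx0 (show x ∈ closedBall 0 ‖x‖ by simp))
  rw [setLAverage_closedBall, lintegral_indicator measurableSet_closedBall,
    Measure.restrict_restrict measurableSet_closedBall,
    inter_eq_left.2 (closedBall_subset_closedBall h1), setLIntegral_one,
    volume_closedBall_eq_ofReal _ zero_le_one, volume_closedBall_eq_ofReal _ hx0.le,
    ← ENNReal.ofReal_div_of_pos (by positivity)]
  have : (2 * 1 : ℝ) ^ n / (2 * ‖x‖) ^ n = (‖x‖ ^ n)⁻¹ := by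
    rw [mul_one, mul_pow]
    field_simp
  rw [this]
  refine (ENNReal.ofReal_lt_ofReal_iff (by positivity)).2 ?_
  rw [lt_inv_comm₀ ht (by positivity)]
  exact h2

/-- For f the indicator of the unit cube, t^q w{Mf > t}^(q/p) is at least a constant times
t^(δ(p-1)q/p) for small t. Its integral against dt/t is of order 1/δ, whereas w of the unit cube is
only of order δ^(p-1). -/
theorem exists_le_maximalNorm_truncated_weight [NeZero n] {p : ℝ} (hp : 1 < p) {q : ℝ≥0∞}
    (hq : q ≠ 0) (hqt : q ≠ ∞) :
    ∃ c : ℝ, 0 < c ∧ ∀ δ : ℝ, 0 < δ → δ < 1 →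
      ENNReal.ofReal (c * δ ^ (-((p - 1) / p + 1 / q.toReal))) ≤
        maximalNorm p q (radialWeight n p (truncatedProfile n δ)) := by
  have hp0 : 0 < p := by linarith
  have hp1 : 0 < p - 1 := by linarith
  have hq0 : 0 < q.toReal := ENNReal.toReal_pos hq hqt
  set q' := q.toReal with hq'
  set θ := q' / p with hθ
  have hθ0 : 0 < θ := by positivity
  set κ := (p - 1) * θ with hκ
  have hκ0 : 0 < κ := by positivity
  -- For t ≤ b the radius T = t^(-1/n) is at least 2, so the shell between T/2 and T lies outside
  -- the unit cube.
  set b : ℝ := (2 ^ n)⁻¹ with hb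
  have hb0 : 0 < b := by positivity
  set c₁ : ℝ := (2 ^ (n * (p - 1)))⁻¹ with hc₁
  have hc₁0 : 0 < c₁ := by positivity
  set c₀ : ℝ := c₁ ^ θ * b ^ κ * q' / (κ * (2 ^ n) ^ θ) with hc₀
  have hc₀0 : 0 < c₀ := by positivity
  refine ⟨c₀ ^ (1 / q'), by positivity, fun δ hδ hδ1 => ?_⟩
  set w := radialWeight n p (truncatedProfile n δ) with hw
  have hwt : IsWeight w := (truncated_weight_constants hp hδ hδ1).1.1
  set f : (Fin n → ℝ) → ℝ := (closedBall 0 1).indicator fun _ => 1 with hf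
  have hfm : Measurable f := measurable_const.indicator measurableSet_closedBall
  have hφ : (fun x => ‖f x‖ₑ) = (closedBall 0 1).indicator fun _ => 1 := by
    ext x
    by_cases hx : x ∈ closedBall (0 : Fin n → ℝ) 1
    · simp [hf, hx]
    · simp [hf, hx]
  have hset : ∀ t : ℝ, 0 < t → {x | ENNReal.ofReal t <
      (closedBall (0 : Fin n → ℝ) 1).indicator (fun _ => (1 : ℝ≥0∞)) x} =
        if t < 1 then closedBall 0 1 else ∅ := by
    intro t ht
    ext x
    by_cases hx : x ∈ closedBall (0 : Fin n → ℝ) 1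
    · split_ifs with h <;> simp_all
    · split_ifs with h <;> simp_all
  set m := weightMeasure w (closedBall 0 1) with hm
  have hm0 : m ≠ 0 := hwt.weightMeasure_pos (volume_closedBall_ne_zero _ one_pos)
  have hmle : m ≤ ENNReal.ofReal (δ ^ (p - 1) * 2 ^ n) := by
    have := weightMeasure_le_of_le (w := w) (E := closedBall 0 1) measurableSet_closedBall
      (a := δ ^ (p - 1)) fun x hx => by
        rw [mem_closedBall, dist_zero_right] at hx
        exact (radialWeight_truncatedProfile_of_le hδ hx).le
    rwa [volume_closedBall_eq_ofReal _ zero_le_one, mul_one,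
      ← ENNReal.ofReal_mul (by positivity)] at this
  have hmT : m ≠ ∞ := (hmle.trans_lt ENNReal.ofReal_lt_top).ne
  have hF0 : ∀ t, 0 < t → t < 1 → m ≤ weightMeasure w {x | ENNReal.ofReal t <
      (closedBall (0 : Fin n → ℝ) 1).indicator (fun _ => (1 : ℝ≥0∞)) x} := fun t ht ht1 => by
    rw [hset t ht, if_pos ht1]
  have hn0 : lorentzNorm p q w (fun x => ‖f x‖ₑ) ≠ 0 := by
    rw [hφ, lorentzNorm_eq_distNorm]
    exact distNorm_ne_zero hp0 hq hm0 hF0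
  have hnT : lorentzNorm p q w (fun x => ‖f x‖ₑ) ≠ ∞ := by
    rw [hφ, lorentzNorm_eq_distNorm]
    refine distNorm_ne_top hp0 hq hmT (lt_add_one p) (fun t ht => ?_) fun t ht => ?_
    · rw [hset t ht]
      split_ifs
      · exact le_rfl
      · simp
    · rw [hset t (by linarith), if_neg (not_lt.2 ht)]
      simp
  refine le_maximalNorm hfm (not_ae_zero_of_closedBall one_pos fun x hx _ => by
    rw [hf, indicator_of_mem hx]; exact one_ne_zero) hn0 hnT ?_
  rw [hφ]
  have hX : ENNReal.ofReal (c₁ ^ θ * (b ^ κ / (δ * κ))) ≤ powIntegral q' (fun t =>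
      weightMeasure w {x | ENNReal.ofReal t < supAverage
        ((closedBall (0 : Fin n → ℝ) 1).indicator fun _ => (1 : ℝ≥0∞)) x} ^ θ) := by
    have hδκ : 0 < δ * κ := by positivity
    have hb1 : b ≤ 1 := inv_le_one_of_one_le₀ (one_le_pow₀ one_le_two)
    calc ENNReal.ofReal (c₁ ^ θ * (b ^ κ / (δ * κ)))
        ≤ ENNReal.ofReal (c₁ ^ θ) * ENNReal.ofReal (b ^ (δ * κ) / (δ * κ)) := by
          rw [← ENNReal.ofReal_mul (by positivity)]
          apply ENNReal.ofReal_le_ofReal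
          -- As b ≤ 1 and δ < 1, this removes δ from the constant.
          have : b ^ κ ≤ b ^ (δ * κ) := Real.rpow_le_rpow_of_exponent_ge hb0 hb1 (by nlinarith)
          gcongr
      _ = ∫⁻ t in Ioc 0 b, ENNReal.ofReal (c₁ ^ θ) * ENNReal.ofReal (t ^ (δ * κ - 1)) := by
          rw [← setLIntegral_Ioc_rpow hb0 hδκ, lintegral_const_mul' _ _ ENNReal.ofReal_ne_top]
      _ ≤ ∫⁻ t in Ioc 0 b, ENNReal.ofReal t ^ q' * weightMeasure w {x | ENNReal.ofReal t <
            supAverage ((closedBall (0 : Fin n → ℝ) 1).indicator fun _ => (1 : ℝ≥0∞)) x} ^ θ /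
              ENNReal.ofReal t := by
          refine setLIntegral_mono' measurableSet_Ioc fun t ht => ?_
          have ht0 := ht.1
          set T := t⁻¹ ^ (1 / (n : ℝ)) with hT
          have hTn : T ^ n = t⁻¹ := by
            rw [hT, one_div, Real.rpow_inv_natCast_pow (by positivity) (NeZero.ne n)]
          have hT0 : 0 ≤ T := by positivity
          have hT2 : 2 ≤ T := by
            refine le_of_pow_le_pow_left₀ (NeZero.ne n) hT0 ?_
            rw [hTn, le_inv_comm₀ (by positivity) ht0]
            exact ht.2
          have hshell := le_weightMeasure_shell (n := n) hp hδ hδ1 hT2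
          rw [hTn] at hshell
          have hsub : (ball (0 : Fin n → ℝ) T \ closedBall 0 (T / 2)) ⊆ {x | ENNReal.ofReal t <
              supAverage ((closedBall (0 : Fin n → ℝ) 1).indicator fun _ => (1 : ℝ≥0∞)) x} := by
            rintro x ⟨hx1, hx2⟩
            rw [mem_ball, dist_zero_right] at hx1
            rw [mem_closedBall, dist_zero_right, not_le] at hx2
            refine lt_supAverage_indicator_of_mem_shell ht0 (by linarith) ?_
            rw [← hTn]
            exact pow_lt_pow_left₀ hx1 (norm_nonneg x) (NeZero.ne n)
          have hlow := ENNReal.rpow_le_rpow (hshell.trans (measure_mono hsub)) hθ0.le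
          rw [ofReal_rpow_mul_div ht0]
          refine le_trans (le_of_eq ?_) (mul_le_mul_left hlow _)
          rw [ENNReal.ofReal_rpow_of_pos (by positivity), ← ENNReal.ofReal_mul (by positivity),
            ← ENNReal.ofReal_mul (by positivity), Real.mul_rpow hc₁0.le (by positivity), mul_assoc,
            Real.inv_rpow ht0.le, ← Real.rpow_neg ht0.le, ← Real.rpow_mul ht0.le,
            ← Real.rpow_add ht0]
          congr 3
          rw [hκ, hθ]
          field_simp
          ring
      _ ≤ _ := lintegral_mono_set Ioc_subset_Ioi_self
  have hY : powIntegral q' (fun t => weightMeasure w {x | ENNReal.ofReal t <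
      (closedBall (0 : Fin n → ℝ) 1).indicator (fun _ => (1 : ℝ≥0∞)) x} ^ θ) ≤
        ENNReal.ofReal ((2 ^ n) ^ θ * δ ^ κ / q') := by
    rw [powIntegral, ← Ioc_union_Ioi_eq_Ioi (zero_le_one : (0:ℝ) ≤ 1)]
    refine (lintegral_union_le _ _ _).trans ?_
    have h2 : ∫⁻ t in Ioi (1 : ℝ), ENNReal.ofReal t ^ q' * weightMeasure w {x | ENNReal.ofReal t <
        (closedBall (0 : Fin n → ℝ) 1).indicator (fun _ => (1 : ℝ≥0∞)) x} ^ θ /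
          ENNReal.ofReal t = 0 := by
      rw [setLIntegral_congr_fun (g := fun _ => 0) measurableSet_Ioi fun t ht => ?_, lintegral_zero]
      have ht : 1 < t := ht
      simp only
      rw [hset t (by linarith), if_neg (not_lt.2 ht.le), measure_empty,
        ENNReal.zero_rpow_of_pos hθ0, mul_zero, ENNReal.zero_div]
    rw [h2, add_zero]
    calc _ ≤ ∫⁻ t in Ioc (0 : ℝ) 1, ENNReal.ofReal ((δ ^ (p - 1) * 2 ^ n) ^ θ) *
          ENNReal.ofReal (t ^ (q' - 1)) := by
          refine setLIntegral_mono' measurableSet_Ioc fun t ht => ?_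
          rw [ofReal_rpow_mul_div ht.1,
            ← ENNReal.ofReal_rpow_of_pos (show 0 < δ ^ (p - 1) * 2 ^ n by positivity)]
          refine mul_le_mul_left (ENNReal.rpow_le_rpow ?_ hθ0.le) _
          rw [hset t ht.1]
          split_ifs
          · exact hmle
          · simp
      _ = _ := by
          rw [lintegral_const_mul' _ _ ENNReal.ofReal_ne_top, setLIntegral_Ioc_rpow one_pos hq0,
            ← ENNReal.ofReal_mul (by positivity), Real.mul_rpow (by positivity) (by positivity),
            ← Real.rpow_mul hδ.le, Real.one_rpow]
          congr 1
          rw [hκ]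
          ring
  have hq'i : 0 ≤ 1 / q' := by positivity
  have hZ : ENNReal.ofReal (c₀ ^ (1 / q') * δ ^ (-((p - 1) / p + 1 / q'))) =
      ENNReal.ofReal (c₀ * δ ^ (-(κ + 1))) ^ (1 / q') := by
    rw [ENNReal.ofReal_rpow_of_pos (by positivity), Real.mul_rpow hc₀0.le (by positivity),
      ← Real.rpow_mul hδ.le]
    congr 3
    rw [hκ, hθ]
    field_simp
  rw [lorentzNorm_eq_distNorm, lorentzNorm_eq_distNorm, distNorm, if_neg hqt, distNorm, if_neg hqt,
    hZ, ← ENNReal.mul_rpow_of_nonneg _ _ hq'i]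
  refine ENNReal.rpow_le_rpow ?_ hq'i
  rw [mul_left_comm]
  refine mul_le_mul_right (le_trans (mul_le_mul_right hY _) (le_trans (le_of_eq ?_) hX)) _
  rw [← ENNReal.ofReal_mul (by positivity)]
  congr 1
  rw [hc₀, neg_add, Real.rpow_add hδ, Real.rpow_neg hδ.le, Real.rpow_neg_one]
  field_simp

/-! ### Optimality of the exponents -/

/-- A family `w_δ` with `[w_δ]_{A_p} ≲ δ^{-(p-1)}`, `[σ_δ]_{A_∞} ≲ δ^{-1}` and
`‖M‖ ≳ δ^{-γ}` excludes all mixed bounds whose right-hand side is `o(δ^{-γ})`. -/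
theorem not_mixedBoundOn_of_family {p : ℝ} (hp : 1 < p) {q : ℝ≥0∞}
    {v : ℝ → (Fin n → ℝ) → ℝ} {V : Set ((Fin n → ℝ) → ℝ)} {k c γ : ℝ} (hk : 0 < k) (hc : 0 < c)
    (hV : ∀ δ, 0 < δ → δ < 1 → v δ ∈ V) (hcl : ∀ δ, 0 < δ → δ < 1 → v δ ∈ apClass n p)
    (hA : ∀ δ, 0 < δ → δ < 1 → apConst p (v δ) ≤ ENNReal.ofReal (k / δ) ^ (p - 1))
    (hS : ∀ δ, 0 < δ → δ < 1 → aInftyConst (dualWeight p (v δ)) ≤ ENNReal.ofReal (k / δ))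
    (hM : ∀ δ, 0 < δ → δ < 1 → ENNReal.ofReal (c * δ ^ (-γ)) ≤ maximalNorm p q (v δ))
    {α β : ℝ} (hαβ : (p - 1) * max α 0 + max β 0 < γ) : ¬ MixedBoundOn p q α β V := by
  rintro ⟨C, hC⟩
  -- Upper bounds for the weight constants can be inserted only under nonnegative exponents. Both
  -- constants are at least 1, so increasing the exponents to their positive parts is harmless.
  set α' := max α 0
  set β' := max β 0
  have hα' : 0 ≤ α' := le_max_right _ _
  have hβ' : 0 ≤ β' := le_max_right _ _
  set η := (p - 1) * α' + β' with hη
  have hbound : ∀ δ, 0 < δ → δ < 1 → c * δ ^ (-(γ - η)) ≤ C * k ^ η := by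
    intro δ hδ hδ1
    have hA1 := one_le_apConst hp (hcl δ hδ hδ1).1
    have hS1 := one_le_aInftyConst_dualWeight hp (hcl δ hδ hδ1)
    have hkδ : 0 < k / δ := by positivity
    have h : ENNReal.ofReal (c * δ ^ (-γ)) ≤ ENNReal.ofReal (C * (k / δ) ^ η) := by
      calc _ ≤ maximalNorm p q (v δ) := hM δ hδ hδ1
        _ ≤ C * apConst p (v δ) ^ α * aInftyConst (dualWeight p (v δ)) ^ β := hC _ (hV δ hδ hδ1)
        _ ≤ C * apConst p (v δ) ^ α' * aInftyConst (dualWeight p (v δ)) ^ β' := by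
            gcongr
            · exact le_max_left _ _
            · exact le_max_left _ _
        _ ≤ C * (ENNReal.ofReal (k / δ) ^ (p - 1)) ^ α' * ENNReal.ofReal (k / δ) ^ β' := by
            gcongr
            · exact hA δ hδ hδ1
            · exact hS δ hδ hδ1
        _ = _ := by
            rw [← ENNReal.rpow_mul, mul_assoc, ← ENNReal.rpow_add _ _ (by simpa using hkδ)
              ENNReal.ofReal_ne_top, ← hη, ENNReal.ofReal_rpow_of_pos hkδ,
              ENNReal.ofReal_mul C.coe_nonneg, ENNReal.ofReal_coe_nnreal]
    rw [ENNReal.ofReal_le_ofReal_iff (by positivity), Real.div_rpow hk.le hδ.le] at h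
    have hδη : 0 < δ ^ η := by positivity
    calc c * δ ^ (-(γ - η)) = c * δ ^ (-γ) * δ ^ η := by
          rw [mul_assoc, ← Real.rpow_add hδ]
          congr 2
          ring
      _ ≤ C * (k ^ η / δ ^ η) * δ ^ η := by gcongr
      _ = _ := by field_simp
  have hlim : Tendsto (fun δ : ℝ => c * δ ^ (-(γ - η))) (𝓝[>] 0) atTop :=
    (tendsto_rpow_neg_nhdsGT_zero (by linarith)).const_mul_atTop hc
  have h1 := hlim.eventually (eventually_gt_atTop (C * k ^ η))
  have h2 : ∀ᶠ δ : ℝ in 𝓝[>] 0, δ ∈ Ioo (0 : ℝ) 1 := Ioo_mem_nhdsGT one_pos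
  obtain ⟨δ, h3, h4⟩ := (h1.and h2).exists
  exact absurd (hbound δ h4.1 h4.2) (not_le.2 h3)

theorem exponent_lt_of_alpha {p γ m : ℝ} (hp : 1 < p) (hm : 0 < m) (hγ : γ = (p - 1) / p + m)
    {α : ℝ} (hα : α < 1 / p) : (p - 1) * max α 0 + max m 0 < γ := by
  have hp0 : 0 < 1 / p := by positivity
  have : (p - 1) * max α 0 < (p - 1) * (1 / p) :=
    mul_lt_mul_of_pos_left (max_lt hα hp0) (by linarith)
  rw [max_eq_left hm.le, hγ]
  have : (p - 1) / p = (p - 1) * (1 / p) := by ring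
  linarith

/-- γ is the power of 1/δ given by the sharp exponents 1/p and `m`. Lowering one of them lowers it
strictly, even after passing to the positive part, since both are positive. -/
theorem exponent_lt_of_beta {p γ m : ℝ} (hp : 1 < p) (hm : 0 < m) (hγ : γ = (p - 1) / p + m)
    {β : ℝ} (hβ : β < m) : (p - 1) * max (1 / p) 0 + max β 0 < γ := by
  have hp0 : 0 ≤ 1 / p := by positivity
  have := max_lt hβ hm
  rw [max_eq_left hp0, hγ]
  have : (p - 1) / p = (p - 1) * (1 / p) := by ring
  linarith

/-- For p ≤ q the critical power is (p-1)/p + 1/p = 1, the growth supplied by the power weights. -/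
theorem not_mixedBoundOn_power_weights [NeZero n] {p : ℝ} (hp : 1 < p) {q : ℝ≥0∞} (hq : q ≠ 0)
    (hpq : ENNReal.ofReal p ≤ q) {V : Set ((Fin n → ℝ) → ℝ)}
    (hV : ∀ δ : ℝ, 0 < δ → δ < 1 → radialWeight n p (fun t => t ^ (-(n * (1 - δ)))) ∈ V) :
    (∀ α : ℝ, α < 1 / p → ¬ MixedBoundOn p q α (invMin p q) V) ∧
      ∀ β : ℝ, β < invMin p q → ¬ MixedBoundOn p q (1 / p) β V := by
  have hp0 : 0 < p := by linarith
  have hinv := invMin_pos hp0 hq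
  have hγ : (1 : ℝ) = (p - 1) / p + invMin p q := by
    rw [invMin_of_le hp0.le hpq]
    field_simp
    ring
  have hM : ∀ δ : ℝ, 0 < δ → δ < 1 → ENNReal.ofReal (1 * δ ^ (-1 : ℝ)) ≤
      maximalNorm p q (radialWeight n p (fun t => t ^ (-(n * (1 - δ))))) := fun δ hδ hδ1 => by
    rw [one_mul, Real.rpow_neg_one, ← one_div]
    exact le_maximalNorm_power_weight hp hq hδ hδ1
  have key := fun (α β : ℝ) (h : (p - 1) * max α 0 + max β 0 < 1) =>
    not_mixedBoundOn_of_family hp (q := q) (k := 2 * 3 ^ n) (by positivity) one_pos hV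
      (fun δ hδ hδ1 => (power_weight_constants hp hδ hδ1).1)
      (fun δ hδ hδ1 => (power_weight_constants hp hδ hδ1).2.1)
      (fun δ hδ hδ1 => (power_weight_constants hp hδ hδ1).2.2) hM h
  exact ⟨fun α hα => key α _ (exponent_lt_of_alpha hp hinv hγ hα),
    fun β hβ => key _ β (exponent_lt_of_beta hp hinv hγ hβ)⟩

theorem not_mixedBoundOn_truncated_weights [NeZero n] {p : ℝ} (hp : 1 < p) {q : ℝ≥0∞} (hq : q ≠ 0)
    (hqp : q ≤ ENNReal.ofReal p) {V : Set ((Fin n → ℝ) → ℝ)}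
    (hV : ∀ δ : ℝ, 0 < δ → δ < 1 → radialWeight n p (truncatedProfile n δ) ∈ V) :
    (∀ α : ℝ, α < 1 / p → ¬ MixedBoundOn p q α (invMin p q) V) ∧
      ∀ β : ℝ, β < invMin p q → ¬ MixedBoundOn p q (1 / p) β V := by
  have hp0 : 0 < p := by linarith
  have hinv := invMin_pos hp0 hq
  have hqt : q ≠ ∞ := (hqp.trans_lt ENNReal.ofReal_lt_top).ne
  obtain ⟨c, hc, hM⟩ := exists_le_maximalNorm_truncated_weight (n := n) hp hq hqt
  rw [← invMin_of_ge hqp] at hM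
  have key := fun (α β : ℝ) (h : (p - 1) * max α 0 + max β 0 < (p - 1) / p + invMin p q) =>
    not_mixedBoundOn_of_family hp (q := q) (k := 2 * 3 ^ n) (by positivity) hc hV
      (fun δ hδ hδ1 => (truncated_weight_constants hp hδ hδ1).1)
      (fun δ hδ hδ1 => (truncated_weight_constants hp hδ hδ1).2.1)
      (fun δ hδ hδ1 => (truncated_weight_constants hp hδ hδ1).2.2) hM h
  exact ⟨fun α hα => key α _ (exponent_lt_of_alpha hp hinv rfl hα),
    fun β hβ => key _ β (exponent_lt_of_beta hp hinv rfl hβ)⟩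

/-! ### The explicit families in dimension one -/

theorem norm_fin_one (x : Fin 1 → ℝ) : ‖x‖ = |x 0| := by
  rw [Pi.norm_def]
  simp

theorem radialWeight_power_one (p δ : ℝ) :
    radialWeight 1 p (fun t => t ^ (-((1 : ℕ) * (1 - δ)))) =
      fun x => |x 0| ^ ((p - 1) * (1 - δ)) := by
  ext x
  rw [radialWeight, norm_fin_one, ← Real.rpow_mul (abs_nonneg _)]
  congr 1
  push_cast
  ring

theorem radialWeight_truncated_one (p : ℝ) {δ : ℝ} (hδ : 0 < δ) :
    radialWeight 1 p (truncatedProfile 1 δ) =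
      fun x => if |x 0| ≤ 1 then δ ^ (p - 1) else |x 0| ^ ((1 - δ) * (p - 1)) := by
  ext x
  split_ifs with h
  · exact radialWeight_truncatedProfile_of_le hδ (by rwa [norm_fin_one])
  · rw [radialWeight_truncatedProfile_of_gt (by rw [norm_fin_one]; exact not_le.1 h), norm_fin_one]
    congr 1
    push_cast
    ring

theorem buckleyWeights_subset {p : ℝ} (hp : 1 < p) : buckleyWeights p ⊆ apClass 1 p := by
  rintro _ ⟨δ, ⟨hδ, hδ1⟩, rfl⟩
  have := (power_weight_constants (n := 1) hp hδ hδ1).1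
  rwa [radialWeight_power_one] at this

theorem truncatedWeights_subset {p : ℝ} (hp : 1 < p) : truncatedWeights p ⊆ apClass 1 p := by
  rintro _ ⟨δ, ⟨hδ, hδ1⟩, rfl⟩
  have := (truncated_weight_constants (n := 1) hp hδ hδ1).1
  rwa [radialWeight_truncated_one p hδ] at this

end WeightedLorentz

end

theorem corollary2p2 :
    -- (1) the estimate, with a constant depending only on `n` and `q`
    (∀ n : ℕ, 1 ≤ n → ∀ q : ℝ≥0∞, q ≠ 0 → ∃ C : ℝ≥0, ∀ p : ℝ, 1 < p →
      ∀ w ∈ WeightedLorentz.apClass n p,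
        WeightedLorentz.maximalNorm p q w ≤
          C * ENNReal.ofReal p.conjExponent ^ WeightedLorentz.invMin p q
            * WeightedLorentz.apConst p w ^ (1 / p)
            * WeightedLorentz.aInftyConst (WeightedLorentz.dualWeight p w)
                ^ WeightedLorentz.invMin p q) ∧
    -- (2) neither exponent can be lowered, whatever `n`, `p`, `q` are
    (∀ n : ℕ, 1 ≤ n → ∀ q : ℝ≥0∞, q ≠ 0 → ∀ p : ℝ, 1 < p →
      (∀ α : ℝ, α < 1 / p → ¬ WeightedLorentz.MixedBoundOn p q α
        (WeightedLorentz.invMin p q) (WeightedLorentz.apClass n p)) ∧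
      (∀ β : ℝ, β < WeightedLorentz.invMin p q → ¬ WeightedLorentz.MixedBoundOn p q (1 / p) β
        (WeightedLorentz.apClass n p))) ∧
    -- (2), in dimension one: the explicit families of weights that show it
    (∀ q : ℝ≥0∞, q ≠ 0 → ∀ p : ℝ, 1 < p →
      (ENNReal.ofReal p ≤ q →
        WeightedLorentz.buckleyWeights p ⊆ WeightedLorentz.apClass 1 p ∧
        (∀ α : ℝ, α < 1 / p → ¬ WeightedLorentz.MixedBoundOn p q α
          (WeightedLorentz.invMin p q) (WeightedLorentz.buckleyWeights p)) ∧
        (∀ β : ℝ, β < WeightedLorentz.invMin p q → ¬ WeightedLorentz.MixedBoundOn p q (1 / p) β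
          (WeightedLorentz.buckleyWeights p))) ∧
      (q ≤ ENNReal.ofReal p →
        WeightedLorentz.truncatedWeights p ⊆ WeightedLorentz.apClass 1 p ∧
        (∀ α : ℝ, α < 1 / p → ¬ WeightedLorentz.MixedBoundOn p q α
          (WeightedLorentz.invMin p q) (WeightedLorentz.truncatedWeights p)) ∧
        (∀ β : ℝ, β < WeightedLorentz.invMin p q → ¬ WeightedLorentz.MixedBoundOn p q (1 / p) β
          (WeightedLorentz.truncatedWeights p)))) := by
  refine ⟨fun n hn q hq => ?_, fun n hn q hq p hp => ?_, fun q hq p hp => ⟨fun hpq => ?_,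
    fun hqp => ?_⟩⟩
  · have : NeZero n := ⟨by omega⟩
    exact WeightedLorentz.exists_maximalNorm_le hq
  · have : NeZero n := ⟨by omega⟩
    rcases le_total (ENNReal.ofReal p) q with hpq | hqp
    · exact WeightedLorentz.not_mixedBoundOn_power_weights hp hq hpq
        fun δ hδ hδ1 => (WeightedLorentz.power_weight_constants hp hδ hδ1).1
    · exact WeightedLorentz.not_mixedBoundOn_truncated_weights hp hq hqp
        fun δ hδ hδ1 => (WeightedLorentz.truncated_weight_constants hp hδ hδ1).1
  · refine ⟨WeightedLorentz.buckleyWeights_subset hp,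
      WeightedLorentz.not_mixedBoundOn_power_weights hp hq hpq fun δ hδ hδ1 => ?_⟩
    exact ⟨δ, ⟨hδ, hδ1⟩, (WeightedLorentz.radialWeight_power_one p δ).symm⟩
  · refine ⟨WeightedLorentz.truncatedWeights_subset hp,
      WeightedLorentz.not_mixedBoundOn_truncated_weights hp hq hqp fun δ hδ hδ1 => ?_⟩
    exact ⟨δ, ⟨hδ, hδ1⟩, (WeightedLorentz.radialWeight_truncated_one p hδ).symm⟩
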